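/- Let $m\ge 2$, $t_0\ge 0$, and consider $n$ manipulators $$H_i(q_i)\ddot q_i+C_i(q_i,\dot q_i)\dot q_i+g_i(q_i)+d_i(t)=u_i,\qquad x_i=\psi_i(q_i),\quad \dot x_i=J_i(q_i)\dot q_i,\quad J_i=\partial\psi_i/\partial q_i,$$ $t\ge t_0$, with $q_i\in\mathbb R^{p_i}$, $p_i\ge m$, $x_i\in\mathbb R^m$. Put $J_i^\sharp=J_i^{-1}$ if $p_i=m$ and $J_i^\sharp=J_i^T(J_iJ_i^T)^{-1}$ if $p_i>m$ (redundant), and let $\varphi_i(t,q_i)\in\mathbb R^{p_i}$ be the auxiliary vector describing the subtask. Standing properties, for each $i$: - $H_i$ is $C^1$, symmetric, bounded and uniformly positive definite, $\dot H_i-2C_i$ is skew symmetric, $C_i,g_i$ are continuous, $\|C_i(q,\dot q)\|\le\bar c_i\|\dot q\|$, $g_i$ is bounded, and $d_i$ is measurable and bounded on $[t_0,\infty)$; - $H_i(q)x+C_i(q,\dot q)y+g_i(q)=Y_i(q,\dot q,y,x)\vartheta_i$ with $\vartheta_i$ constant and a continuous regressor $Y_i$ that is bounded, uniformly in $q$,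 for bounded $\dot q,y,x$; - $\psi_i$ is $C^2$, $J_i(q)$ has rank $m$ for every $q$, and $J_i$, $J_i^\sharp$ and the derivative of $J_i$ are bounded; - $\varphi_i$ is $C^1$, and $(I-J_i^\sharp J_i)\varphi_i$ and its derivative in $(t,q)$ are bounded on $[t_0,\infty)\times\mathbb R^{p_i}$. The manipulators communicate over a digraph with weights $\varepsilon_{ij}\ge0$, $\varepsilon_{ii}=0$ ($\varepsilon_{ij}>0$ iff $i$ receives information from $j$, i.e. $j\in\mathcal N_i$), and $b_i\ge0$ ($b_i>0$ iff $i$ receives information from the leader). The leader satisfies $\dot x_0=v_0$, $\dot v_0=a_0$ with $a_0$ differentiable. Assumption A1: in the digraph augmented by the leader, the leader has a directed path to every node. Assumption A2: $\|v_0\|_\infty<\beta_1$, $\|a_0\|_\infty<\beta_2$, $\|\dot a_0\|_\infty<\beta_3$ with $\beta_1,\beta_2,\beta_3>0$, where $\|\cdot\|_\infty$ is the supremum over all $t\ge t_0$ and all components. With $\alpha_i>0$, $\zeta_i=\mathrm{col}(\hat x_i,\hat v_i,\hat a_i)$, $\zeta_0=\mathrm{col}(x_0,v_0,a_0)$ and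 $$\dot{\hat q}_{ri}=J_i^\sharp(\hat v_i-\alpha_i(x_i-\hat x_i))+(I-J_i^\sharp J_i)\varphi_i,$$ $$\ddot{\hat q}_{ri}=\dot J_i^\sharp(\hat v_i-\alpha_i(x_i-\hat x_i))+J_i^\sharp(\hat a_i-\alpha_i(\dot x_i-\hat v_i))+\tfrac{d}{dt}[(I-J_i^\sharp J_i)\varphi_i],\qquad \hat s_i=\dot q_i-\dot{\hat q}_{ri},$$ the distributed controller-estimator algorithm (DCEA) is $$u_i=Y_i(q_i,\dot q_i,\dot{\hat q}_{ri},\ddot{\hat q}_{ri})\hat\vartheta_i-J_i^TK_{xi}J_i\hat s_i-K_{si}\hat s_i-K_{ri}\,\mathrm{sgn}(\hat s_i),$$ $$\dot{\hat\vartheta}_i=-T_iY_i^T(q_i,\dot q_i,\dot{\hat q}_{ri},\ddot{\hat q}_{ri})\hat s_i,\qquad \dot\zeta_i=-\bigl(\mathrm{diag}(\beta_1,\beta_2,\beta_3)\otimes I_m\bigr)\,\mathrm{sgn}\Bigl(\sum_{j\in\mathcal N_i}\varepsilon_{ij}(\zeta_i-\zeta_j)+b_i(\zeta_i-\zeta_0)\Bigr),$$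 where $\mathrm{sgn}$ acts componentwise and $\mathrm{sgn}(0)=0$. The gains $K_{xi},K_{si},K_{ri},T_i$ are symmetric positive definite, $K_{ri}$ and $T_i$ are diagonal, and $\lambda_{\min}(K_{ri})\ge\sup_{t\ge t_0}\|d_i(t)\|$. Suppose that A2 holds. Then the DCEA achieves the control tasks if and only if A1 holds. Here the DCEA achieves the control tasks if the closed-loop system has a Filippov solution on $[t_0,\infty)$ from every initial state at time $t_0$, and along every Filippov solution on $[t_0,\infty)$, as $t\to\infty$, $x_i\to x_0$ and $\dot x_i\to v_0$ (that is, $x_i-x_0\to0$ and $\dot x_i-v_0\to0$) for every $i$ (maintask), and $e_{si}=(I-J_i^\sharp J_i)(\dot q_i-\varphi_i)\to0$ for every $i$ with $p_i>m$ (subtask). -/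

import Mathlib

open Set Filter Topology MeasureTheory
open scoped RealInnerProductSpace

noncomputable section

/-! ### Filippov solutions of differential equations with discontinuous right-hand side -/

/-- The Filippov set-valued map of a vector field `g` at the point `x`:
the intersection, over all radii `δ > 0` and all null sets `N`, of the closed convex hull of
`g (B(x, δ) \ N)`. -/
def filippovMap {X : Type*} [NormedAddCommGroup X] [NormedSpace ℝ X] [MeasureSpace X]
    (g : X → X) (x : X) : Set X :=
  ⋂ (δ : ℝ) (_ : 0 < δ) (N : Set X) (_ : volume N = 0),
    closure (convexHull ℝ (g '' (Metric.ball x δ \ N)))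

/-- `z` is a Filippov solution of `z' = f (t, z)` on `[t₀, ∞)`: it is locally absolutely continuous
and satisfies the Filippov differential inclusion at almost every time. -/
def IsFilippovSolution {X : Type*} [NormedAddCommGroup X] [NormedSpace ℝ X] [MeasureSpace X]
    (f : ℝ → X → X) (t₀ : ℝ) (z : ℝ → X) : Prop :=
  (∀ T, t₀ ≤ T → AbsolutelyContinuousOnInterval z t₀ T) ∧
  ∀ᵐ t ∂(volume.restrict (Ici t₀)), ∃ w ∈ filippovMap (f t) (z t), HasDerivAt z w t

/-! ### Elementary notions -/

/-- `d`-dimensional Euclidean space. -/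
abbrev Euc (d : ℕ) : Type := EuclideanSpace ℝ (Fin d)

/-- Lebesgue measure on Euclidean space (shortcut instance). -/
instance instMeasureSpaceEuc (d : ℕ) : MeasureSpace (Euc d) := measureSpaceOfInnerProductSpace

/-- The componentwise signum function, with `sgn 0 = 0`. -/
def sgn {d : ℕ} (v : Euc d) : Euc d := WithLp.toLp 2 fun l => Real.sign (v l)

/-- The smallest eigenvalue of a real symmetric matrix. -/
def lambdaMin {d : ℕ} (A : Matrix (Fin d) (Fin d) ℝ) : ℝ := sInf (spectrum ℝ A)

/-- The action of a square matrix on Euclidean space. -/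
abbrev matAct {d : ℕ} (A : Matrix (Fin d) (Fin d) ℝ) (v : Euc d) : Euc d :=
  Matrix.toEuclideanLin A v

/-! ### A single manipulator -/

/-- The data of a manipulator with `p` degrees of freedom, task space of dimension `m` and `k`
constant dynamic parameters, together with its disturbance and its subtask vector. -/
structure Manipulator (m p k : ℕ) where
  /-- inertia matrix `H(q)` -/
  H : Euc p → (Euc p →L[ℝ] Euc p)
  /-- centripetal-Coriolis matrix `C(q, q')` -/
  C : Euc p → Euc p → (Euc p →L[ℝ] Euc p)
  /-- gravity vector `g(q)` -/
  g : Euc p → Euc p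
  /-- forward kinematics `ψ(q)` -/
  ψ : Euc p → Euc m
  /-- regressor `Y(q, q', y, x)` -/
  Y : Euc p → Euc p → Euc p → Euc p → (Euc k →L[ℝ] Euc p)
  /-- the constant dynamic parameters -/
  θ : Euc k
  /-- input disturbance `d(t)` -/
  d : ℝ → Euc p
  /-- auxiliary (performance-gradient) vector of the subtask; it may depend on the time and on the
  joint position -/
  φ : ℝ → Euc p → Euc p

namespace Manipulator

variable {m p k : ℕ} (M : Manipulator m p k)

/-- The Jacobian `J(q) = ∂ψ/∂q`. -/
def J (q : Euc p) : Euc p →L[ℝ] Euc m := fderiv ℝ M.ψ q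

/-- `J^♯`: the inverse `J⁻¹` of the Jacobian if `p = m` (nonredundant manipulator), the
pseudoinverse `Jᵀ (J Jᵀ)⁻¹` otherwise (redundant manipulator). -/
def sharp (q : Euc p) : Euc m →L[ℝ] Euc p :=
  if p = m then (M.J q).inverse
  else (ContinuousLinearMap.adjoint (M.J q)).comp
    ((M.J q).comp (ContinuousLinearMap.adjoint (M.J q))).inverse

/-- The projection `I - J^♯ J`. -/
def nullProj (q : Euc p) : Euc p →L[ℝ] Euc p :=
  ContinuousLinearMap.id ℝ (Euc p) - (M.sharp q).comp (M.J q)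

/-- The vector `(I - J^♯ J) φ` as a function of the pair (time, joint position). -/
def nullφ (y : ℝ × Euc p) : Euc p := M.nullProj y.2 (M.φ y.1 y.2)

/-- The standing properties of a manipulator on the time interval `[t₀, ∞)`. -/
structure Regular (t₀ : ℝ) : Prop where
  H_smooth : ContDiff ℝ 1 M.H
  H_symm : ∀ q, IsSelfAdjoint (M.H q)
  H_pos : ∃ h > 0, ∀ q v, h * ‖v‖ ^ 2 ≤ ⟪M.H q v, v⟫
  H_bdd : ∃ c, ∀ q, ‖M.H q‖ ≤ c
  /-- `H' - 2 C` is skew symmetric, where `H'` is the derivative of `H` along the motion. -/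
  skew : ∀ q v w, ⟪(fderiv ℝ M.H q v - (2 : ℝ) • M.C q v) w, w⟫ = 0
  C_cont : Continuous fun y : Euc p × Euc p => M.C y.1 y.2
  C_bdd : ∃ c > 0, ∀ q v, ‖M.C q v‖ ≤ c * ‖v‖
  g_cont : Continuous M.g
  g_bdd : ∃ c, ∀ q, ‖M.g q‖ ≤ c
  d_meas : Measurable M.d
  d_bdd : ∃ c, ∀ t, t₀ ≤ t → ‖M.d t‖ ≤ c
  Y_cont : Continuous fun y : Euc p × Euc p × Euc p × Euc p => M.Y y.1 y.2.1 y.2.2.1 y.2.2.2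
  /-- linear parametrization of the dynamic terms -/
  Y_param : ∀ q v y x, M.H q x + M.C q v y + M.g q = M.Y q v y x M.θ
  /-- the regressor is bounded for bounded velocity and acceleration arguments, uniformly in `q` -/
  Y_bdd : ∀ R : ℝ, ∃ c, ∀ q v y x, ‖v‖ ≤ R → ‖y‖ ≤ R → ‖x‖ ≤ R → ‖M.Y q v y x‖ ≤ c
  ψ_smooth : ContDiff ℝ 2 M.ψ
  /-- no kinematic singularity: the Jacobian has rank `m` -/
  J_surj : ∀ q, Function.Surjective (M.J q)
  J_bdd : ∃ c, ∀ q, ‖M.J q‖ ≤ c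
  sharp_bdd : ∃ c, ∀ q, ‖M.sharp q‖ ≤ c
  J_deriv_bdd : ∃ c, ∀ q, ‖fderiv ℝ M.J q‖ ≤ c
  φ_smooth : ContDiff ℝ 1 fun y : ℝ × Euc p => M.φ y.1 y.2
  nullφ_bdd : ∃ c, ∀ t q, t₀ ≤ t → ‖M.nullφ (t, q)‖ ≤ c
  nullφ_deriv_bdd : ∃ c, ∀ t q, t₀ ≤ t → ‖fderiv ℝ M.nullφ (t, q)‖ ≤ c

end Manipulator

/-- The control gains of a manipulator. -/
structure Gains (m p k : ℕ) where
  Kx : Matrix (Fin m) (Fin m) ℝ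
  Ks : Matrix (Fin p) (Fin p) ℝ
  Kr : Matrix (Fin p) (Fin p) ℝ
  /-- adaptation gain -/
  T : Matrix (Fin k) (Fin k) ℝ
  α : ℝ

/-- The gain conditions. The last one is `λ_min(K_r) ≥ sup_{t ≥ t₀} ‖d(t)‖`. -/
structure Gains.Admissible {m p k : ℕ} (G : Gains m p k) (M : Manipulator m p k) (t₀ : ℝ) :
    Prop where
  Kx_pos : G.Kx.PosDef
  Ks_pos : G.Ks.PosDef
  Kr_pos : G.Kr.PosDef
  Kr_diag : G.Kr.IsDiag
  T_pos : G.T.PosDef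
  T_diag : G.T.IsDiag
  α_pos : 0 < G.α
  Kr_dist : ⨆ t : Ici t₀, ‖M.d t‖ ≤ lambdaMin G.Kr

/-! ### The closed loop of one manipulator -/

/-- The state of one node: `(q, q', ϑ̂, x̂, v̂, â)`, i.e. joint position, joint velocity,
parameter estimate and the three leader estimates, `ζ = (x̂, v̂, â)`. -/
abbrev NodeState (m p k : ℕ) : Type := Euc p × Euc p × Euc k × Euc m × Euc m × Euc m

namespace NodeState

variable {m p k : ℕ} (s : NodeState m p k)

/-- joint position -/
abbrev q : Euc p := s.1
/-- joint velocity -/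
abbrev dq : Euc p := s.2.1
/-- parameter estimate -/
abbrev θhat : Euc k := s.2.2.1
/-- estimate of the leader's position -/
abbrev xhat : Euc m := s.2.2.2.1
/-- estimate of the leader's velocity -/
abbrev vhat : Euc m := s.2.2.2.2.1
/-- estimate of the leader's acceleration -/
abbrev ahat : Euc m := s.2.2.2.2.2

end NodeState

section Loop

variable {m p k : ℕ} (M : Manipulator m p k) (G : Gains m p k) (t : ℝ) (s : NodeState m p k)

/-- Task-space position `x = ψ(q)`. -/
def taskPos : Euc m := M.ψ (NodeState.q s)

/-- Task-space velocity `x' = J(q) q'`. -/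
def taskVel : Euc m := M.J (NodeState.q s) (NodeState.dq s)

/-- Auxiliary joint velocity `q̂_r' = J^♯ (v̂ - α (x - x̂)) + (I - J^♯ J) φ`. -/
def auxVel : Euc p :=
  M.sharp (NodeState.q s)
      (NodeState.vhat s - G.α • (taskPos M s - NodeState.xhat s)) +
    M.nullφ (t, NodeState.q s)

/-- Auxiliary joint acceleration
`(J^♯)' (v̂ - α (x - x̂)) + J^♯ (â - α (x' - v̂)) + d/dt [(I - J^♯ J) φ]`,
the time derivatives being taken along the motion. -/
def auxAcc : Euc p :=
  fderiv ℝ M.sharp (NodeState.q s) (NodeState.dq s)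
      (NodeState.vhat s - G.α • (taskPos M s - NodeState.xhat s)) +
    M.sharp (NodeState.q s)
      (NodeState.ahat s - G.α • (taskVel M s - NodeState.vhat s)) +
    fderiv ℝ M.nullφ (t, NodeState.q s) (1, NodeState.dq s)

/-- `ŝ = q' - q̂_r'`. -/
def sHat : Euc p := NodeState.dq s - auxVel M G t s

/-- The regressor `Y(q, q', q̂_r', q̂_r'')` used by the controller. -/
def regressor : Euc k →L[ℝ] Euc p :=
  M.Y (NodeState.q s) (NodeState.dq s) (auxVel M G t s) (auxAcc M G t s)

/-- The control law `u = Y ϑ̂ - Jᵀ K_x J ŝ - K_s ŝ - K_r sgn ŝ`. -/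
def torque : Euc p :=
  regressor M G t s (NodeState.θhat s)
    - ContinuousLinearMap.adjoint (M.J (NodeState.q s))
        (matAct G.Kx (M.J (NodeState.q s) (sHat M G t s)))
    - matAct G.Ks (sHat M G t s) - matAct G.Kr (sgn (sHat M G t s))

/-- The joint acceleration, from `H q'' + C q' + g + d = u`. -/
def jointAcc : Euc p :=
  (M.H (NodeState.q s)).inverse
    (torque M G t s - M.C (NodeState.q s) (NodeState.dq s) (NodeState.dq s)
      - M.g (NodeState.q s) - M.d t)

/-- The parameter adaptation law `ϑ̂' = - T Yᵀ ŝ`. -/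
def adaptation : Euc k :=
  -matAct G.T (ContinuousLinearMap.adjoint (regressor M G t s) (sHat M G t s))

/-- The subtask tracking error `e_s = (I - J^♯ J) (q' - φ)`. -/
def subtaskError : Euc p :=
  M.nullProj (NodeState.q s) (NodeState.dq s - M.φ t (NodeState.q s))

end Loop

/-! ### The leader and the network -/

/-- The leader's position, velocity, acceleration and derivative of the acceleration. -/
structure Leader (m : ℕ) where
  x : ℝ → Euc m
  v : ℝ → Euc m
  a : ℝ → Euc m
  da : ℝ → Euc m

/-- The leader's signals are successive derivatives of each other on `[t₀, ∞)`. -/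
structure Leader.IsTrajectory {m : ℕ} (L : Leader m) (t₀ : ℝ) : Prop where
  x_deriv : ∀ t, t₀ ≤ t → HasDerivWithinAt L.x (L.v t) (Ici t₀) t
  v_deriv : ∀ t, t₀ ≤ t → HasDerivWithinAt L.v (L.a t) (Ici t₀) t
  a_deriv : ∀ t, t₀ ≤ t → HasDerivWithinAt L.a (L.da t) (Ici t₀) t

/-- `‖w‖_∞ < β`: the supremum over all times `t ≥ t₀` and all components of `|w|` is smaller
than `β`. -/
def SupNormLT {m : ℕ} (w : ℝ → Euc m) (t₀ β : ℝ) : Prop :=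
  ∃ c < β, ∀ t, t₀ ≤ t → ∀ l, |w t l| ≤ c

/-- A network of `n` manipulators with common task-space dimension `m`. -/
structure Network (n m : ℕ) where
  /-- degrees of freedom -/
  p : Fin n → ℕ
  /-- number of dynamic parameters -/
  k : Fin n → ℕ
  plant : ∀ i, Manipulator m (p i) (k i)
  gain : ∀ i, Gains m (p i) (k i)
  /-- weighted adjacency matrix; `ε i j > 0` if and only if node `i` receives information from
  node `j` -/
  ε : Matrix (Fin n) (Fin n) ℝ
  /-- `b i > 0` if and only if node `i` receives information from the leader -/
  b : Fin n → ℝ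
  β₁ : ℝ
  β₂ : ℝ
  β₃ : ℝ

namespace Network

variable {n m : ℕ} (S : Network n m)

/-- The state of the whole network. -/
abbrev State : Type := ∀ i : Fin n, NodeState m (S.p i) (S.k i)

/-- The argument of the signum function in the estimator of node `i`, for the estimates `y` of a
leader signal with current value `y₀`: `∑_{j ∈ N_i} ε_ij (y_i - y_j) + b_i (y_i - y₀)`. -/
def disagreement (y : Fin n → Euc m) (y₀ : Euc m) (i : Fin n) : Euc m :=
  (∑ j with 0 < S.ε i j, S.ε i j • (y i - y j)) + S.b i • (y i - y₀)

/-- The right-hand side of the closed-loop system: manipulators, control law, adaptation law and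
distributed estimators. -/
def closedLoop (L : Leader m) (t : ℝ) (z : S.State) : S.State := fun i =>
  (NodeState.dq (z i),
   jointAcc (S.plant i) (S.gain i) t (z i),
   adaptation (S.plant i) (S.gain i) t (z i),
   -(S.β₁ • sgn (S.disagreement (fun j => NodeState.xhat (z j)) (L.x t) i)),
   -(S.β₂ • sgn (S.disagreement (fun j => NodeState.vhat (z j)) (L.v t) i)),
   -(S.β₃ • sgn (S.disagreement (fun j => NodeState.ahat (z j)) (L.a t) i)))

/-- The edges of the digraph augmented by the leader (`none`): information flows from the leader
to `i` if `b i > 0` and from `j` to `i` if `ε i j > 0`. -/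
def Edge : Option (Fin n) → Option (Fin n) → Prop
  | none, some i => 0 < S.b i
  | some j, some i => 0 < S.ε i j
  | _, none => False

/-- The leader has a directed path to every node. -/
def LeaderReachesAll : Prop := ∀ i : Fin n, Relation.TransGen S.Edge none (some i)

/-- Along the network trajectory `z`, every end-effector tracks the leader, in position and in
velocity. -/
def MainTask (L : Leader m) (z : ℝ → S.State) : Prop :=
  ∀ i, Tendsto (fun t => taskPos (S.plant i) (z t i) - L.x t) atTop (𝓝 0) ∧
    Tendsto (fun t => taskVel (S.plant i) (z t i) - L.v t) atTop (𝓝 0)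

/-- Along the network trajectory `z`, the subtask error of every redundant manipulator tends to
zero. -/
def SubTask (z : ℝ → S.State) : Prop :=
  ∀ i, m < S.p i → Tendsto (fun t => subtaskError (S.plant i) t (z t i)) atTop (𝓝 0)

/-- The closed loop achieves the control tasks: from every initial state there is a Filippov
solution on `[t₀, ∞)`, and along every Filippov solution on `[t₀, ∞)` both tasks are achieved. -/
def AchievesTasks (L : Leader m) (t₀ : ℝ) : Prop :=
  (∀ z₀ : S.State, ∃ z : ℝ → S.State, z t₀ = z₀ ∧ IsFilippovSolution (S.closedLoop L) t₀ z) ∧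
  ∀ z : ℝ → S.State, IsFilippovSolution (S.closedLoop L) t₀ z → S.MainTask L z ∧ S.SubTask z

/-- The standing assumptions on the network. -/
structure Standing (t₀ : ℝ) : Prop where
  dof : ∀ i, m ≤ S.p i
  regular : ∀ i, (S.plant i).Regular t₀
  ε_nonneg : ∀ i j, 0 ≤ S.ε i j
  ε_diag : ∀ i, S.ε i i = 0
  b_nonneg : ∀ i, 0 ≤ S.b i

end Network

end

noncomputable section

/-! ### Absolutely continuous functions -/

/-! Sufficiency. The estimators do not depend on the manipulators. In each component the estimation
errors satisfy e' = -β σ - (leader derivative), with σ a generalized sign of the disagreement. When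
the largest error is positive and the leader reaches every node, some node attaining it has positive
disagreement (`exists_max_scalarDisagreement_pos`), so the largest error decreases at a rate equal
to the gap between β and the bound on the leader signal. The same holds for the negated errors, so
all estimates equal the leader signals after a finite time (`estimates_eventually_eq`).

From then on the estimates are successive derivatives of each other and the auxiliary acceleration
is the true derivative of the auxiliary velocity. The energy ½ŝᵀHŝ + ½(ϑ̂-ϑ)ᵀT⁻¹(ϑ̂-ϑ) then
satisfies V' ≤ -ŝᵀK_sŝ: skew symmetry removes the Coriolis term, adaptation removes the parameter
error, and K_r sgn ŝ dominates the disturbance (`deriv_nodeEnergy_le`). All signals that determine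
ŝ' are bounded, so ŝ is Lipschitz and tends to 0 by a Barbalat argument. The tracking error solves
r' = Jŝ - αr and the subtask error is the null-space projection of ŝ, so both vanish in the limit
(`node_converges`).

Existence. The field jumps in the state, along surfaces that move with time, and is only measurable
in time through the disturbance. Limits of Euler polygons are Krasovskii solutions
(`exists_krasovskii_solution`): a displacement of the state undoes the motion of the surfaces, and
Lebesgue points handle the disturbance. The energy estimate gives an a priori bound on bounded
intervals, and a cutoff makes the solution global (`exists_global_solution`). Krasovskii solutions
are Filippov solutions here because every value of the field is approximated by means of its values
at two points z ± e outside any given null set, where the vanishing sign arguments take opposite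
signs (`field_mem_filippovMap`).

Necessity. The nodes that the leader does not reach receive information only from each other. If all
their estimates start at (c, 0, 0), their disagreements vanish and, as sgn 0 = 0, there is a
solution along which these estimates stay constant. Such a node satisfies x_i → c by
`node_converges`, so achieving the tasks forces x₀ → c for every c, which is absurd
(`tendsto_of_not_transGen`). -/

theorem LipschitzOnWith.comp_absolutelyContinuousOnInterval {X Y : Type*} [PseudoMetricSpace X]
    [PseudoMetricSpace Y] {F : X → Y} {γ : ℝ → X} {s : Set X} {K : NNReal} {a b : ℝ}
    (hF : LipschitzOnWith K F s) (hγ : AbsolutelyContinuousOnInterval γ a b)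
    (hs : MapsTo γ (uIcc a b) s) : AbsolutelyContinuousOnInterval (fun t => F (γ t)) a b := by
  rw [absolutelyContinuousOnInterval_iff] at hγ ⊢
  intro ε hε
  obtain ⟨δ, hδ, h⟩ := hγ (ε / (K + 1)) (by positivity)
  refine ⟨δ, hδ, fun E hE hlt => ?_⟩
  have h1 := h E hE hlt
  have h2 : ∑ i ∈ Finset.range E.1, dist (F (γ (E.2 i).1)) (F (γ (E.2 i).2)) ≤
      (K + 1) * ∑ i ∈ Finset.range E.1, dist (γ (E.2 i).1) (γ (E.2 i).2) := by
    rw [Finset.mul_sum]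
    refine Finset.sum_le_sum fun i hi => ?_
    have := hF.dist_le_mul _ (hs (hE.1 i hi).1) _ (hs (hE.1 i hi).2)
    nlinarith [dist_nonneg (x := γ (E.2 i).1) (y := γ (E.2 i).2)]
  calc _ ≤ _ := h2
    _ < (K + 1) * (ε / (K + 1)) := by gcongr
    _ = ε := by field_simp

/-- An absolutely continuous curve stays in a ball, and a C¹ map is Lipschitz on closed balls of a
finite-dimensional space. -/
theorem ContDiff.comp_absolutelyContinuousOnInterval {E F : Type*} [NormedAddCommGroup E]
    [NormedSpace ℝ E] [FiniteDimensional ℝ E] [NormedAddCommGroup F] [NormedSpace ℝ F]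
    {Φ : E → F} (hΦ : ContDiff ℝ 1 Φ) {γ : ℝ → E} {a b : ℝ}
    (hγ : AbsolutelyContinuousOnInterval γ a b) :
    AbsolutelyContinuousOnInterval (fun t => Φ (γ t)) a b := by
  obtain ⟨R, hR⟩ := hγ.exists_bound
  have := FiniteDimensional.proper_real E
  obtain ⟨K, hK⟩ := (hΦ.contDiffOn (s := Metric.closedBall (0 : E) R)).exists_lipschitzOnWith
    (by decide) (convex_closedBall _ _) (isCompact_closedBall _ _)
  exact hK.comp_absolutelyContinuousOnInterval hγ fun t ht => by simpa using hR t ht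

theorem AbsolutelyContinuousOnInterval.prodMk {X Y : Type*} [PseudoMetricSpace X]
    [PseudoMetricSpace Y] {f : ℝ → X} {g : ℝ → Y} {a b : ℝ}
    (hf : AbsolutelyContinuousOnInterval f a b) (hg : AbsolutelyContinuousOnInterval g a b) :
    AbsolutelyContinuousOnInterval (fun t => (f t, g t)) a b := by
  rw [absolutelyContinuousOnInterval_iff] at *
  intro ε hε
  obtain ⟨δ, hδ, h⟩ := hf (ε / 2) (by positivity)
  obtain ⟨δ', hδ', h'⟩ := hg (ε / 2) (by positivity)
  refine ⟨min δ δ', lt_min hδ hδ', fun E hE hlt => ?_⟩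
  have h1 := h E hE (hlt.trans_le (min_le_left _ _))
  have h2 := h' E hE (hlt.trans_le (min_le_right _ _))
  have h3 : ∑ i ∈ Finset.range E.1, dist (f (E.2 i).1, g (E.2 i).1) (f (E.2 i).2, g (E.2 i).2) ≤
      ∑ i ∈ Finset.range E.1, dist (f (E.2 i).1) (f (E.2 i).2) +
        ∑ i ∈ Finset.range E.1, dist (g (E.2 i).1) (g (E.2 i).2) := by
    rw [← Finset.sum_add_distrib]
    refine Finset.sum_le_sum fun i _ => ?_
    exact max_le (le_add_of_nonneg_right dist_nonneg) (le_add_of_nonneg_left dist_nonneg)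
  linarith

theorem AbsolutelyContinuousOnInterval.id (a b : ℝ) :
    AbsolutelyContinuousOnInterval (fun t : ℝ => t) a b :=
  (LipschitzWith.id.lipschitzOnWith (s := uIcc a b)).absolutelyContinuousOnInterval

/-- An absolutely continuous function whose derivative is at most `c` almost everywhere grows at
most at rate `c`. -/
theorem AbsolutelyContinuousOnInterval.sub_le_of_deriv_le {g : ℝ → ℝ} {a b c : ℝ} (hab : a ≤ b)
    (hg : AbsolutelyContinuousOnInterval g a b)
    (h : ∀ᵐ t ∂volume.restrict (Icc a b), ∀ d, HasDerivAt g d t → d ≤ c) :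
    g b - g a ≤ c * (b - a) := by
  rw [← hg.integral_deriv_eq_sub]
  have h1 : ∀ᵐ t ∂volume.restrict (Icc a b), deriv g t ≤ c := by
    have := hg.ae_differentiableAt
    rw [uIcc_of_le hab, ← ae_restrict_iff' measurableSet_Icc] at this
    filter_upwards [this, h] with t h1 h2 using h2 _ h1.hasDerivAt
  calc _ ≤ ∫ _ in a..b, c := intervalIntegral.integral_mono_ae_restrict hab
        hg.intervalIntegrable_deriv intervalIntegrable_const h1
    _ = c * (b - a) := by simp [mul_comm]

theorem ae_restrict_Icc_mono {a b c d : ℝ} {P : ℝ → Prop}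
    (h : ∀ᵐ t ∂volume.restrict (Icc a b), P t) (hac : a ≤ c) (hdb : d ≤ b) :
    ∀ᵐ t ∂volume.restrict (Icc c d), P t :=
  ae_restrict_of_ae_restrict_of_subset (Icc_subset_Icc hac hdb) h

theorem ae_restrict_Icc_of_Ici {a c d : ℝ} {P : ℝ → Prop}
    (h : ∀ᵐ t ∂volume.restrict (Ici a), P t) (hac : a ≤ c) :
    ∀ᵐ t ∂volume.restrict (Icc c d), P t :=
  ae_restrict_of_ae_restrict_of_subset (Icc_subset_Ici_self.trans (Ici_subset_Ici.2 hac)) h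

theorem AbsolutelyContinuousOnInterval.mono_Icc {X : Type*} [PseudoMetricSpace X] {f : ℝ → X}
    {a b c d : ℝ} (h : AbsolutelyContinuousOnInterval f a b) (hac : a ≤ c) (hcd : c ≤ d)
    (hdb : d ≤ b) : AbsolutelyContinuousOnInterval f c d := by
  refine h.mono ?_
  rw [uIcc_of_le hcd, uIcc_of_le (hac.trans (hcd.trans hdb))]
  exact Icc_subset_Icc hac hdb

theorem AbsolutelyContinuousOnInterval.antitoneOn {g : ℝ → ℝ} {a b : ℝ}
    (hg : AbsolutelyContinuousOnInterval g a b)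
    (h : ∀ᵐ t ∂volume.restrict (Icc a b), ∀ d, HasDerivAt g d t → d ≤ 0) :
    AntitoneOn g (Icc a b) := by
  intro s hs t ht hst
  have := (hg.mono_Icc hs.1 hst ht.2).sub_le_of_deriv_le hst (ae_restrict_Icc_mono h hs.1 ht.2)
  linarith

/-- Grönwall's inequality for `y' ≤ c y + k` almost everywhere. -/
theorem AbsolutelyContinuousOnInterval.exp_mul_le {y : ℝ → ℝ} {a b c k : ℝ} (hab : a ≤ b)
    (hc : c ≠ 0) (hy : AbsolutelyContinuousOnInterval y a b)
    (h : ∀ᵐ t ∂volume.restrict (Icc a b), ∀ d, HasDerivAt y d t → d ≤ c * y t + k) :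
    y b + k / c ≤ Real.exp (c * (b - a)) * (y a + k / c) := by
  have hconst : AbsolutelyContinuousOnInterval (fun _ : ℝ => k / c) a b :=
    ((LipschitzWith.const (k / c)).lipschitzOnWith (s := uIcc a b)).absolutelyContinuousOnInterval
  have hexp : AbsolutelyContinuousOnInterval (fun t : ℝ => Real.exp (-(c * t))) a b := by
    refine ContDiffOn.absolutelyContinuousOnInterval (ContDiff.contDiffOn ?_)
    fun_prop
  -- Integrating factor: exp(-ct)(y + k/c) is shown to be nonincreasing.
  have hmul := hexp.mul (hy.add hconst)
  have hae := hy.ae_differentiableAt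
  rw [uIcc_of_le hab, ← ae_restrict_iff' measurableSet_Icc] at hae
  have := hmul.sub_le_of_deriv_le (c := 0) hab (by
    filter_upwards [h, hae] with t ht hyt d hd
    have h1 : HasDerivAt (fun t : ℝ => Real.exp (-(c * t))) (Real.exp (-(c * t)) * (-c)) t := by
      have := ((hasDerivAt_id t).const_mul c).neg.exp
      simpa using this
    have h2 := h1.mul (hyt.hasDerivAt.add_const (k / c))
    have h3 := hd.unique h2
    have h4 := ht _ hyt.hasDerivAt
    rw [h3]
    have h5 : Real.exp (-(c * t)) * -c * (y t + k / c) + Real.exp (-(c * t)) * deriv y t =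
        Real.exp (-(c * t)) * (deriv y t - (c * y t + k)) := by field_simp; ring
    rw [h5]
    exact mul_nonpos_of_nonneg_of_nonpos (Real.exp_pos _).le (by linarith))
  simp only [Pi.mul_apply, Pi.add_apply, zero_mul, sub_nonpos] at this
  have e1 : Real.exp (c * (b - a)) = Real.exp (c * b) * Real.exp (-(c * a)) := by
    rw [← Real.exp_add]; ring_nf
  have e2 : Real.exp (c * b) * Real.exp (-(c * b)) = 1 := by rw [← Real.exp_add]; simp
  calc y b + k / c = Real.exp (c * b) * (Real.exp (-(c * b)) * (y b + k / c)) := by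
        rw [← mul_assoc, e2, one_mul]
    _ ≤ Real.exp (c * b) * (Real.exp (-(c * a)) * (y a + k / c)) := by gcongr
    _ = _ := by rw [e1]; ring

/-- A nonnegative absolutely continuous function that decreases at rate `κ` as long as it is
positive vanishes after a finite time. -/
theorem eventually_eq_zero_of_deriv_le {M : ℝ → ℝ} {t₀ κ : ℝ} (hκ : 0 < κ)
    (hM : ∀ T, t₀ ≤ T → AbsolutelyContinuousOnInterval M t₀ T) (h0 : ∀ t, 0 ≤ M t)
    (h : ∀ᵐ t ∂volume.restrict (Ici t₀), 0 < M t → ∀ d, HasDerivAt M d t → d ≤ -κ) :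
    ∃ T, t₀ ≤ T ∧ ∀ t, T ≤ t → M t = 0 := by
  have hanti : ∀ T, AntitoneOn M (Icc t₀ T) := by
    intro T
    rcases le_or_gt t₀ T with hT | hT
    swap
    · rw [Icc_eq_empty hT.not_ge]; exact fun _ h => h.elim
    refine (hM T hT).antitoneOn ?_
    filter_upwards [ae_restrict_Icc_of_Ici h le_rfl] with t ht d hd
    rcases (h0 t).lt_or_eq with hp | hz
    · linarith [ht hp d hd]
    -- M is nonnegative, so each of its zeros is a minimum and a derivative there must vanish.
    · have hmin : IsLocalMin M t := Eventually.of_forall fun s => hz ▸ h0 s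
      exact (hmin.hasDerivAt_eq_zero hd).le
  -- At rate κ the initial value M t₀ is used up after the time M t₀ / κ.
  refine ⟨t₀ + M t₀ / κ, le_add_of_nonneg_right (div_nonneg (h0 _) hκ.le), fun t ht => ?_⟩
  have htt : t₀ ≤ t := le_trans (le_add_of_nonneg_right (div_nonneg (h0 _) hκ.le)) ht
  by_contra hne
  have hpos : 0 < M t := lt_of_le_of_ne (h0 t) (Ne.symm hne)
  have := (hM t htt).sub_le_of_deriv_le (c := -κ) htt (by
    filter_upwards [ae_restrict_Icc_of_Ici h (le_refl t₀), ae_restrict_mem measurableSet_Icc]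
      with s hs hsm d hd
    exact hs (hpos.trans_le (hanti t hsm ⟨htt, le_rfl⟩ hsm.2)) d hd)
  have h2 : M t₀ ≤ κ * (t - t₀) := by
    have : M t₀ / κ ≤ t - t₀ := by linarith
    rwa [div_le_iff₀ hκ, mul_comm] at this
  linarith

/-- If `y ≥ 0` and `y' ≤ -c y + k` almost everywhere, then `y` stays bounded. -/
theorem AbsolutelyContinuousOnInterval.le_of_deriv_le {y : ℝ → ℝ} {a b c k : ℝ} (hab : a ≤ b)
    (hc : 0 < c) (hk : 0 ≤ k) (hya : 0 ≤ y a) (hy : AbsolutelyContinuousOnInterval y a b)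
    (h : ∀ᵐ t ∂volume.restrict (Icc a b), ∀ d, HasDerivAt y d t → d ≤ -c * y t + k) :
    y b ≤ y a + k / c := by
  have h1 := hy.exp_mul_le hab (neg_ne_zero.2 hc.ne') h
  have h2 : Real.exp (-c * (b - a)) ≤ 1 := by
    rw [Real.exp_le_one_iff]; nlinarith
  have h3 := Real.exp_pos (-c * (b - a))
  rw [div_neg] at h1
  have h4 : 0 ≤ k / c := by positivity
  nlinarith

/-- If `y ≥ 0` and `y' ≤ -c y + k` almost everywhere with `k → 0`, then `y → 0`. -/
theorem tendsto_zero_of_deriv_le {y k : ℝ → ℝ} {t₀ c : ℝ} (hc : 0 < c) (hy0 : ∀ t, 0 ≤ y t)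
    (hy : ∀ T, t₀ ≤ T → AbsolutelyContinuousOnInterval y t₀ T)
    (hk : Tendsto k atTop (𝓝 0))
    (h : ∀ᵐ t ∂volume.restrict (Ici t₀), ∀ d, HasDerivAt y d t → d ≤ -c * y t + k t) :
    Tendsto y atTop (𝓝 0) := by
  rw [Metric.tendsto_atTop]
  intro ε hε
  obtain ⟨T, hT⟩ := eventually_atTop.1 (hk.eventually (gt_mem_nhds (show 0 < c * (ε / 2) by positivity)))
  set a := max T t₀
  have hlim : Tendsto (fun t => Real.exp (-c * (t - a)) * y a) atTop (𝓝 0) := by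
    have h1 : Tendsto (fun t => -c * (t - a)) atTop atBot :=
      (tendsto_atTop_add_const_right _ (-a) tendsto_id).const_mul_atTop_of_neg (neg_lt_zero.2 hc)
    simpa using (Real.tendsto_exp_atBot.comp h1).mul_const (y a)
  obtain ⟨T', hT'⟩ := eventually_atTop.1 (hlim.eventually (gt_mem_nhds (show 0 < ε / 2 by positivity)))
  refine ⟨max T' a, fun t ht => ?_⟩
  have hat : a ≤ t := (le_max_right _ _).trans ht
  -- Once k ≤ cε/2, Grönwall's inequality with rate -c pulls y towards ε/2; the transient term is
  -- below ε/2 after T'.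
  have h1 := ((hy t ((le_max_right _ _).trans hat)).mono_Icc (le_max_right T t₀) hat le_rfl).exp_mul_le
    (k := c * (ε / 2)) hat (neg_ne_zero.2 hc.ne') (by
      filter_upwards [ae_restrict_Icc_of_Ici h (le_max_right T t₀),
        ae_restrict_mem measurableSet_Icc] with s hs hsm d hd
      have := hs d hd
      have := hT s ((le_max_left _ _).trans hsm.1)
      linarith)
  have h2 := hT' t ((le_max_left _ _).trans ht)
  have h3 : c * (ε / 2) / -c = -(ε / 2) := by field_simp
  rw [h3] at h1
  have h4 := Real.exp_pos (-c * (t - a))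
  rw [Real.dist_eq, sub_zero, abs_of_nonneg (hy0 t)]
  nlinarith

/-- Barbalat-type lemma: if `V` decreases at least at rate `c ‖s‖²` and is bounded below, and `s` is
Lipschitz, then `s → 0`. -/
theorem tendsto_zero_of_lyapunov {E : Type*} [NormedAddCommGroup E] {s : ℝ → E} {V : ℝ → ℝ}
    {t₀ c : ℝ} {K : NNReal} (hc : 0 < c) (hs : LipschitzOnWith K s (Ici t₀)) (hV0 : ∀ t, 0 ≤ V t)
    (hV : ∀ T, t₀ ≤ T → AbsolutelyContinuousOnInterval V t₀ T)
    (h : ∀ᵐ t ∂volume.restrict (Ici t₀), ∀ d, HasDerivAt V d t → d ≤ -c * ‖s t‖ ^ 2) :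
    Tendsto s atTop (𝓝 0) := by
  have hdec : ∀ a b r, t₀ ≤ a → a ≤ b → 0 ≤ r → (∀ u ∈ Icc a b, r ≤ ‖s u‖) →
      V b - V a ≤ -c * r ^ 2 * (b - a) := by
    intro a b r ha hab hr hu
    refine ((hV b (ha.trans hab)).mono_Icc ha hab le_rfl).sub_le_of_deriv_le hab ?_
    filter_upwards [ae_restrict_Icc_of_Ici h ha, ae_restrict_mem measurableSet_Icc]
      with u hu' hm d hd
    have h1 := hu' d hd
    have h2 : r ^ 2 ≤ ‖s u‖ ^ 2 := pow_le_pow_left₀ hr (hu u hm) 2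
    nlinarith
  have hanti : AntitoneOn V (Ici t₀) := by
    intro a ha b _ hab
    have := hdec a b 0 ha hab le_rfl fun u _ => norm_nonneg _
    simp at this; exact this
  set ℓ := sInf (V '' Ici t₀)
  have hbdd : BddBelow (V '' Ici t₀) := ⟨0, by rintro _ ⟨t, -, rfl⟩; exact hV0 t⟩
  rw [Metric.tendsto_atTop]
  intro ε hε
  -- If ‖s t‖ ≥ ε, the Lipschitz bound keeps ‖s‖ ≥ ε/2 during a time η, so V loses at least
  -- c(ε/2)²η. This is impossible once V is closer than that to its infimum ℓ.
  set η := ε / (2 * (K + 1)) with hη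
  have hηp : 0 < η := by positivity
  have hgap : 0 < c * (ε / 2) ^ 2 * η := by positivity
  obtain ⟨_, ⟨T, hT, rfl⟩, hlt⟩ := exists_lt_of_csInf_lt ((nonempty_Ici (a := t₀)).image V)
    (lt_add_of_pos_right ℓ hgap)
  refine ⟨T, fun t ht => ?_⟩
  rw [dist_zero_right]
  by_contra! hge
  have ht₀ : t₀ ≤ t := le_trans hT ht
  have h1 := hdec t (t + η) (ε / 2) ht₀ (by linarith) (by positivity) (by
    intro u hu
    have h2 := hs.dist_le_mul t ht₀ u (ht₀.trans hu.1)
    have h3 : dist t u ≤ η := by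
      rw [Real.dist_eq, abs_sub_comm, abs_of_nonneg (by linarith [hu.1])]; linarith [hu.2]
    have h4 : (K : ℝ) * dist t u ≤ ε / 2 := by
      calc (K : ℝ) * dist t u ≤ (K + 1) * η := by gcongr; linarith
        _ = ε / 2 := by rw [hη]; field_simp
    have h5 : ‖s t‖ ≤ ‖s u‖ + dist (s t) (s u) := by
      rw [dist_eq_norm]
      simpa using norm_add_le (s u) (s t - s u)
    linarith)
  have h2 : ℓ ≤ V (t + η) := csInf_le hbdd ⟨t + η, by rw [mem_Ici]; linarith, rfl⟩
  have h3 := hanti hT ht₀ ht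
  have h4 : -c * (ε / 2) ^ 2 * (t + η - t) = -(c * (ε / 2) ^ 2 * η) := by ring
  rw [h4] at h1
  linarith

/-! ### Existence of Krasovskii solutions -/

/-- The Krasovskii set-valued map of a vector field. -/
def krasovskiiMap {X : Type*} [NormedAddCommGroup X] [NormedSpace ℝ X] (g : X → X) (x : X) :
    Set X :=
  ⋂ (δ : ℝ) (_ : 0 < δ), closure (convexHull ℝ (g '' Metric.ball x δ))

/-- Lebesgue differentiation along balls that contain t without being centred at it: [t, t + h] is
the closed ball with centre t + h/2 and radius h/2. -/
theorem ae_tendsto_average_norm_sub_right {E : Type*} [NormedAddCommGroup E] [NormedSpace ℝ E]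
    [CompleteSpace E] {d : ℝ → E} (hd : LocallyIntegrable d) :
    ∀ᵐ t, Tendsto (fun h : ℝ => h⁻¹ * ∫ s in t..t + h, ‖d s - d t‖) (𝓝[>] 0) (𝓝 0) := by
  filter_upwards [IsUnifLocDoublingMeasure.ae_tendsto_average_norm_sub volume hd 1] with t ht
  have h1 := ht (l := 𝓝[>] (0 : ℝ)) (fun h : ℝ => t + h / 2) (fun h : ℝ => h / 2) (by
    refine tendsto_nhdsWithin_iff.2 ⟨?_, ?_⟩
    · have : Tendsto (fun h : ℝ => h / 2) (𝓝 0) (𝓝 (0 / 2)) := tendsto_id.div_const 2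
      rw [zero_div] at this
      exact this.mono_left nhdsWithin_le_nhds
    · filter_upwards [self_mem_nhdsWithin] with h hh
      exact half_pos (mem_Ioi.1 hh)) (by
    filter_upwards [self_mem_nhdsWithin] with h hh
    have : (0 : ℝ) < h := hh
    rw [Metric.mem_closedBall, Real.dist_eq, abs_sub_comm, abs_of_nonneg] <;> linarith)
  refine h1.congr' ?_
  filter_upwards [self_mem_nhdsWithin] with h hh
  have hh : (0 : ℝ) < h := hh
  rw [setAverage_eq, Real.closedBall_eq_Icc, integral_Icc_eq_integral_Ioc,
    intervalIntegral.integral_of_le (by linarith)]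
  have e1 : t + h / 2 - h / 2 = t := by ring
  have e2 : t + h / 2 + h / 2 = t + h := by ring
  simp [measureReal_def, e1, e2, hh.le]

/-! ### Euler polygons with the state frozen over each time step. -/

section Euler

variable {X : Type*} [NormedAddCommGroup X] [NormedSpace ℝ X]

/-- The values at the nodes `t₀ + k h` of the Euler-type polygon that integrates the vector field
with frozen state over each time step. -/
def eulerNode (f : ℝ → X → X) (t₀ h : ℝ) (z₀ : X) : ℕ → X
  | 0 => z₀
  | k + 1 => eulerNode f t₀ h z₀ k + ∫ s in t₀ + k * h..t₀ + (k + 1) * h, f s (eulerNode f t₀ h z₀ k)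

/-- The piecewise constant state along the polygon. -/
def eulerStep (f : ℝ → X → X) (t₀ h : ℝ) (z₀ : X) (s : ℝ) : X :=
  eulerNode f t₀ h z₀ ⌊(s - t₀) / h⌋₊

/-- The Euler-type polygon. -/
def eulerCurve (f : ℝ → X → X) (t₀ h : ℝ) (z₀ : X) (t : ℝ) : X :=
  z₀ + ∫ s in t₀..t, f s (eulerStep f t₀ h z₀ s)

variable [FiniteDimensional ℝ X] [MeasurableSpace X] [BorelSpace X]
  {f : ℝ → X → X} {t₀ h : ℝ} {z₀ : X}

theorem measurable_eulerField (hf : ∀ x, Measurable fun t => f t x) :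
    Measurable fun s => f s (eulerStep f t₀ h z₀ s) := by
  have h1 : Measurable fun p : ℕ × ℝ => f p.2 (eulerNode f t₀ h z₀ p.1) :=
    measurable_from_prod_countable_right fun k => hf (eulerNode f t₀ h z₀ k)
  have h2 : Measurable fun s : ℝ => (⌊(s - t₀) / h⌋₊, s) :=
    (Nat.measurable_floor.comp ((measurable_id.sub_const t₀).div_const h)).prodMk measurable_id
  exact h1.comp h2

variable {B : ℝ → ℝ}

theorem intervalIntegrable_of_bounded {g : ℝ → X} (hg : Measurable g) {T C : ℝ}
    (hC : ∀ t ∈ Icc t₀ T, ‖g t‖ ≤ C) {a b : ℝ} (ha : a ∈ Icc t₀ T) (hb : b ∈ Icc t₀ T) :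
    IntervalIntegrable g volume a b := by
  have : FiniteDimensional ℝ X := inferInstance
  have : ProperSpace X := FiniteDimensional.proper_real X
  have := secondCountable_of_proper (α := X)
  have hsub : uIoc a b ⊆ Icc t₀ T := uIoc_subset_uIcc.trans (uIcc_subset_Icc ha hb)
  rw [intervalIntegrable_iff]
  refine Measure.integrableOn_of_bounded (M := C) ?_ hg.aestronglyMeasurable ?_
  · simp
  · filter_upwards [ae_restrict_mem measurableSet_uIoc] with t ht using hC t (hsub ht)

theorem intervalIntegrable_eulerField (hf : ∀ x, Measurable fun t => f t x) {T C : ℝ}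
    (hC : ∀ t ∈ Icc t₀ T, ∀ x, ‖f t x‖ ≤ C) {a b : ℝ} (ha : a ∈ Icc t₀ T) (hb : b ∈ Icc t₀ T) :
    IntervalIntegrable (fun s => f s (eulerStep f t₀ h z₀ s)) volume a b :=
  intervalIntegrable_of_bounded (measurable_eulerField hf) (fun t ht => hC t ht _) ha hb

theorem eulerCurve_sub (hf : ∀ x, Measurable fun t => f t x) {T C : ℝ}
    (hC : ∀ t ∈ Icc t₀ T, ∀ x, ‖f t x‖ ≤ C) {a b : ℝ} (ha : a ∈ Icc t₀ T) (hb : b ∈ Icc t₀ T) :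
    eulerCurve f t₀ h z₀ b - eulerCurve f t₀ h z₀ a =
      ∫ s in a..b, f s (eulerStep f t₀ h z₀ s) := by
  have ht₀ : t₀ ∈ Icc t₀ T := ⟨le_rfl, ha.1.trans ha.2⟩
  rw [eulerCurve, eulerCurve, add_sub_add_left_eq_sub,
    intervalIntegral.integral_interval_sub_left (intervalIntegrable_eulerField hf hC ht₀ hb)
      (intervalIntegrable_eulerField hf hC ht₀ ha)]

theorem norm_eulerCurve_sub_le (hf : ∀ x, Measurable fun t => f t x) {T C : ℝ}
    (hC : ∀ t ∈ Icc t₀ T, ∀ x, ‖f t x‖ ≤ C) {a b : ℝ} (ha : a ∈ Icc t₀ T) (hb : b ∈ Icc t₀ T) :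
    ‖eulerCurve f t₀ h z₀ b - eulerCurve f t₀ h z₀ a‖ ≤ C * |b - a| := by
  rw [eulerCurve_sub hf hC ha hb]
  refine intervalIntegral.norm_integral_le_of_norm_le_const fun s hs => hC s ?_ _
  exact uIoc_subset_uIcc.trans (uIcc_subset_Icc ha hb) hs

theorem eulerCurve_node (hf : ∀ x, Measurable fun t => f t x) (hh : 0 < h) {T C : ℝ}
    (hC : ∀ t ∈ Icc t₀ T, ∀ x, ‖f t x‖ ≤ C) :
    ∀ k : ℕ, t₀ + k * h ≤ T → eulerCurve f t₀ h z₀ (t₀ + k * h) = eulerNode f t₀ h z₀ k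
  | 0, _ => by simp [eulerCurve, eulerNode]
  | k + 1, hk => by
    push_cast at hk
    have hkh : (0 : ℝ) ≤ k * h := by positivity
    have ha : t₀ + k * h ∈ Icc t₀ T := ⟨by linarith, by linarith⟩
    have hb : t₀ + (k + 1) * h ∈ Icc t₀ T := ⟨by linarith, hk⟩
    have h1 := eulerCurve_sub (h := h) (z₀ := z₀) hf hC ha hb
    rw [eulerCurve_node hf hh hC k ha.2, sub_eq_iff_eq_add'] at h1
    push_cast
    rw [h1, eulerNode]
    congr 1
    have hle : t₀ + k * h ≤ t₀ + (k + 1) * h := by linarith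
    rw [intervalIntegral.integral_of_le hle, intervalIntegral.integral_of_le hle,
      integral_Ioc_eq_integral_Ioo, integral_Ioc_eq_integral_Ioo]
    refine setIntegral_congr_fun measurableSet_Ioo fun s hs => ?_
    -- The floor is constant only on the half-open step; passing to the open interval discards the
    -- end points, which are null.
    have : ⌊(s - t₀) / h⌋₊ = k := by
      rw [Nat.floor_eq_iff (div_nonneg (by linarith [hs.1]) hh.le), le_div_iff₀ hh, div_lt_iff₀ hh]
      exact ⟨by linarith [hs.1], by linarith [hs.2]⟩
    simp only [eulerStep, this]

/-- The frozen state is the polygon at the last node, at most h earlier, and the polygon moves with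
speed at most C. -/
theorem norm_eulerStep_sub_le (hf : ∀ x, Measurable fun t => f t x) (hh : 0 < h) {T C : ℝ}
    (hC : ∀ t ∈ Icc t₀ T, ∀ x, ‖f t x‖ ≤ C) {s : ℝ} (hs : s ∈ Icc t₀ T) :
    ‖eulerStep f t₀ h z₀ s - eulerCurve f t₀ h z₀ s‖ ≤ C * h := by
  have h0 : 0 ≤ (s - t₀) / h := div_nonneg (by linarith [hs.1]) hh.le
  have h1 := Nat.floor_le h0
  have h2 := Nat.lt_floor_add_one ((s - t₀) / h)
  rw [le_div_iff₀ hh] at h1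
  rw [div_lt_iff₀ hh] at h2
  set k := ⌊(s - t₀) / h⌋₊ with hk
  have hkh : (0 : ℝ) ≤ k * h := by positivity
  have ha : t₀ + k * h ∈ Icc t₀ T := ⟨by linarith, by linarith [hs.2]⟩
  rw [eulerStep, ← hk, ← eulerCurve_node hf hh hC k ha.2]
  have hC0 : 0 ≤ C := (norm_nonneg _).trans (hC s hs 0)
  refine (norm_eulerCurve_sub_le hf hC hs ha).trans ?_
  gcongr
  rw [abs_sub_comm, abs_of_nonneg] <;> linarith

variable {Z : Type*} [NormedAddCommGroup Z] [NormedSpace ℝ Z] [CompleteSpace Z]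

/-- Since the field has no π-component on the fibre of `z₀`, the polygon never leaves this fibre. In
the proof of necessity this keeps the estimates of unreachable nodes constant, although other
Filippov solutions may leave the fibre. -/
theorem map_eulerNode (hf : ∀ x, Measurable fun t => f t x) (hh : 0 < h)
    (hC : ∀ T, ∃ C, ∀ t ∈ Icc t₀ T, ∀ x, ‖f t x‖ ≤ C) (π : X →L[ℝ] Z)
    (hπ : ∀ t, t₀ ≤ t → ∀ x, π x = π z₀ → π (f t x) = 0) :
    ∀ k : ℕ, π (eulerNode f t₀ h z₀ k) = π z₀
  | 0 => rfl
  | k + 1 => by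
    have ih := map_eulerNode hf hh hC π hπ k
    have hkh : (0 : ℝ) ≤ k * h := by positivity
    obtain ⟨C, hC⟩ := hC (t₀ + (k + 1) * h)
    have hi : IntervalIntegrable (fun s => f s (eulerNode f t₀ h z₀ k)) volume (t₀ + k * h)
        (t₀ + (k + 1) * h) :=
      intervalIntegrable_of_bounded (hf _) (fun t ht => hC t ht _) ⟨by linarith, by linarith⟩
        ⟨by linarith, le_rfl⟩
    rw [eulerNode, map_add, ih, ← π.intervalIntegral_comp_comm hi,
      intervalIntegral.integral_congr (g := fun _ => 0), intervalIntegral.integral_zero, add_zero]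
    intro s hs
    rw [uIcc_of_le (by linarith)] at hs
    exact hπ s (by linarith [hs.1]) _ ih

theorem map_eulerCurve (hf : ∀ x, Measurable fun t => f t x) (hh : 0 < h)
    (hC : ∀ T, ∃ C, ∀ t ∈ Icc t₀ T, ∀ x, ‖f t x‖ ≤ C) (π : X →L[ℝ] Z)
    (hπ : ∀ t, t₀ ≤ t → ∀ x, π x = π z₀ → π (f t x) = 0) {t : ℝ} (ht : t₀ ≤ t) :
    π (eulerCurve f t₀ h z₀ t) = π z₀ := by
  obtain ⟨C, hC'⟩ := hC t
  rw [eulerCurve, map_add, ← π.intervalIntegral_comp_comm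
    (intervalIntegrable_eulerField hf hC' ⟨le_rfl, ht⟩ ⟨ht, le_rfl⟩),
    intervalIntegral.integral_congr (g := fun _ => 0), intervalIntegral.integral_zero, add_zero]
  intro s hs
  rw [uIcc_of_le ht] at hs
  exact hπ s hs.1 _ (map_eulerNode hf hh hC π hπ _)

variable {E : Type*} [NormedAddCommGroup E] [NormedSpace ℝ E] [CompleteSpace E]

/-- Existence of Krasovskii solutions for vector fields that are bounded on bounded time intervals,
measurable in time, and whose dependence on time is, up to a displacement of the state, controlled
by a locally integrable function. -/
theorem exists_krasovskii_solution (hf : ∀ x, Measurable fun t => f t x)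
    (hC : ∀ T, ∃ C, ∀ t ∈ Icc t₀ T, ∀ x, ‖f t x‖ ≤ C) {d : ℝ → E} (hd : LocallyIntegrable d)
    (hH : ∀ t x, ∃ C, 0 ≤ C ∧ ∀ δ > 0, ∀ᶠ p in 𝓝 (t, x), ∃ y ∈ Metric.ball x δ,
      ‖f p.1 p.2 - f t y‖ ≤ δ + C * ‖d p.1 - d t‖)
    (π : X →L[ℝ] Z) (hπ : ∀ t, t₀ ≤ t → ∀ x, π x = π z₀ → π (f t x) = 0) :
    ∃ z : ℝ → X, z t₀ = z₀ ∧ (∀ T, ∃ K, LipschitzOnWith K z (Icc t₀ T)) ∧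
      (∀ t, t₀ ≤ t → π (z t) = π z₀) ∧
      ∀ᵐ t ∂volume.restrict (Ici t₀), ∃ w ∈ krasovskiiMap (f t) (z t), HasDerivAt z w t := by
  have : ProperSpace X := FiniteDimensional.proper_real X
  set η : ℕ → ℝ := fun n => 1 / ((n : ℝ) + 1) with hη
  have hηp : ∀ n, 0 < η n := fun n => Nat.one_div_pos_of_nat
  have hη0 : Tendsto η (hyperfilter ℕ) (𝓝 0) :=
    tendsto_one_div_add_atTop_nhds_zero_nat.mono_left Nat.hyperfilter_le_atTop
  set Zn : ℕ → ℝ → X := fun n => eulerCurve f t₀ (η n) z₀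
  have hZ0 : ∀ n, Zn n t₀ = z₀ := fun n => by simp [Zn, eulerCurve]
  -- Along an ultrafilter the bounded sequences `Zn n t` converge for all t at once, so no
  -- subsequence has to be chosen; the Lipschitz bounds pass to the limit.
  have hex : ∀ t, t₀ ≤ t → ∃ x, Tendsto (fun n => Zn n t) (hyperfilter ℕ) (𝓝 x) := by
    intro t ht
    obtain ⟨C, hC⟩ := hC t
    have hmem : ∀ n, Zn n t ∈ Metric.closedBall z₀ (C * |t - t₀|) := fun n => by
      rw [mem_closedBall_iff_norm, ← hZ0 n]
      exact norm_eulerCurve_sub_le hf hC ⟨le_rfl, ht⟩ ⟨ht, le_rfl⟩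
    obtain ⟨x, -, hx⟩ := (isCompact_closedBall z₀ (C * |t - t₀|)).ultrafilter_le_nhds'
      ((hyperfilter ℕ).map fun n => Zn n t) (Ultrafilter.mem_map.2 (univ_mem' hmem))
    exact ⟨x, hx⟩
  choose! z hz using hex
  have hLip : ∀ T C, (∀ t ∈ Icc t₀ T, ∀ x, ‖f t x‖ ≤ C) → ∀ a ∈ Icc t₀ T, ∀ b ∈ Icc t₀ T,
      ‖z b - z a‖ ≤ C * |b - a| := fun T C hC a ha b hb =>
    le_of_tendsto ((hz b hb.1).sub (hz a ha.1)).norm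
      (Eventually.of_forall fun n => norm_eulerCurve_sub_le hf hC ha hb)
  have hLip' : ∀ T, ∃ K, LipschitzOnWith K z (Icc t₀ T) := by
    intro T
    obtain ⟨C, hC⟩ := hC T
    refine ⟨C.toNNReal, LipschitzOnWith.of_dist_le_mul fun a ha b hb => ?_⟩
    rw [dist_eq_norm, Real.dist_eq]
    refine (hLip T C hC b hb a ha).trans ?_
    gcongr
    exact Real.le_coe_toNNReal C
  refine ⟨z, ?_, hLip', ?_, ?_⟩
  · exact tendsto_nhds_unique (hz t₀ le_rfl) (by simp only [hZ0]; exact tendsto_const_nhds)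
  · intro t ht
    refine tendsto_nhds_unique ((π.continuous.tendsto _).comp (hz t ht)) ?_
    have : ∀ n, π (Zn n t) = π z₀ := fun n => map_eulerCurve hf (hηp n) hC π hπ ht
    simp only [Function.comp_def, this]
    exact tendsto_const_nhds
  have hdiff : ∀ᵐ t ∂volume.restrict (Ici t₀), t₀ < t → DifferentiableAt ℝ z t := by
    have h1 : ∀ n : ℕ, ∀ᵐ t, t ∈ Icc t₀ (t₀ + n) →
        DifferentiableWithinAt ℝ z (Icc t₀ (t₀ + n)) t := by
      intro n
      obtain ⟨K, hK⟩ := hLip' (t₀ + n)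
      exact hK.ae_differentiableWithinAt_of_mem
    filter_upwards [ae_restrict_of_ae (ae_all_iff.2 h1)] with t ht htt
    obtain ⟨n, hn⟩ := exists_nat_gt (t - t₀)
    exact (ht n ⟨htt.le, by linarith⟩).differentiableAt (Icc_mem_nhds htt (by linarith))
  have hne : ∀ᵐ t ∂volume.restrict (Ici t₀), t ≠ t₀ :=
    ae_restrict_of_ae (Measure.ae_ne volume t₀)
  filter_upwards [hdiff, hne, ae_restrict_mem measurableSet_Ici,
    ae_restrict_of_ae (ae_tendsto_average_norm_sub_right hd)] with t htd hne hmem hdt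
  have ht₀ : t₀ < t := lt_of_le_of_ne hmem hne.symm
  refine ⟨deriv z t, ?_, (htd ht₀).hasDerivAt⟩
  obtain ⟨C, hC0, hCH⟩ := hH t (z t)
  obtain ⟨B, hB⟩ := hC (t + 1)
  have hB0 : 0 ≤ B := (norm_nonneg _).trans (hB t ⟨ht₀.le, by linarith⟩ 0)
  simp only [krasovskiiMap, mem_iInter]
  intro δ₀ hδ₀
  -- Otherwise a functional ℓ strictly separates the derivative from the closed convex hull. The
  -- contradiction comes from bounding ℓ on right difference quotients of the polygons, with an
  -- error δ that finally tends to 0.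
  by_contra hnot
  obtain ⟨ℓ, u, hu, hul⟩ := geometric_hahn_banach_closed_point
    (convex_convexHull ℝ _).closure isClosed_closure hnot
  have key : ∀ δ > 0, δ ≤ δ₀ → ℓ (deriv z t) ≤ u + ‖ℓ‖ * δ := by
    intro δ hδ hδ'
    obtain ⟨r, hr, hball⟩ := Metric.eventually_nhds_iff_ball.1 (hCH δ hδ)
    have hpt : ∀ s ∈ Metric.ball t r, ∀ y ∈ Metric.ball (z t) r,
        ℓ (f s y) ≤ u + ‖ℓ‖ * (δ + C * ‖d s - d t‖) := by
      intro s hs y hy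
      obtain ⟨y', hy', hle⟩ := hball (s, y) (by
        rw [← ball_prod_same]; exact ⟨hs, hy⟩)
      have h1 : ℓ (f t y') ≤ u := (hu _ (subset_closure (subset_convexHull ℝ _
        ⟨y', Metric.ball_subset_ball hδ' hy', rfl⟩))).le
      have h2 : ℓ (f s y - f t y') ≤ ‖ℓ‖ * (δ + C * ‖d s - d t‖) :=
        (le_abs_self _).trans ((ℓ.le_opNorm _).trans (by gcongr))
      rw [map_sub] at h2
      linarith
    have hquot : ∀ᶠ h in 𝓝[>] (0 : ℝ), ℓ (h⁻¹ • (z (t + h) - z t)) ≤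
        u + ‖ℓ‖ * δ + ‖ℓ‖ * C * (h⁻¹ * ∫ s in t..t + h, ‖d s - d t‖) := by
      -- h < 1 stays on the time interval where B bounds the field, and h < r keeps the time in the
      -- good neighbourhood. The last condition gives B h ≤ r/3: the frozen state is within r of `z
      -- t`, with r/3 each for the Euler step, the motion since time t, and the distance of the
      -- polygon from its limit.
      have hsmall : ∀ᶠ h in 𝓝[>] (0 : ℝ), h < min 1 (min r (r / (3 * (B + 1)))) :=
        nhdsWithin_le_nhds (gt_mem_nhds (by positivity))
      filter_upwards [hsmall, self_mem_nhdsWithin] with h hlt hpos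
      have hpos : 0 < h := hpos
      obtain ⟨hl1, hl2, hl3⟩ : h < 1 ∧ h < r ∧ h < r / (3 * (B + 1)) := by
        simpa [lt_min_iff] using hlt
      have hBh : B * h ≤ r / 3 := by
        rw [lt_div_iff₀ (by positivity)] at hl3; nlinarith
      have hn : ∀ᶠ n in (hyperfilter ℕ : Filter ℕ), ℓ (Zn n (t + h) - Zn n t) ≤
          h * (u + ‖ℓ‖ * δ) + ‖ℓ‖ * C * ∫ s in t..t + h, ‖d s - d t‖ := by
        have h1 : ∀ᶠ n in (hyperfilter ℕ : Filter ℕ), Zn n t ∈ Metric.ball (z t) (r / 3) :=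
          (hz t ht₀.le).eventually (Metric.ball_mem_nhds _ (by positivity))
        have h2 : ∀ᶠ n in (hyperfilter ℕ : Filter ℕ), B * η n < r / 3 := by
          have : Tendsto (fun n => B * η n) (hyperfilter ℕ) (𝓝 (B * 0)) := hη0.const_mul B
          rw [mul_zero] at this
          exact this.eventually (gt_mem_nhds (by positivity))
        filter_upwards [h1, h2] with n hn1 hn2
        have hta : t ∈ Icc t₀ (t + 1) := ⟨ht₀.le, by linarith⟩
        have htb : t + h ∈ Icc t₀ (t + 1) := ⟨by linarith, by linarith⟩
        have hint := intervalIntegrable_eulerField (h := η n) (z₀ := z₀) hf hB hta htb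
        rw [eulerCurve_sub hf hB hta htb, ← ℓ.intervalIntegral_comp_comm hint]
        have hdi : IntervalIntegrable (fun s => ‖d s - d t‖) volume t (t + h) :=
          ((hd.integrableOn_isCompact isCompact_uIcc).intervalIntegrable.sub intervalIntegrable_const).norm
        have hgi : IntervalIntegrable (fun s => u + ‖ℓ‖ * δ + ‖ℓ‖ * C * ‖d s - d t‖) volume t
            (t + h) := intervalIntegrable_const.add (hdi.const_mul _)
        have hmono := intervalIntegral.integral_mono_on (μ := volume) (a := t) (b := t + h)
          (by linarith) ⟨ℓ.integrable_comp hint.1, ℓ.integrable_comp hint.2⟩ hgi (by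
            intro s hs
            have hsm : s ∈ Icc t₀ (t + 1) := ⟨by linarith [hs.1], by linarith [hs.2]⟩
            have hst : s ∈ Metric.ball t r := by
              rw [Metric.mem_ball, Real.dist_eq, abs_of_nonneg] <;> linarith [hs.1, hs.2]
            have h3 := norm_eulerStep_sub_le (z₀ := z₀) hf (hηp n) hB hsm
            have h4 := norm_eulerCurve_sub_le (h := η n) (z₀ := z₀) hf hB hta hsm
            have h5 : B * |s - t| ≤ r / 3 := by
              refine le_trans ?_ hBh
              gcongr
              rw [abs_of_nonneg] <;> linarith [hs.1, hs.2]
            have h6 : eulerStep f t₀ (η n) z₀ s ∈ Metric.ball (z t) r := by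
              rw [mem_ball_iff_norm] at hn1 ⊢
              calc ‖eulerStep f t₀ (η n) z₀ s - z t‖
                  = ‖(eulerStep f t₀ (η n) z₀ s - Zn n s) + (Zn n s - Zn n t) + (Zn n t - z t)‖ := by
                    congr 1; abel
                _ ≤ _ := norm_add₃_le
                _ < r := by linarith
            have h7 := hpt s hst _ h6
            linarith)
        refine hmono.trans (le_of_eq ?_)
        rw [intervalIntegral.integral_add intervalIntegrable_const (hdi.const_mul _),
          intervalIntegral.integral_const, intervalIntegral.integral_const_mul]
        simp
      have hlim : ℓ (z (t + h) - z t) ≤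
          h * (u + ‖ℓ‖ * δ) + ‖ℓ‖ * C * ∫ s in t..t + h, ‖d s - d t‖ :=
        le_of_tendsto ((ℓ.continuous.tendsto _).comp
          ((hz (t + h) (by linarith)).sub (hz t ht₀.le))) hn
      rw [map_smul, smul_eq_mul]
      calc h⁻¹ * ℓ (z (t + h) - z t) ≤
            h⁻¹ * (h * (u + ‖ℓ‖ * δ) + ‖ℓ‖ * C * ∫ s in t..t + h, ‖d s - d t‖) := by gcongr
        _ = _ := by field_simp
    have hslope : Tendsto (fun h : ℝ => ℓ (h⁻¹ • (z (t + h) - z t))) (𝓝[>] 0)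
        (𝓝 (ℓ (deriv z t))) :=
      (ℓ.continuous.tendsto _).comp
        (((hasDerivAt_iff_tendsto_slope_zero.1 (htd ht₀).hasDerivAt)).mono_left
          (nhdsWithin_mono _ fun x (hx : 0 < x) => hx.ne'))
    have hrhs := (hdt.const_mul (‖ℓ‖ * C)).const_add (u + ‖ℓ‖ * δ)
    rw [mul_zero, add_zero] at hrhs
    exact le_of_tendsto_of_tendsto hslope hrhs hquot
  have hlim : Tendsto (fun δ : ℝ => u + ‖ℓ‖ * δ) (𝓝[>] 0) (𝓝 (u + ‖ℓ‖ * 0)) :=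
    ((tendsto_id.const_mul ‖ℓ‖).const_add u).mono_left nhdsWithin_le_nhds
  have : ℓ (deriv z t) ≤ u + ‖ℓ‖ * 0 := by
    refine ge_of_tendsto hlim ?_
    filter_upwards [self_mem_nhdsWithin, nhdsWithin_le_nhds (gt_mem_nhds hδ₀)] with δ h1 h2
    exact key δ h1 h2.le
  rw [mul_zero, add_zero] at this
  linarith

end Euler

/-! ### Switched vector fields -/

theorem krasovskiiMap_subset_of_eventuallyEq {X : Type*} [NormedAddCommGroup X] [NormedSpace ℝ X]
    {g g' : X → X} {x : X} (h : g =ᶠ[𝓝 x] g') : krasovskiiMap g x ⊆ krasovskiiMap g' x := by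
  obtain ⟨r, hr, hball⟩ := Metric.eventually_nhds_iff_ball.1 h
  intro w hw
  simp only [krasovskiiMap, mem_iInter] at hw ⊢
  intro δ hδ
  refine closure_mono (convexHull_mono ?_) (hw (min δ r) (lt_min hδ hr))
  rintro _ ⟨y, hy, rfl⟩
  exact ⟨y, Metric.ball_subset_ball (min_le_left _ _) hy,
    (hball y (Metric.ball_subset_ball (min_le_right _ _) hy)).symm⟩

/-- The componentwise signs of a vector. -/
def signVec {ι : Type*} (a : ι → ℝ) : ι → ℝ := fun i => Real.sign (a i)

/-- The convex set of generalized sign vectors: the sign of a zero component is any number in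
`[-1, 1]`. -/
def signSet {ι : Type*} (a : ι → ℝ) : Set (ι → ℝ) :=
  {σ | ∀ i, |σ i| ≤ 1 ∧ (0 < a i → σ i = 1) ∧ (a i < 0 → σ i = -1)}

theorem abs_sign_le_one (x : ℝ) : |Real.sign x| ≤ 1 := by
  rcases Real.sign_apply_eq x with h | h | h <;> simp [h]

theorem signVec_mem_signSet {ι : Type*} (a : ι → ℝ) : signVec a ∈ signSet a := fun _ =>
  ⟨abs_sign_le_one _, Real.sign_of_pos, Real.sign_of_neg⟩

theorem convex_signSet {ι : Type*} (a : ι → ℝ) : Convex ℝ (signSet a) := by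
  intro σ hσ τ hτ p q hp hq hpq i
  obtain ⟨h1, h2, h3⟩ := hσ i
  obtain ⟨h4, h5, h6⟩ := hτ i
  simp only [Pi.add_apply, Pi.smul_apply, smul_eq_mul]
  refine ⟨?_, fun h => ?_, fun h => ?_⟩
  · rw [abs_le] at *
    constructor <;> nlinarith
  · rw [h2 h, h5 h]; linarith
  · rw [h3 h, h6 h]; linarith

theorem isCompact_signBox (ι : Type*) [Fintype ι] : IsCompact {σ : ι → ℝ | ∀ i, |σ i| ≤ 1} := by
  have : {σ : ι → ℝ | ∀ i, |σ i| ≤ 1} = Set.univ.pi fun _ => Icc (-1) 1 := by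
    ext σ; simp only [mem_ofPred_eq, abs_le, mem_univ_pi, mem_Icc]
  rw [this]
  exact isCompact_univ_pi fun _ => isCompact_Icc

theorem isClosed_signSet {ι : Type*} (a : ι → ℝ) : IsClosed (signSet a) := by
  simp only [signSet, ofPred_forall]
  refine isClosed_iInter fun i => ?_
  have h2 : IsClosed {σ : ι → ℝ | 0 < a i → σ i = 1} := by
    by_cases h : 0 < a i
    · simpa only [h, true_imp_iff] using isClosed_eq (continuous_apply i) continuous_const
    · simp [h]
  have h3 : IsClosed {σ : ι → ℝ | a i < 0 → σ i = -1} := by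
    by_cases h : a i < 0
    · simpa only [h, true_imp_iff] using isClosed_eq (continuous_apply i) continuous_const
    · simp [h]
  exact (isClosed_le (continuous_abs.comp (continuous_apply i)) continuous_const).inter
    (h2.inter h3)

theorem isCompact_signSet {ι : Type*} [Fintype ι] (a : ι → ℝ) : IsCompact (signSet a) :=
  (isCompact_signBox ι).of_isClosed_subset (isClosed_signSet a) fun _ h i => (h i).1

/-- Strict signs persist under small perturbations, which makes the set-valued sign upper
semicontinuous. -/
theorem eventually_signSet_subset {ι : Type*} [Fintype ι] (a : ι → ℝ) :
    ∀ᶠ b in 𝓝 a, signSet b ⊆ signSet a := by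
  have h : ∀ i, ∀ᶠ b in 𝓝 a, (0 < a i → 0 < b i) ∧ (a i < 0 → b i < 0) := by
    intro i
    have hc : Tendsto (fun b : ι → ℝ => b i) (𝓝 a) (𝓝 (a i)) := (continuous_apply i).tendsto a
    refine Eventually.and ?_ ?_
    · by_cases hp : 0 < a i
      · filter_upwards [hc.eventually (lt_mem_nhds hp)] with b hb _ using hb
      · simp [hp]
    · by_cases hp : a i < 0
      · filter_upwards [hc.eventually (gt_mem_nhds hp)] with b hb _ using hb
      · simp [hp]
  filter_upwards [eventually_all.2 h] with b hb σ hσ i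
  exact ⟨(hσ i).1, fun hp => (hσ i).2.1 ((hb i).1 hp), fun hp => (hσ i).2.2 ((hb i).2 hp)⟩

/-- Tube lemma: continuity in the first variable is uniform over a compact set of second variables.
-/
theorem eventually_forall_dist_lt {A B Y : Type*} [TopologicalSpace A] [TopologicalSpace B]
    [PseudoMetricSpace Y] {Ψ : A × B → Y} (hΨ : Continuous Ψ) {K : Set B} (hK : IsCompact K) (a : A)
    {η : ℝ} (hη : 0 < η) : ∀ᶠ a' in 𝓝 a, ∀ b ∈ K, dist (Ψ (a', b)) (Ψ (a, b)) < η := by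
  refine hK.eventually_forall_of_forall_eventually fun b _ => ?_
  have h1 : Continuous fun p : A × B => dist (Ψ p) (Ψ (a, p.2)) := by fun_prop
  have h2 := h1.tendsto (a, b)
  simp only [dist_self] at h2
  exact h2.eventually (gt_mem_nhds hη)

/-- A vector field `Φ (t, x) e σ`, depending on a disturbance `e` and on the signs `σ` of the
components of a continuous function of `(t, x)`. -/
structure SwitchedField (X E ι : Type*) [NormedAddCommGroup X] [NormedSpace ℝ X]
    [NormedAddCommGroup E] where
  Φ : ℝ × X → E → (ι → ℝ) → X
  arg : ℝ × X → ι → ℝ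
  Φ_cont : Continuous fun p : (ℝ × X) × E × (ι → ℝ) => Φ p.1 p.2.1 p.2.2
  arg_cont : Continuous arg
  affine : ∀ p e σ τ (a b : ℝ), a + b = 1 → Φ p e (a • σ + b • τ) = a • Φ p e σ + b • Φ p e τ
  lip : ∃ C, 0 ≤ C ∧ ∀ p e e' σ, ‖Φ p e σ - Φ p e' σ‖ ≤ C * ‖e - e'‖
  /-- a displacement of the state that compensates the dependence of `arg` on the time -/
  shift : ℝ → ℝ × X → X
  shift_cont : ∀ t, Continuous (shift t)
  shift_self : ∀ t x, shift t (t, x) = x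
  arg_shift : ∀ t p, arg (t, shift t p) = arg p

namespace SwitchedField

variable {X E ι : Type*} [NormedAddCommGroup X] [NormedSpace ℝ X] [NormedAddCommGroup E]

/-- The vector field associated with a disturbance signal. -/
def field (S : SwitchedField X E ι) (d : ℝ → E) (t : ℝ) (x : X) : X :=
  S.Φ (t, x) (d t) (signVec (S.arg (t, x)))

/-- Multiplication of a switched vector field by a cutoff function. -/
def cutoff (S : SwitchedField X E ι) (χ : ℝ × X → ℝ) (hχ : Continuous χ)
    (hχ1 : ∀ p, |χ p| ≤ 1) : SwitchedField X E ι where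
  Φ p e σ := χ p • S.Φ p e σ
  arg := S.arg
  Φ_cont := (hχ.comp continuous_fst).smul S.Φ_cont
  arg_cont := S.arg_cont
  affine p e σ τ a b hab := by
    rw [S.affine p e σ τ a b hab, smul_add, smul_comm (χ p), smul_comm (χ p)]
  lip := by
    obtain ⟨C, hC, h⟩ := S.lip
    refine ⟨C, hC, fun p e e' σ => ?_⟩
    rw [← smul_sub, norm_smul, Real.norm_eq_abs]
    calc |χ p| * ‖S.Φ p e σ - S.Φ p e' σ‖ ≤ 1 * ‖S.Φ p e σ - S.Φ p e' σ‖ := by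
          gcongr; exact hχ1 p
      _ ≤ _ := by rw [one_mul]; exact h _ _ _ _
  shift := S.shift
  shift_cont := S.shift_cont
  shift_self := S.shift_self
  arg_shift := S.arg_shift

variable [Fintype ι] (S : SwitchedField X E ι) (d : ℝ → E)

/-- The image G of the generalized signs is compact, and convex because Φ is affine in σ. Values of
the field near x lie in any prescribed thickening of G, which is convex as well, so the Krasovskii
map is contained in all thickenings and hence in G. -/
theorem mem_of_mem_krasovskiiMap {t : ℝ} {x w : X} (hw : w ∈ krasovskiiMap (S.field d t) x) :
    ∃ σ ∈ signSet (S.arg (t, x)), w = S.Φ (t, x) (d t) σ := by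
  set G : Set X := S.Φ (t, x) (d t) '' signSet (S.arg (t, x)) with hG
  have hcont : Continuous (S.Φ (t, x) (d t)) :=
    S.Φ_cont.comp (by fun_prop : Continuous fun σ : ι → ℝ => ((t, x), d t, σ))
  have hGc : IsClosed G := ((isCompact_signSet _).image hcont).isClosed
  have hGconv : Convex ℝ G := by
    rintro _ ⟨σ, hσ, rfl⟩ _ ⟨τ, hτ, rfl⟩ a b ha hb hab
    exact ⟨a • σ + b • τ, convex_signSet _ hσ hτ ha hb hab, S.affine _ _ _ _ _ _ hab⟩
  have hmem : w ∈ G := by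
    rw [← hGc.closure_eq, Metric.closure_eq_iInter_cthickening]
    simp only [mem_iInter]
    intro η hη
    have h1 : ∀ᶠ y in 𝓝 x, signSet (S.arg (t, y)) ⊆ signSet (S.arg (t, x)) := by
      have : Tendsto (fun y => S.arg (t, y)) (𝓝 x) (𝓝 (S.arg (t, x))) :=
        (S.arg_cont.comp (by fun_prop : Continuous fun y : X => (t, y))).tendsto x
      exact this.eventually (eventually_signSet_subset _)
    have h2 := eventually_forall_dist_lt (A := X) (B := ι → ℝ)
      (Ψ := fun p => S.Φ (t, p.1) (d t) p.2)
      (S.Φ_cont.comp (by fun_prop : Continuous fun p : X × (ι → ℝ) => ((t, p.1), d t, p.2)))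
      (isCompact_signBox ι) x hη
    obtain ⟨δ, hδ, hball⟩ := Metric.eventually_nhds_iff_ball.1 (h1.and h2)
    simp only [krasovskiiMap, mem_iInter] at hw
    refine closure_minimal (convexHull_min ?_ (hGconv.cthickening η))
      Metric.isClosed_cthickening (hw δ hδ)
    rintro _ ⟨y, hy, rfl⟩
    obtain ⟨h3, h4⟩ := hball y hy
    have h5 := signVec_mem_signSet (S.arg (t, y))
    exact Metric.mem_cthickening_of_dist_le _ _ _ _ ⟨_, h3 h5, rfl⟩
      (h4 _ fun i => (h5 i).1).le
  obtain ⟨σ, hσ, rfl⟩ := hmem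
  exact ⟨σ, hσ, rfl⟩

variable {d}

/-- The point p = (s, x') and its displacement to time t have exactly the same switching arguments.
Hence no sign differs, and only the continuity of Φ (δ/2 for each of two comparisons with (t, x))
and its Lipschitz dependence on the disturbance are left. -/
theorem exists_displacement [ProperSpace E] {D : ℝ} (hD : ∀ t, ‖d t‖ ≤ D) (t : ℝ) (x : X) :
    ∃ C, 0 ≤ C ∧ ∀ δ > 0, ∀ᶠ p in 𝓝 (t, x), ∃ y ∈ Metric.ball x δ,
      ‖S.field d p.1 p.2 - S.field d t y‖ ≤ δ + C * ‖d p.1 - d t‖ := by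
  obtain ⟨C, hC, hlip⟩ := S.lip
  refine ⟨C, hC, fun δ hδ => ?_⟩
  have hsh : Tendsto (S.shift t) (𝓝 (t, x)) (𝓝 x) := by
    have := (S.shift_cont t).tendsto (t, x)
    rwa [S.shift_self] at this
  have hu := eventually_forall_dist_lt (A := ℝ × X) (B := E × (ι → ℝ))
    (Ψ := fun p => S.Φ p.1 p.2.1 p.2.2) S.Φ_cont
    ((isCompact_closedBall (0 : E) D).prod (isCompact_signBox ι)) (t, x) (half_pos hδ)
  have hu' : ∀ᶠ p in 𝓝 (t, x), ∀ b ∈ Metric.closedBall (0 : E) D ×ˢ {σ : ι → ℝ | ∀ i, |σ i| ≤ 1},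
      dist (S.Φ (t, S.shift t p) b.1 b.2) (S.Φ (t, x) b.1 b.2) < δ / 2 :=
    ((tendsto_const_nhds (x := t)).prodMk_nhds hsh).eventually hu
  filter_upwards [hu, hu', hsh.eventually (Metric.ball_mem_nhds x hδ)] with p h1 h2 h3
  refine ⟨S.shift t p, h3, ?_⟩
  have hb : (d p.1, signVec (S.arg p)) ∈
      Metric.closedBall (0 : E) D ×ˢ {σ : ι → ℝ | ∀ i, |σ i| ≤ 1} :=
    ⟨by simpa using hD p.1, fun i => abs_sign_le_one _⟩
  have h4 := h1 _ hb
  have h5 := h2 _ hb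
  have h6 := hlip (t, S.shift t p) (d p.1) (d t) (signVec (S.arg p))
  simp only [field, S.arg_shift]
  rw [dist_eq_norm] at h4
  rw [dist_comm, dist_eq_norm] at h5
  calc ‖S.Φ p (d p.1) (signVec (S.arg p)) - S.Φ (t, S.shift t p) (d t) (signVec (S.arg p))‖
      = ‖(S.Φ p (d p.1) (signVec (S.arg p)) - S.Φ (t, x) (d p.1) (signVec (S.arg p))) +
          (S.Φ (t, x) (d p.1) (signVec (S.arg p)) -
            S.Φ (t, S.shift t p) (d p.1) (signVec (S.arg p))) +
          (S.Φ (t, S.shift t p) (d p.1) (signVec (S.arg p)) -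
            S.Φ (t, S.shift t p) (d t) (signVec (S.arg p)))‖ := by congr 1; abel
    _ ≤ _ := norm_add₃_le
    _ ≤ _ := by linarith

variable [MeasurableSpace X] [BorelSpace X] [MeasurableSpace E] [BorelSpace E]
  [NormedSpace ℝ E] [FiniteDimensional ℝ E] [FiniteDimensional ℝ X]

omit [NormedSpace ℝ E] [FiniteDimensional ℝ E] [FiniteDimensional ℝ X] in
theorem measurable_field [SecondCountableTopology E] [SecondCountableTopology X]
    (hd : Measurable d) (x : X) :
    Measurable fun t => S.field d t x := by
  have h1 : Measurable fun t => signVec (S.arg (t, x)) := by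
    refine measurable_pi_lambda _ fun i => ?_
    have h2 : Measurable fun t => S.arg (t, x) i :=
      ((continuous_apply i).comp (S.arg_cont.comp (by fun_prop :
        Continuous fun t : ℝ => (t, x)))).measurable
    have h3 : Measurable Real.sign := by
      unfold Real.sign
      exact Measurable.ite measurableSet_Iio measurable_const
        (Measurable.ite measurableSet_Ioi measurable_const measurable_const)
    exact h3.comp h2
  have h4 : Measurable fun t => (((t, x), d t, signVec (S.arg (t, x))) : (ℝ × X) × E × (ι → ℝ)) :=
    (measurable_id.prodMk measurable_const).prodMk (hd.prodMk h1)
  exact S.Φ_cont.measurable.comp h4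

variable {Z : Type*} [NormedAddCommGroup Z] [NormedSpace ℝ Z] [CompleteSpace Z]

/-- Global existence of Krasovskii solutions under an a priori bound. -/
theorem exists_global_solution (hd : Measurable d) {D : ℝ} (hD : ∀ t, ‖d t‖ ≤ D) {t₀ : ℝ} {z₀ : X}
    (hbound : ∀ T, t₀ ≤ T → ∃ R, ∀ τ ∈ Icc t₀ T, ∀ z : ℝ → X, z t₀ = z₀ →
      AbsolutelyContinuousOnInterval z t₀ τ →
      (∀ᵐ t ∂volume.restrict (Icc t₀ τ), ∃ σ ∈ signSet (S.arg (t, z t)),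
        HasDerivAt z (S.Φ (t, z t) (d t) σ) t) → ‖z τ‖ < R)
    (π : X →L[ℝ] Z) (hπ : ∀ t, t₀ ≤ t → ∀ x, π x = π z₀ → π (S.field d t x) = 0) :
    ∃ z : ℝ → X, z t₀ = z₀ ∧ (∀ T, t₀ ≤ T → AbsolutelyContinuousOnInterval z t₀ T) ∧
      (∀ t, t₀ ≤ t → π (z t) = π z₀) ∧
      ∀ᵐ t ∂volume.restrict (Ici t₀), ∃ w ∈ krasovskiiMap (S.field d t) (z t),
        HasDerivAt z w t := by
  have : ProperSpace X := FiniteDimensional.proper_real X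
  have : ProperSpace E := FiniteDimensional.proper_real E
  have := secondCountable_of_proper (α := X)
  have := secondCountable_of_proper (α := E)
  -- A partition of unity glues the a priori bounds into one continuous R(τ). The bound on [t₀, τ +
  -- 1] serves all times near τ, and admissible radii form a convex set.
  obtain ⟨R, hR⟩ := exists_continuous_forall_mem_convex_of_local_const (X := ℝ) (E := ℝ)
    (t := fun τ => {r | t₀ ≤ τ → ∀ z : ℝ → X, z t₀ = z₀ →
      AbsolutelyContinuousOnInterval z t₀ τ →
      (∀ᵐ t ∂volume.restrict (Icc t₀ τ), ∃ σ ∈ signSet (S.arg (t, z t)),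
        HasDerivAt z (S.Φ (t, z t) (d t) σ) t) → ‖z τ‖ < r}) (by
      intro τ r hr r' hr' a b ha hb hab h1 z h2 h3 h4
      exact convex_Ioi (𝕜 := ℝ) ‖z τ‖ (hr h1 z h2 h3 h4) (hr' h1 z h2 h3 h4) ha hb hab) (by
      intro τ
      obtain ⟨R, hR⟩ := hbound (max t₀ (τ + 1)) (le_max_left _ _)
      refine ⟨R, ?_⟩
      filter_upwards [gt_mem_nhds (lt_add_one τ)] with s hs h1 z h2 h3 h4
      exact hR s ⟨h1, hs.le.trans (le_max_right _ _)⟩ z h2 h3 h4)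
  -- The cutoff is 1 where ‖x‖ ≤ R(t) and 0 where ‖x‖ ≥ R(t) + 1, so the modified field is bounded
  -- on bounded time intervals.
  set χ : ℝ × X → ℝ := fun p => max 0 (min 1 (R p.1 + 1 - ‖p.2‖)) with hχ
  have hχc : Continuous χ := by
    have := R.continuous
    fun_prop
  have hχ1 : ∀ p, |χ p| ≤ 1 := fun p => by
    rw [abs_of_nonneg (le_max_left _ _)]
    exact max_le zero_le_one (min_le_left _ _)
  have hχone : ∀ t x, ‖x‖ ≤ R t → χ (t, x) = 1 := fun t x h => by
    have : (1 : ℝ) ≤ R t + 1 - ‖x‖ := by linarith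
    simp [hχ, min_eq_left this]
  have hχzero : ∀ t x, R t + 1 ≤ ‖x‖ → χ (t, x) = 0 := fun t x h => by
    have : min 1 (R t + 1 - ‖x‖) ≤ 0 := (min_le_right _ _).trans (by linarith)
    simp [hχ, max_eq_left this]
  set S' := S.cutoff χ hχc hχ1
  have hfield : ∀ t x, S'.field d t x = χ (t, x) • S.field d t x := fun t x => rfl
  have hbdd : ∀ T, ∃ C, ∀ t ∈ Icc t₀ T, ∀ x, ‖S'.field d t x‖ ≤ C := by
    intro T
    obtain ⟨ρ, hρ⟩ := (isCompact_Icc (a := t₀) (b := T)).exists_bound_of_continuousOn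
      R.continuous.continuousOn
    obtain ⟨C, hC⟩ := (((isCompact_Icc (a := t₀) (b := T)).prod
      (isCompact_closedBall (0 : X) (ρ + 1))).prod ((isCompact_closedBall (0 : E) D).prod
        (isCompact_signBox ι))).exists_bound_of_continuousOn S'.Φ_cont.continuousOn
    refine ⟨max C 0, fun t ht x => ?_⟩
    rcases le_or_gt (R t + 1) ‖x‖ with h | h
    · rw [hfield, hχzero t x h, zero_smul, norm_zero]; exact le_max_right _ _
    · refine (hC ((t, x), d t, signVec (S'.arg (t, x))) ⟨⟨ht, ?_⟩, by simpa using hD t,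
        fun i => abs_sign_le_one _⟩).trans (le_max_left _ _)
      have := (le_abs_self _).trans (hρ t ht)
      rw [mem_closedBall_zero_iff]; linarith
  have hloc : LocallyIntegrable d := by
    refine (locallyIntegrable_const D).mono hd.aestronglyMeasurable (Eventually.of_forall fun t => ?_)
    rw [Real.norm_eq_abs]
    exact (hD t).trans (le_abs_self _)
  obtain ⟨z, hz0, hzL, hzπ, hz⟩ := exists_krasovskii_solution (z₀ := z₀) (t₀ := t₀)
    (S'.measurable_field hd) hbdd hloc (S'.exists_displacement hD) π (by
      intro t ht x hx
      rw [hfield, map_smul, hπ t ht x hx, smul_zero])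
  have hAC : ∀ T, t₀ ≤ T → AbsolutelyContinuousOnInterval z t₀ T := by
    intro T hT
    obtain ⟨K, hK⟩ := hzL T
    rw [← uIcc_of_le hT] at hK
    exact hK.absolutelyContinuousOnInterval
  have hcont : ContinuousOn z (Ici t₀) := by
    intro t ht
    have ht : t₀ ≤ t := ht
    have h1 := (hAC (t + 1) (by linarith)).continuousOn t (by
      rw [uIcc_of_le (by linarith)]; exact ⟨ht, by linarith⟩)
    rw [uIcc_of_le (by linarith)] at h1
    refine h1.mono_of_mem_nhdsWithin ?_
    rw [← Ici_inter_Iic]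
    exact inter_mem self_mem_nhdsWithin (nhdsWithin_le_nhds (Iic_mem_nhds (by linarith)))
  have hlt : ∀ t, t₀ ≤ t → ‖z t‖ < R t := by
    by_contra! hcon
    -- At the first time τ with ‖z‖ ≥ R, the curve has solved the original inclusion up to τ, so the
    -- a priori bound at τ is violated.
    set A : Set ℝ := {t ∈ Ici t₀ | R t ≤ ‖z t‖}
    have hA : A.Nonempty := by
      obtain ⟨t, h1, h2⟩ := hcon; exact ⟨t, h1, h2⟩
    have hAb : BddBelow A := ⟨t₀, fun t ht => ht.1⟩
    have hAc : IsClosed A :=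
      isClosed_Ici.isClosed_le (R.continuous.continuousOn) (hcont.norm)
    have hτ := hAc.csInf_mem hA hAb
    set τ := sInf A
    refine absurd (hR τ hτ.1 z hz0 (hAC τ hτ.1) ?_) hτ.2.not_gt
    have hne : ∀ᵐ t ∂volume.restrict (Icc t₀ τ), t ≠ τ := ae_restrict_of_ae (Measure.ae_ne volume τ)
    filter_upwards [ae_restrict_Icc_of_Ici hz le_rfl, hne, ae_restrict_mem measurableSet_Icc]
      with t ⟨w, hw, hwd⟩ hne hmem
    have h1 : ‖z t‖ < R t := by
      by_contra! h
      exact hne (le_antisymm hmem.2 (csInf_le hAb ⟨hmem.1, h⟩))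
    obtain ⟨σ, hσ, rfl⟩ := S'.mem_of_mem_krasovskiiMap d hw
    refine ⟨σ, hσ, ?_⟩
    have h2 : S'.Φ (t, z t) (d t) σ = S.Φ (t, z t) (d t) σ := by
      change χ (t, z t) • _ = _
      rw [hχone t _ h1.le, one_smul]
    rwa [h2] at hwd
  refine ⟨z, hz0, hAC, hzπ, ?_⟩
  filter_upwards [hz, ae_restrict_mem measurableSet_Ici] with t ⟨w, hw, hwd⟩ hmem
  refine ⟨w, krasovskiiMap_subset_of_eventuallyEq ?_ hw, hwd⟩
  filter_upwards [continuous_norm.continuousAt.eventually (gt_mem_nhds (hlt t hmem))] with x hx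
  rw [hfield, hχone t x hx.le, one_smul]

end SwitchedField

/-! ### Kinematics and dynamics of a single manipulator -/

theorem ContinuousLinearMap.isInvertible_of_injective {d : ℕ} {A : Euc d →L[ℝ] Euc d}
    (hA : Function.Injective A) : A.IsInvertible :=
  ⟨(LinearEquiv.ofInjectiveEndo (A : Euc d →ₗ[ℝ] Euc d) hA).toContinuousLinearEquiv, by
    ext v; rfl⟩

theorem ContinuousLinearMap.IsInvertible.apply_inverse {d e : ℕ} {A : Euc d →L[ℝ] Euc e}
    (hA : A.IsInvertible) (v : Euc e) : A (A.inverse v) = v := by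
  obtain ⟨e, rfl⟩ := hA
  rw [ContinuousLinearMap.inverse_equiv]; simp

theorem ContinuousLinearMap.IsInvertible.inverse_apply {d e : ℕ} {A : Euc d →L[ℝ] Euc e}
    (hA : A.IsInvertible) (v : Euc d) : A.inverse (A v) = v := by
  obtain ⟨e, rfl⟩ := hA
  rw [ContinuousLinearMap.inverse_equiv]; simp

theorem isInvertible_of_coercive {d : ℕ} {A : Euc d →L[ℝ] Euc d} {h : ℝ} (hh : 0 < h)
    (hA : ∀ v, h * ‖v‖ ^ 2 ≤ ⟪A v, v⟫) : A.IsInvertible := by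
  refine ContinuousLinearMap.isInvertible_of_injective ((injective_iff_map_eq_zero A).2 fun v hv => ?_)
  have := hA v
  rw [hv, inner_zero_left] at this
  have h2 : ‖v‖ ^ 2 ≤ 0 := by nlinarith [sq_nonneg ‖v‖]
  simpa using le_antisymm h2 (sq_nonneg _)

theorem norm_inverse_apply_le_of_coercive {d : ℕ} {A : Euc d →L[ℝ] Euc d} {h : ℝ} (hh : 0 < h)
    (hA : ∀ v, h * ‖v‖ ^ 2 ≤ ⟪A v, v⟫) (v : Euc d) : ‖A.inverse v‖ ≤ h⁻¹ * ‖v‖ := by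
  have h1 := hA (A.inverse v)
  rw [(isInvertible_of_coercive hh hA).apply_inverse] at h1
  have h2 := real_inner_le_norm v (A.inverse v)
  rcases eq_or_ne ‖A.inverse v‖ 0 with h0 | h0
  · rw [h0]; positivity
  · have hp : 0 < ‖A.inverse v‖ := lt_of_le_of_ne (norm_nonneg _) h0.symm
    rw [inv_mul_eq_div, le_div_iff₀ hh]
    nlinarith

theorem contDiffAt_inverse_comp {E : Type*} [NormedAddCommGroup E] [NormedSpace ℝ E] {d : ℕ}
    {A : E → Euc d →L[ℝ] Euc d} {n : WithTop ℕ∞} (hA : ContDiff ℝ n A)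
    (hinv : ∀ x, (A x).IsInvertible) : ContDiff ℝ n fun x => (A x).inverse :=
  contDiff_iff_contDiffAt.2 fun x =>
    (hinv x).contDiffAt_map_inverse.comp x hA.contDiffAt

/-- Taking adjoints, as a continuous linear map. -/
def adjointL (d e : ℕ) : (Euc d →L[ℝ] Euc e) →L[ℝ] (Euc e →L[ℝ] Euc d) :=
  LinearMap.toContinuousLinearMap
    { toFun := fun A => ContinuousLinearMap.adjoint A
      map_add' := fun A B => map_add _ A B
      map_smul' := fun c A => by simp }

theorem norm_adjoint_eq {d e : ℕ} (A : Euc d →L[ℝ] Euc e) :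
    ‖ContinuousLinearMap.adjoint A‖ = ‖A‖ := ContinuousLinearMap.adjoint.norm_map A

theorem norm_sub_le_of_norm_fderiv_le {E F : Type*} [NormedAddCommGroup E] [NormedSpace ℝ E]
    [NormedAddCommGroup F] [NormedSpace ℝ F] {f : E → F} {c : ℝ} (hf : Differentiable ℝ f)
    (hc : ∀ x, ‖fderiv ℝ f x‖ ≤ c) (x y : E) : ‖f x - f y‖ ≤ c * ‖x - y‖ :=
  convex_univ.norm_image_sub_le_of_norm_fderiv_le (fun z _ => hf z) (fun z _ => hc z) (mem_univ y)
    (mem_univ x)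

namespace Manipulator

namespace Regular

variable {m p k : ℕ} {M : Manipulator m p k} {t₀ : ℝ}

theorem contDiff_J (hM : M.Regular t₀) : ContDiff ℝ 1 M.J :=
  hM.ψ_smooth.fderiv_right (by norm_num)

theorem injective_adjoint_J (hM : M.Regular t₀) (q : Euc p) :
    Function.Injective (ContinuousLinearMap.adjoint (M.J q)) := by
  refine (injective_iff_map_eq_zero _).2 fun v hv => ?_
  obtain ⟨w, hw⟩ := hM.J_surj q v
  have : ⟪v, v⟫ = 0 := by
    nth_rewrite 2 [← hw]
    rw [← ContinuousLinearMap.adjoint_inner_left, hv, inner_zero_left]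
  exact inner_self_eq_zero.1 this

theorem isInvertible_gram (hM : M.Regular t₀) (q : Euc p) :
    ((M.J q).comp (ContinuousLinearMap.adjoint (M.J q))).IsInvertible := by
  refine ContinuousLinearMap.isInvertible_of_injective ((injective_iff_map_eq_zero _).2 fun v hv => ?_)
  refine (injective_iff_map_eq_zero _).1 (hM.injective_adjoint_J q) v ?_
  have : ⟪ContinuousLinearMap.adjoint (M.J q) v, ContinuousLinearMap.adjoint (M.J q) v⟫ = 0 := by
    rw [ContinuousLinearMap.adjoint_inner_left]
    rw [ContinuousLinearMap.comp_apply] at hv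
    rw [hv, inner_zero_right]
  exact inner_self_eq_zero.1 this

/-- If p = m, then J is injective and both sides are right inverses of it. One formula thus serves
both cases of the definition. -/
theorem sharp_eq (hM : M.Regular t₀) (q : Euc p) :
    M.sharp q = (ContinuousLinearMap.adjoint (M.J q)).comp
      ((M.J q).comp (ContinuousLinearMap.adjoint (M.J q))).inverse := by
  unfold Manipulator.sharp
  split_ifs with h
  swap
  · rfl
  subst h
  have hinj : Function.Injective (M.J q) :=
    (LinearMap.injective_iff_surjective (f := ((M.J q : Euc p →L[ℝ] Euc p) : Euc p →ₗ[ℝ] Euc p))).2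
      (hM.J_surj q)
  have hinv := ContinuousLinearMap.isInvertible_of_injective hinj
  ext1 v
  apply hinj
  rw [hinv.apply_inverse]
  exact ((hM.isInvertible_gram q).apply_inverse v).symm

theorem J_sharp (hM : M.Regular t₀) (q : Euc p) (v : Euc m) : M.J q (M.sharp q v) = v := by
  rw [hM.sharp_eq]
  exact (hM.isInvertible_gram q).apply_inverse v

theorem J_nullProj (hM : M.Regular t₀) (q v : Euc p) : M.J q (M.nullProj q v) = 0 := by
  simp [Manipulator.nullProj, hM.J_sharp]

theorem nullProj_sharp (hM : M.Regular t₀) (q : Euc p) (v : Euc m) :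
    M.nullProj q (M.sharp q v) = 0 := by
  simp [Manipulator.nullProj, hM.J_sharp]

theorem nullProj_nullProj (hM : M.Regular t₀) (q v : Euc p) :
    M.nullProj q (M.nullProj q v) = M.nullProj q v := by
  have := hM.J_nullProj q v
  change M.nullProj q v - M.sharp q (M.J q (M.nullProj q v)) = _
  rw [this, map_zero, sub_zero]

theorem contDiff_gram (hM : M.Regular t₀) :
    ContDiff ℝ 1 fun q => (M.J q).comp (ContinuousLinearMap.adjoint (M.J q)) :=
  hM.contDiff_J.clm_comp ((adjointL p m).contDiff.comp hM.contDiff_J)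

theorem contDiff_gram_inverse (hM : M.Regular t₀) :
    ContDiff ℝ 1 fun q => ((M.J q).comp (ContinuousLinearMap.adjoint (M.J q))).inverse :=
  contDiffAt_inverse_comp hM.contDiff_gram hM.isInvertible_gram

theorem contDiff_sharp (hM : M.Regular t₀) : ContDiff ℝ 1 M.sharp := by
  have h : M.sharp = fun q => (ContinuousLinearMap.adjoint (M.J q)).comp
      ((M.J q).comp (ContinuousLinearMap.adjoint (M.J q))).inverse := funext hM.sharp_eq
  rw [h]
  exact ((adjointL p m).contDiff.comp hM.contDiff_J).clm_comp hM.contDiff_gram_inverse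

theorem contDiff_nullφ (hM : M.Regular t₀) : ContDiff ℝ 1 M.nullφ := by
  have h : M.nullφ = fun y : ℝ × Euc p => M.φ y.1 y.2 - M.sharp y.2 (M.J y.2 (M.φ y.1 y.2)) := by
    ext1 y; simp [Manipulator.nullφ, Manipulator.nullProj]
  rw [h]
  exact hM.φ_smooth.sub ((hM.contDiff_sharp.comp contDiff_snd).clm_apply
    ((hM.contDiff_J.comp contDiff_snd).clm_apply hM.φ_smooth))

/-- With G = (JJᵀ)⁻¹ one has ⟨JᵀGv, JᵀGw⟩ = ⟨Gv, JJᵀGw⟩ = ⟨Gv, w⟩. The bound on J^♯ therefore bounds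
G, with no separate assumption on the singular values of J. -/
theorem gram_inverse_eq (hM : M.Regular t₀) (q : Euc p) :
    ((M.J q).comp (ContinuousLinearMap.adjoint (M.J q))).inverse =
      (ContinuousLinearMap.adjoint (M.sharp q)).comp (M.sharp q) := by
  have hinv := hM.isInvertible_gram q
  ext1 v
  refine ext_inner_right ℝ fun w => ?_
  rw [ContinuousLinearMap.comp_apply, ContinuousLinearMap.adjoint_inner_left]
  rw [hM.sharp_eq]
  rw [ContinuousLinearMap.comp_apply, ContinuousLinearMap.comp_apply,
    ContinuousLinearMap.adjoint_inner_left]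
  exact congrArg _ (hinv.apply_inverse w).symm

theorem norm_comp_sub_comp_le {D E F : ℕ} (A A' : Euc E →L[ℝ] Euc F) (B B' : Euc D →L[ℝ] Euc E) :
    ‖A.comp B - A'.comp B'‖ ≤ ‖A - A'‖ * ‖B‖ + ‖A'‖ * ‖B - B'‖ := by
  have : A.comp B - A'.comp B' = (A - A').comp B + A'.comp (B - B') := by
    simp [ContinuousLinearMap.sub_comp, ContinuousLinearMap.comp_sub]
  rw [this]
  exact (norm_add_le _ _).trans (add_le_add (ContinuousLinearMap.opNorm_comp_le _ _)
    (ContinuousLinearMap.opNorm_comp_le _ _))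

/-- J and its adjoint are Lipschitz because J has bounded derivative; the inverse Gram matrix is
Lipschitz by A_x⁻¹ - A_y⁻¹ = A_x⁻¹(A_y - A_x)A_y⁻¹. The product J^♯ = Jᵀ(JJᵀ)⁻¹ is then Lipschitz,
and its Lipschitz constant bounds the derivative. -/
theorem sharp_deriv_bdd (hM : M.Regular t₀) : ∃ c, ∀ q, ‖fderiv ℝ M.sharp q‖ ≤ c := by
  obtain ⟨j, hj⟩ := hM.J_bdd
  obtain ⟨j', hj'⟩ := hM.J_deriv_bdd
  obtain ⟨s, hs⟩ := hM.sharp_bdd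
  have hj0 : 0 ≤ j := (norm_nonneg _).trans (hj 0)
  have hj'0 : 0 ≤ j' := (norm_nonneg (fderiv ℝ M.J 0)).trans (hj' 0)
  have hs0 : 0 ≤ s := (norm_nonneg _).trans (hs 0)
  set A : Euc p → Euc m →L[ℝ] Euc m := fun q => (M.J q).comp (ContinuousLinearMap.adjoint (M.J q))
  have hJL : ∀ x y, ‖M.J x - M.J y‖ ≤ j' * ‖x - y‖ :=
    norm_sub_le_of_norm_fderiv_le (hM.contDiff_J.differentiable one_ne_zero) hj'
  have hJL' : ∀ x y, ‖ContinuousLinearMap.adjoint (M.J x) - ContinuousLinearMap.adjoint (M.J y)‖ ≤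
      j' * ‖x - y‖ := fun x y => by
    rw [← map_sub, norm_adjoint_eq]; exact hJL x y
  have hG : ∀ q, ‖(A q).inverse‖ ≤ s * s := fun q => by
    rw [hM.gram_inverse_eq]
    refine (ContinuousLinearMap.opNorm_comp_le _ _).trans ?_
    rw [norm_adjoint_eq]
    exact mul_le_mul (hs q) (hs q) (norm_nonneg _) hs0
  have hAL : ∀ x y, ‖A x - A y‖ ≤ (j' * j + j * j') * ‖x - y‖ := fun x y => by
    refine (norm_comp_sub_comp_le _ _ _ _).trans ?_
    rw [norm_adjoint_eq]
    calc _ ≤ (j' * ‖x - y‖) * j + j * (j' * ‖x - y‖) := by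
          gcongr
          exacts [hJL x y, hj x, hj y, hJL' x y]
      _ = _ := by ring
  have hGL : ∀ x y, ‖(A x).inverse - (A y).inverse‖ ≤
      (s * s) * ((j' * j + j * j') * (s * s)) * ‖x - y‖ := fun x y => by
    have e : (A x).inverse - (A y).inverse = (A x).inverse.comp ((A y - A x).comp (A y).inverse) := by
      ext1 v
      simp only [ContinuousLinearMap.comp_apply, sub_apply, map_sub]
      rw [(hM.isInvertible_gram y).apply_inverse, (hM.isInvertible_gram x).inverse_apply]
    rw [e]
    refine (ContinuousLinearMap.opNorm_comp_le _ _).trans ?_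
    have h1 := ContinuousLinearMap.opNorm_comp_le (A y - A x) (A y).inverse
    have h2 := hAL y x
    rw [norm_sub_rev y x] at h2
    calc _ ≤ (s * s) * (((j' * j + j * j') * ‖x - y‖) * (s * s)) := by
          gcongr
          · exact hG x
          · exact h1.trans (mul_le_mul h2 (hG y) (norm_nonneg _) (by positivity))
      _ = _ := by ring
  set K := j' * (s * s) + j * ((s * s) * ((j' * j + j * j') * (s * s))) with hK
  have hSL : ∀ x y, ‖M.sharp x - M.sharp y‖ ≤ K * ‖x - y‖ := fun x y => by
    rw [hM.sharp_eq x, hM.sharp_eq y]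
    refine (norm_comp_sub_comp_le _ _ _ _).trans ?_
    rw [norm_adjoint_eq]
    calc _ ≤ (j' * ‖x - y‖) * (s * s) +
          j * ((s * s) * ((j' * j + j * j') * (s * s)) * ‖x - y‖) := by
          gcongr
          exacts [hJL' x y, hG x, hj y, hGL x y]
      _ = _ := by rw [hK]; ring
  have hK0 : 0 ≤ K := by positivity
  refine ⟨K, fun q => ?_⟩
  have : LipschitzWith K.toNNReal M.sharp := LipschitzWith.of_dist_le_mul fun x y => by
    rw [dist_eq_norm, dist_eq_norm, Real.coe_toNNReal _ hK0]; exact hSL x y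
  simpa [Real.coe_toNNReal _ hK0] using norm_fderiv_le_of_lipschitz ℝ this (x₀ := q)

theorem isInvertible_H (hM : M.Regular t₀) (q : Euc p) : (M.H q).IsInvertible := by
  obtain ⟨h, hh, hH⟩ := hM.H_pos
  exact isInvertible_of_coercive hh (hH q)

theorem continuous_H_inverse (hM : M.Regular t₀) : Continuous fun q => (M.H q).inverse :=
  (contDiffAt_inverse_comp hM.H_smooth hM.isInvertible_H).continuous

theorem norm_H_inverse_le (hM : M.Regular t₀) :
    ∃ c, 0 ≤ c ∧ ∀ q v, ‖(M.H q).inverse v‖ ≤ c * ‖v‖ := by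
  obtain ⟨h, hh, hH⟩ := hM.H_pos
  exact ⟨h⁻¹, by positivity, fun q v => norm_inverse_apply_le_of_coercive hh (hH q) v⟩

end Regular

end Manipulator

/-! ### Matrix gains -/

theorem matAct_apply {d : ℕ} (A : Matrix (Fin d) (Fin d) ℝ) (v : Euc d) (l : Fin d) :
    matAct A v l = ∑ j, A l j * v j := by
  simp [matAct, Matrix.toLpLin_apply, Matrix.mulVec, dotProduct]

theorem matAct_apply_of_isDiag {d : ℕ} {A : Matrix (Fin d) (Fin d) ℝ} (hA : A.IsDiag) (v : Euc d)
    (l : Fin d) : matAct A v l = A l l * v l := by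
  rw [matAct_apply]
  refine Finset.sum_eq_single l (fun j _ hj => ?_) (by simp)
  rw [hA hj.symm, zero_mul]

theorem continuous_matAct {d : ℕ} (A : Matrix (Fin d) (Fin d) ℝ) :
    Continuous fun v => matAct A v :=
  LinearMap.continuous_of_finiteDimensional _

theorem exists_norm_matAct_le {d : ℕ} (A : Matrix (Fin d) (Fin d) ℝ) :
    ∃ c, 0 ≤ c ∧ ∀ v, ‖matAct A v‖ ≤ c * ‖v‖ :=
  ⟨_, norm_nonneg _, (LinearMap.toContinuousLinearMap (Matrix.toEuclideanLin A)).le_opNorm⟩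

theorem inner_euc {d : ℕ} (v w : Euc d) : ⟪v, w⟫ = ∑ l, v l * w l := by
  rw [PiLp.inner_apply]
  exact Finset.sum_congr rfl fun l _ => by simp [mul_comm]

theorem inner_matAct_pos {d : ℕ} {A : Matrix (Fin d) (Fin d) ℝ} (hA : A.PosDef) {v : Euc d}
    (hv : v ≠ 0) : 0 < ⟪matAct A v, v⟫ := by
  have h := (Matrix.posDef_iff_dotProduct_mulVec.1 hA).2 (x := v.ofLp) (by
    intro h; apply hv; ext l; simp [h])
  rw [inner_euc]
  simp only [dotProduct, Matrix.mulVec] at h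
  refine h.trans_eq (Finset.sum_congr rfl fun l _ => ?_)
  rw [matAct_apply, mul_comm]; simp

theorem inner_matAct_nonneg {d : ℕ} {A : Matrix (Fin d) (Fin d) ℝ} (hA : A.PosDef) (v : Euc d) :
    0 ≤ ⟪matAct A v, v⟫ := by
  rcases eq_or_ne v 0 with rfl | hv
  · simp
  · exact (inner_matAct_pos hA hv).le

theorem exists_coercive_of_posDef {d : ℕ} {A : Matrix (Fin d) (Fin d) ℝ} (hA : A.PosDef) :
    ∃ c > 0, ∀ v, c * ‖v‖ ^ 2 ≤ ⟪matAct A v, v⟫ := by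
  -- The constant is the minimum of the quadratic form on the unit sphere, which is empty in
  -- dimension zero.
  rcases (Metric.sphere (0 : Euc d) 1).eq_empty_or_nonempty with he | hne
  · refine ⟨1, one_pos, fun v => ?_⟩
    have hv : v = 0 := by
      by_contra hv
      have : ‖v‖⁻¹ • v ∈ Metric.sphere (0 : Euc d) 1 := by
        simp [norm_smul, norm_ne_zero_iff.2 hv]
      rw [he] at this; exact this
    simp [hv]
  · obtain ⟨u, hu, hmin⟩ := (isCompact_sphere (0 : Euc d) 1).exists_isMinOn hne
      ((continuous_matAct A).inner (𝕜 := ℝ) continuous_id).continuousOn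
    have hu0 : u ≠ 0 := by
      rintro rfl; simp at hu
    refine ⟨⟪matAct A u, u⟫, inner_matAct_pos hA hu0, fun v => ?_⟩
    rcases eq_or_ne v 0 with rfl | hv
    · simp
    have hn : ‖v‖ ≠ 0 := norm_ne_zero_iff.2 hv
    have h1 := hmin (show ‖v‖⁻¹ • v ∈ Metric.sphere (0 : Euc d) 1 by simp [norm_smul, hn])
    simp only [mem_ofPred_eq, id, map_smul, inner_smul_left, inner_smul_right,
      RCLike.conj_to_real] at h1
    calc ⟪matAct A u, u⟫ * ‖v‖ ^ 2 ≤ (‖v‖⁻¹ * (‖v‖⁻¹ * ⟪matAct A v, v⟫)) * ‖v‖ ^ 2 := by gcongr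
      _ = _ := by field_simp

theorem lambdaMin_le_of_isDiag {d : ℕ} {A : Matrix (Fin d) (Fin d) ℝ} (hA : A.IsDiag) (l : Fin d) :
    lambdaMin A ≤ A l l := by
  refine csInf_le (Matrix.finite_spectrum A).bddBelow ?_
  rw [← hA.diagonal_diag, spectrum_diagonal]
  exact ⟨l, by simp⟩

theorem norm_le_sum_abs {d : ℕ} (v : Euc d) : ‖v‖ ≤ ∑ l, |v l| := by
  rw [EuclideanSpace.norm_eq]
  refine Real.sqrt_le_iff.2 ⟨Finset.sum_nonneg fun _ _ => abs_nonneg _, ?_⟩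
  simp only [Real.norm_eq_abs]
  exact Finset.sum_sq_le_sq_sum_of_nonneg fun _ _ => abs_nonneg _

/-- Generalized sign vectors of a Euclidean vector. -/
def IsSignOf {d : ℕ} (σ v : Euc d) : Prop :=
  ∀ l, |σ l| ≤ 1 ∧ (0 < v l → σ l = 1) ∧ (v l < 0 → σ l = -1)

theorem IsSignOf.mul_eq_abs {d : ℕ} {σ v : Euc d} (h : IsSignOf σ v) (l : Fin d) :
    σ l * v l = |v l| := by
  rcases lt_trichotomy (v l) 0 with hl | hl | hl
  · rw [(h l).2.2 hl, abs_of_neg hl]; ring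
  · rw [hl]; simp
  · rw [(h l).2.1 hl, abs_of_pos hl]; ring

theorem IsSignOf.norm_le {d : ℕ} {σ v : Euc d} (h : IsSignOf σ v) : ‖σ‖ ≤ d := by
  refine (norm_le_sum_abs σ).trans ?_
  calc ∑ l, |σ l| ≤ ∑ _l : Fin d, (1 : ℝ) := Finset.sum_le_sum fun l _ => (h l).1
    _ = d := by simp

/-- The inner product is Σ A_ll |v_l|, each A_ll is an eigenvalue, and the ℓ¹ norm dominates the
Euclidean one. With r = ‖d‖ this lets the K_r term absorb the disturbance. -/
theorem IsSignOf.le_inner_matAct {d : ℕ} {σ v : Euc d} (h : IsSignOf σ v)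
    {A : Matrix (Fin d) (Fin d) ℝ} (hA : A.IsDiag) {r : ℝ} (hr : 0 ≤ r) (hle : r ≤ lambdaMin A) :
    r * ‖v‖ ≤ ⟪matAct A σ, v⟫ := by
  rw [inner_euc]
  calc r * ‖v‖ ≤ r * ∑ l, |v l| := by gcongr; exact norm_le_sum_abs v
    _ = ∑ l, r * |v l| := Finset.mul_sum _ _ _
    _ ≤ _ := Finset.sum_le_sum fun l _ => by
      rw [matAct_apply_of_isDiag hA, mul_assoc, h.mul_eq_abs]
      gcongr
      exact hle.trans (lambdaMin_le_of_isDiag hA l)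

/-! ### The closed loop of one node -/

theorem NodeState.hasDerivAt_comp {m p k : ℕ} {s : ℝ → NodeState m p k} {w : NodeState m p k}
    {t : ℝ} (h : HasDerivAt s w t) :
    HasDerivAt (fun τ => NodeState.q (s τ)) (NodeState.q w) t ∧
    HasDerivAt (fun τ => NodeState.dq (s τ)) (NodeState.dq w) t ∧
    HasDerivAt (fun τ => NodeState.θhat (s τ)) (NodeState.θhat w) t ∧
    HasDerivAt (fun τ => NodeState.xhat (s τ)) (NodeState.xhat w) t ∧
    HasDerivAt (fun τ => NodeState.vhat (s τ)) (NodeState.vhat w) t ∧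
    HasDerivAt (fun τ => NodeState.ahat (s τ)) (NodeState.ahat w) t :=
  ⟨h.fst, h.snd.fst, h.snd.snd.fst, h.snd.snd.snd.fst, h.snd.snd.snd.snd.fst,
    h.snd.snd.snd.snd.snd⟩

section Node

variable {m p k : ℕ} (M : Manipulator m p k) (G : Gains m p k)

/-- The joint acceleration for a generalized sign vector `σ` of `ŝ` and a disturbance `e`. -/
def switchedAcc (t : ℝ) (s : NodeState m p k) (e σ : Euc p) : Euc p :=
  (M.H (NodeState.q s)).inverse
    (regressor M G t s (NodeState.θhat s)
      - ContinuousLinearMap.adjoint (M.J (NodeState.q s))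
          (matAct G.Kx (M.J (NodeState.q s) (sHat M G t s)))
      - matAct G.Ks (sHat M G t s) - matAct G.Kr σ
      - M.C (NodeState.q s) (NodeState.dq s) (NodeState.dq s) - M.g (NodeState.q s) - e)

/-- `w` is a possible rate of change of the manipulator and of the parameter estimate of a node,
with the signum function replaced by the set of generalized signs. -/
def NodeRates (t : ℝ) (s w : NodeState m p k) : Prop :=
  NodeState.q w = NodeState.dq s ∧
  (∃ σ, IsSignOf σ (sHat M G t s) ∧ NodeState.dq w = switchedAcc M G t s (M.d t) σ) ∧
  NodeState.θhat w = adaptation M G t s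

/-- The difference between the estimate of the task-space position and the task-space position. -/
def trackErr (s : NodeState m p k) : Euc m := taskPos M s - NodeState.xhat s

/-- The Lyapunov function `½ ŝᵀ H ŝ + ½ (ϑ̂ - ϑ)ᵀ T⁻¹ (ϑ̂ - ϑ)`. -/
def nodeEnergy (t : ℝ) (s : NodeState m p k) : ℝ :=
  2⁻¹ * ⟪M.H (NodeState.q s) (sHat M G t s), sHat M G t s⟫ +
    2⁻¹ * ∑ l, (G.T l l)⁻¹ * (NodeState.θhat s l - M.θ l) ^ 2

/-- The mismatch between the derivative of the auxiliary velocity and the auxiliary acceleration. -/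
def auxMismatch (s w : NodeState m p k) : Euc p :=
  M.sharp (NodeState.q s) ((NodeState.vhat w - NodeState.ahat s) +
    G.α • (NodeState.xhat w - NodeState.vhat s))

variable {M G} {t₀ : ℝ}

theorem contDiff_auxVel (hM : M.Regular t₀) :
    ContDiff ℝ 1 fun y : ℝ × NodeState m p k => auxVel M G y.1 y.2 := by
  unfold auxVel taskPos
  have hq : ContDiff ℝ 1 fun y : ℝ × NodeState m p k => NodeState.q y.2 := by
    unfold NodeState.q; fun_prop
  have hψ := (hM.ψ_smooth.of_le (m := 1) (by norm_num)).comp hq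
  refine ContDiff.add (ContDiff.clm_apply (hM.contDiff_sharp.comp hq) ?_)
    (hM.contDiff_nullφ.comp (contDiff_fst.prodMk hq))
  refine ContDiff.sub (by unfold NodeState.vhat; fun_prop) (ContDiff.const_smul _ (hψ.sub ?_))
  unfold NodeState.xhat; fun_prop

theorem contDiff_sHat (hM : M.Regular t₀) :
    ContDiff ℝ 1 fun y : ℝ × NodeState m p k => sHat M G y.1 y.2 := by
  unfold sHat
  exact ContDiff.sub (by unfold NodeState.dq; fun_prop) (contDiff_auxVel hM)

theorem contDiff_nodeEnergy (hM : M.Regular t₀) :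
    ContDiff ℝ 1 fun y : ℝ × NodeState m p k => nodeEnergy M G y.1 y.2 := by
  unfold nodeEnergy
  have hq : ContDiff ℝ 1 fun y : ℝ × NodeState m p k => NodeState.q y.2 := by
    unfold NodeState.q; fun_prop
  have hs := contDiff_sHat (G := G) hM
  refine ContDiff.add (contDiff_const.mul (((hM.H_smooth.comp hq).clm_apply hs).inner ℝ hs))
    (contDiff_const.mul (ContDiff.sum fun l _ => contDiff_const.mul (ContDiff.pow ?_ 2)))
  refine ContDiff.sub ?_ contDiff_const
  unfold NodeState.θhat; fun_prop

theorem contDiff_trackErr (hM : M.Regular t₀) :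
    ContDiff ℝ 1 fun s : NodeState m p k => trackErr M s := by
  unfold trackErr taskPos
  refine ContDiff.sub ((hM.ψ_smooth.of_le (m := 1) (by norm_num)).comp ?_) ?_
  · unfold NodeState.q; fun_prop
  · unfold NodeState.xhat; fun_prop

theorem hasDerivAt_trackErr (hM : M.Regular t₀) {s : ℝ → NodeState m p k} {w : NodeState m p k}
    {t : ℝ} (hs : HasDerivAt s w t) (hq : NodeState.q w = NodeState.dq (s t)) :
    HasDerivAt (fun τ => trackErr M (s τ)) (taskVel M (s t) - NodeState.xhat w) t := by
  obtain ⟨h1, -, -, h4, -, -⟩ := NodeState.hasDerivAt_comp hs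
  have hψ : HasFDerivAt M.ψ (M.J (NodeState.q (s t))) (NodeState.q (s t)) :=
    (hM.ψ_smooth.differentiable (by norm_num) _).hasFDerivAt
  have h5 := hψ.comp_hasDerivAt t h1
  rw [hq] at h5
  exact h5.sub h4

/-- The auxiliary acceleration is formed as if x̂' = v̂ and v̂' = â; the defect of these two
relations enters only through J^♯. -/
theorem hasDerivAt_auxVel (hM : M.Regular t₀) {s : ℝ → NodeState m p k} {w : NodeState m p k}
    {t : ℝ} (hs : HasDerivAt s w t) (hq : NodeState.q w = NodeState.dq (s t)) :
    HasDerivAt (fun τ => auxVel M G τ (s τ)) (auxAcc M G t (s t) + auxMismatch M G (s t) w) t := by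
  obtain ⟨h1, -, -, -, h5, -⟩ := NodeState.hasDerivAt_comp hs
  have hr := hasDerivAt_trackErr hM hs hq
  have hsharp := ((hM.contDiff_sharp.differentiable one_ne_zero) (NodeState.q (s t))).hasFDerivAt.comp_hasDerivAt
    t h1
  have hnull := ((hM.contDiff_nullφ.differentiable one_ne_zero) (t, NodeState.q (s t))).hasFDerivAt.comp_hasDerivAt
    t ((hasDerivAt_id t).prodMk h1)
  have h6 := (hsharp.clm_apply (h5.sub (hr.const_smul G.α))).add hnull
  refine h6.congr_deriv ?_
  rw [hq]
  simp only [auxAcc, auxMismatch, trackErr, map_add, map_sub, map_smul, smul_sub,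
    Function.comp_apply, Pi.sub_apply, Pi.smul_apply]
  abel

theorem hasDerivAt_sHat (hM : M.Regular t₀) {s : ℝ → NodeState m p k} {w : NodeState m p k}
    {t : ℝ} (hs : HasDerivAt s w t) (hq : NodeState.q w = NodeState.dq (s t)) :
    HasDerivAt (fun τ => sHat M G τ (s τ))
      (NodeState.dq w - auxAcc M G t (s t) - auxMismatch M G (s t) w) t := by
  obtain ⟨-, h2, -⟩ := NodeState.hasDerivAt_comp hs
  have := h2.sub (hasDerivAt_auxVel (G := G) hM hs hq)
  rwa [sub_sub]

theorem J_auxVel (hM : M.Regular t₀) (t : ℝ) (s : NodeState m p k) :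
    M.J (NodeState.q s) (auxVel M G t s) = NodeState.vhat s - G.α • trackErr M s := by
  rw [auxVel, map_add, hM.J_sharp, Manipulator.nullφ, hM.J_nullProj, add_zero, trackErr]

theorem taskVel_eq (hM : M.Regular t₀) (t : ℝ) (s : NodeState m p k) :
    taskVel M s = M.J (NodeState.q s) (sHat M G t s) + NodeState.vhat s - G.α • trackErr M s := by
  rw [sHat, map_sub, J_auxVel hM, taskVel]; abel

/-- The projection kills the range of J^♯ and is idempotent, so only ŝ survives. -/
theorem subtaskError_eq (hM : M.Regular t₀) (t : ℝ) (s : NodeState m p k) :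
    subtaskError M t s = M.nullProj (NodeState.q s) (sHat M G t s) := by
  rw [subtaskError, sHat, auxVel, map_sub, map_sub, map_add, hM.nullProj_sharp, Manipulator.nullφ,
    hM.nullProj_nullProj, zero_add]

/-- The error r satisfies r' = b - αr with b = Jŝ + (v̂ - x̂'), and Young's inequality 2⟨r, b⟩ ≤
α‖r‖² + ‖b‖²/α uses half of the damping -2α‖r‖². -/
theorem deriv_norm_sq_trackErr_le (hM : M.Regular t₀) (hα : 0 < G.α) {s : ℝ → NodeState m p k}
    {w : NodeState m p k} {t : ℝ} (hs : HasDerivAt s w t)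
    (hq : NodeState.q w = NodeState.dq (s t)) {e : ℝ}
    (he : HasDerivAt (fun τ => ‖trackErr M (s τ)‖ ^ 2) e t) :
    e ≤ -G.α * ‖trackErr M (s t)‖ ^ 2 + G.α⁻¹ * ‖M.J (NodeState.q (s t)) (sHat M G t (s t)) +
      (NodeState.vhat (s t) - NodeState.xhat w)‖ ^ 2 := by
  have h1 := (hasDerivAt_trackErr hM hs hq).norm_sq
  rw [he.unique h1, taskVel_eq (G := G) hM t]
  set r := trackErr M (s t)
  set b := M.J (NodeState.q (s t)) (sHat M G t (s t)) + (NodeState.vhat (s t) - NodeState.xhat w)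
    with hb
  have e1 : M.J (NodeState.q (s t)) (sHat M G t (s t)) + NodeState.vhat (s t) - G.α • r -
      NodeState.xhat w = b - G.α • r := by rw [hb]; abel
  rw [e1, inner_sub_right, inner_smul_right, real_inner_self_eq_norm_sq]
  have h2 := real_inner_le_norm r b
  have h3 : 2 * (‖r‖ * ‖b‖) ≤ G.α * ‖r‖ ^ 2 + G.α⁻¹ * ‖b‖ ^ 2 := by
    have h4 : 0 ≤ G.α⁻¹ * (G.α * ‖r‖ - ‖b‖) ^ 2 := by positivity
    have h5 : G.α⁻¹ * (G.α * ‖r‖ - ‖b‖) ^ 2 =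
        G.α * ‖r‖ ^ 2 - 2 * (‖r‖ * ‖b‖) + G.α⁻¹ * ‖b‖ ^ 2 := by field_simp; ring
    linarith
  linarith

theorem norm_disturbance_le (hM : M.Regular t₀) (hG : G.Admissible M t₀) {t : ℝ} (ht : t₀ ≤ t) :
    ‖M.d t‖ ≤ lambdaMin G.Kr := by
  refine le_trans ?_ hG.Kr_dist
  obtain ⟨c, hc⟩ := hM.d_bdd
  exact le_ciSup (f := fun t : Ici t₀ => ‖M.d t‖) ⟨c, by rintro _ ⟨t, rfl⟩; exact hc t t.2⟩ ⟨t, ht⟩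

/-- The linear parametrization gives Hŝ' = Y(ϑ̂-ϑ) - JᵀK_xJŝ - K_sŝ - K_rσ - Cŝ - d - HΔ, where Δ is
the mismatch. Tested with ŝ, the Coriolis term cancels ½H', the adaptation law cancels the parameter
error, K_x only dissipates and K_r outweighs d. -/
theorem deriv_nodeEnergy_le (hM : M.Regular t₀) (hG : G.Admissible M t₀)
    {s : ℝ → NodeState m p k} {w : NodeState m p k} {t : ℝ} (ht : t₀ ≤ t) (hs : HasDerivAt s w t)
    (hw : NodeRates M G t (s t) w) {e : ℝ}
    (he : HasDerivAt (fun τ => nodeEnergy M G τ (s τ)) e t) :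
    e ≤ -⟪matAct G.Ks (sHat M G t (s t)), sHat M G t (s t)⟫ -
      ⟪M.H (NodeState.q (s t)) (auxMismatch M G (s t) w), sHat M G t (s t)⟫ := by
  obtain ⟨hq, ⟨σ, hσ, hdq⟩, hθ⟩ := hw
  obtain ⟨h1, -, h3, -⟩ := NodeState.hasDerivAt_comp hs
  have hsd := hasDerivAt_sHat (G := G) hM hs hq
  have hH := ((hM.H_smooth.differentiable one_ne_zero) (NodeState.q (s t))).hasFDerivAt.comp_hasDerivAt
    t h1
  have hin := (hH.clm_apply hsd).inner ℝ hsd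
  have hθd : ∀ l, HasDerivAt (fun τ => (G.T l l)⁻¹ * (NodeState.θhat (s τ) l - M.θ l) ^ 2)
      ((G.T l l)⁻¹ * (2 * (NodeState.θhat (s t) l - M.θ l) * NodeState.θhat w l)) t := by
    intro l
    have h4 : HasDerivAt (fun τ => NodeState.θhat (s τ) l) (NodeState.θhat w l) t :=
      (EuclideanSpace.proj (𝕜 := ℝ) l).hasFDerivAt.comp_hasDerivAt t h3
    have h5 := ((h4.sub_const (M.θ l)).pow 2).const_mul (G.T l l)⁻¹
    refine h5.congr_deriv ?_
    simp
  have hsum := HasDerivAt.fun_sum (u := Finset.univ) fun l _ => hθd l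
  have hV := (hin.const_mul 2⁻¹).add (hsum.const_mul 2⁻¹)
  rw [he.unique hV]
  clear hV hsum hin hθd hH hsd he
  -- T is diagonal, so the weights (T_ll)⁻¹ of the energy cancel the adaptation gains.
  have hYsum : (2⁻¹ : ℝ) * ∑ l, (G.T l l)⁻¹ * (2 * (NodeState.θhat (s t) l - M.θ l) * NodeState.θhat w l) =
      -⟪regressor M G t (s t) (NodeState.θhat (s t) - M.θ), sHat M G t (s t)⟫ := by
    rw [← ContinuousLinearMap.adjoint_inner_right, inner_euc, ← Finset.sum_neg_distrib,
      Finset.mul_sum]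
    refine Finset.sum_congr rfl fun l _ => ?_
    rw [hθ, adaptation]
    have hT := (hG.T_pos.diag_pos (i := l)).ne'
    rw [PiLp.neg_apply, matAct_apply_of_isDiag hG.T_diag, PiLp.sub_apply]
    field_simp
  rw [hYsum]
  set q := NodeState.q (s t)
  set ŝ := sHat M G t (s t) with hŝ
  set Δ := auxMismatch M G (s t) w
  set Yr := regressor M G t (s t) with hYr
  simp only [Function.comp_apply]
  have hpar : Yr M.θ = M.H q (auxAcc M G t (s t)) + M.C q (NodeState.dq (s t)) (auxVel M G t (s t)) +
      M.g q := (hM.Y_param _ _ _ _).symm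
  have hHw : M.H q (NodeState.dq w) = Yr (NodeState.θhat (s t))
      - ContinuousLinearMap.adjoint (M.J q) (matAct G.Kx (M.J q ŝ))
      - matAct G.Ks ŝ - matAct G.Kr σ
      - M.C q (NodeState.dq (s t)) (NodeState.dq (s t)) - M.g q - M.d t := by
    rw [hdq]; exact (hM.isInvertible_H q).apply_inverse _
  have hmain : M.H q (NodeState.dq w - auxAcc M G t (s t) - Δ) =
      Yr (NodeState.θhat (s t) - M.θ) - ContinuousLinearMap.adjoint (M.J q) (matAct G.Kx (M.J q ŝ))
      - matAct G.Ks ŝ - matAct G.Kr σ - M.C q (NodeState.dq (s t)) ŝ - M.d t - M.H q Δ := by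
    have e1 : ŝ = NodeState.dq (s t) - auxVel M G t (s t) := rfl
    have e2 : M.C q (NodeState.dq (s t)) ŝ = M.C q (NodeState.dq (s t)) (NodeState.dq (s t)) -
        M.C q (NodeState.dq (s t)) (auxVel M G t (s t)) := by rw [e1, map_sub]
    rw [map_sub, map_sub, hHw, map_sub Yr, hpar, e2]
    abel
  have hskew := hM.skew q (NodeState.dq (s t)) ŝ
  rw [sub_apply, smul_apply, inner_sub_left, inner_smul_left, RCLike.conj_to_real] at hskew
  have hsymm : ⟪M.H q ŝ, NodeState.dq w - auxAcc M G t (s t) - Δ⟫ =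
      ⟪M.H q (NodeState.dq w - auxAcc M G t (s t) - Δ), ŝ⟫ := by
    rw [real_inner_comm]
    exact ((ContinuousLinearMap.isSelfAdjoint_iff_isSymmetric.1 (hM.H_symm q)) _ _).symm
  have hKx : 0 ≤ ⟪ContinuousLinearMap.adjoint (M.J q) (matAct G.Kx (M.J q ŝ)), ŝ⟫ := by
    rw [ContinuousLinearMap.adjoint_inner_left]
    exact inner_matAct_nonneg hG.Kx_pos _
  have hKr := hσ.le_inner_matAct hG.Kr_diag (norm_nonneg _) (norm_disturbance_le hM hG ht)
  have hd : -(‖M.d t‖ * ‖ŝ‖) ≤ ⟪M.d t, ŝ⟫ :=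
    (abs_le.1 (abs_real_inner_le_norm (M.d t) ŝ)).1
  rw [hsymm, hq, inner_add_left, hmain]
  simp only [inner_sub_left]
  have hm' : ⟪Yr (NodeState.θhat (s t) - M.θ), ŝ⟫ = ⟪Yr (NodeState.θhat (s t) - M.θ), ŝ⟫ := rfl
  linarith

end Node

/-! ### Boundedness and convergence of one node -/

theorem AbsolutelyContinuousOnInterval.norm_sub_le {E : Type*} [NormedAddCommGroup E]
    [NormedSpace ℝ E] {f : ℝ → E} {a b c : ℝ} (hab : a ≤ b)
    (hf : AbsolutelyContinuousOnInterval f a b)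
    (h : ∀ᵐ t ∂volume.restrict (Icc a b), ∃ w, HasDerivAt f w t ∧ ‖w‖ ≤ c) :
    ‖f b - f a‖ ≤ c * (b - a) := by
  -- A norming functional reduces the claim to the scalar case. It requires a nonzero increment; for
  -- a zero increment c ≥ 0 is needed, which any single time of differentiability provides if a < b.
  rcases eq_or_ne ‖f b - f a‖ 0 with h0 | h0
  · rcases hab.eq_or_lt with rfl | hlt
    · simp
    have hne : (ae (volume.restrict (Icc a b))).NeBot := by
      rw [ae_neBot]
      intro hzero
      have := Measure.restrict_eq_zero.1 hzero
      simp [hlt.not_ge] at this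
    obtain ⟨t, w, -, hw⟩ := h.exists
    rw [h0]
    exact mul_nonneg ((norm_nonneg w).trans hw) (by linarith)
  obtain ⟨ℓ, hℓ, hℓv⟩ := exists_dual_vector ℝ _ h0
  have hac : AbsolutelyContinuousOnInterval (fun t => ℓ (f t)) a b :=
    (ℓ.lipschitz.lipschitzOnWith (s := univ)).comp_absolutelyContinuousOnInterval hf
      (mapsTo_univ _ _)
  have := hac.sub_le_of_deriv_le (c := c) hab (by
    filter_upwards [h] with t ⟨w, hw, hwc⟩ d hd
    rw [hd.unique (ℓ.hasFDerivAt.comp_hasDerivAt t hw)]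
    refine (le_abs_self _).trans ((ℓ.le_opNorm w).trans ?_)
    rwa [hℓ, one_mul])
  rw [← map_sub, hℓv] at this
  exact this

theorem le_add_one_of_sq_le {x K : ℝ} (h : x ^ 2 ≤ K) : x ≤ K + 1 := by
  nlinarith [sq_nonneg (x - 1)]

section Node

variable {m p k : ℕ} {M : Manipulator m p k} {G : Gains m p k} {t₀ : ℝ}

theorem absolutelyContinuousOnInterval_nodeEnergy (hM : M.Regular t₀) {s : ℝ → NodeState m p k} {a b : ℝ}
    (hs : AbsolutelyContinuousOnInterval s a b) :
    AbsolutelyContinuousOnInterval (fun t => nodeEnergy M G t (s t)) a b :=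
  (contDiff_nodeEnergy (G := G) hM).comp_absolutelyContinuousOnInterval
    (γ := fun t => (t, s t)) ((AbsolutelyContinuousOnInterval.id a b).prodMk hs)

theorem absolutelyContinuousOnInterval_sHat (hM : M.Regular t₀) {s : ℝ → NodeState m p k} {a b : ℝ}
    (hs : AbsolutelyContinuousOnInterval s a b) :
    AbsolutelyContinuousOnInterval (fun t => sHat M G t (s t)) a b :=
  (contDiff_sHat (G := G) hM).comp_absolutelyContinuousOnInterval
    (γ := fun t => (t, s t)) ((AbsolutelyContinuousOnInterval.id a b).prodMk hs)

theorem absolutelyContinuousOnInterval_norm_sq_trackErr (hM : M.Regular t₀) {s : ℝ → NodeState m p k} {a b : ℝ}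
    (hs : AbsolutelyContinuousOnInterval s a b) :
    AbsolutelyContinuousOnInterval (fun t => ‖trackErr M (s t)‖ ^ 2) a b :=
  ((contDiff_trackErr hM).norm_sq ℝ).comp_absolutelyContinuousOnInterval hs

theorem exists_nodeEnergy_coercive (hM : M.Regular t₀) (hG : G.Admissible M t₀) :
    ∃ μ > 0, ∀ t s, μ * ‖sHat M G t s‖ ^ 2 ≤ nodeEnergy M G t s ∧
      μ * ‖NodeState.θhat s - M.θ‖ ^ 2 ≤ nodeEnergy M G t s := by
  obtain ⟨h, hh, hH⟩ := hM.H_pos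
  have hT : ∀ l, 0 < G.T l l := fun l => hG.T_pos.diag_pos
  -- τ exceeds every T_ll and is positive even without parameters, so τ⁻¹ bounds all weights
  -- (T_ll)⁻¹ from below.
  set τ := 1 + ∑ l, G.T l l with hτ
  have hτ0 : 0 < τ := add_pos_of_pos_of_nonneg one_pos (Finset.sum_nonneg fun l _ => (hT l).le)
  have hTτ : ∀ l, τ⁻¹ ≤ (G.T l l)⁻¹ := fun l => by
    refine inv_anti₀ (hT l) ?_
    have : G.T l l ≤ ∑ l, G.T l l :=
      Finset.single_le_sum (f := fun l => G.T l l) (fun l _ => (hT l).le) (Finset.mem_univ l)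
    linarith
  refine ⟨2⁻¹ * min h τ⁻¹, by positivity, fun t s => ?_⟩
  have h1 : h * ‖sHat M G t s‖ ^ 2 ≤ ⟪M.H (NodeState.q s) (sHat M G t s), sHat M G t s⟫ := hH _ _
  have h2 : τ⁻¹ * ‖NodeState.θhat s - M.θ‖ ^ 2 ≤
      ∑ l, (G.T l l)⁻¹ * (NodeState.θhat s l - M.θ l) ^ 2 := by
    rw [EuclideanSpace.norm_sq_eq, Finset.mul_sum]
    refine Finset.sum_le_sum fun l _ => ?_
    rw [Real.norm_eq_abs, sq_abs, PiLp.sub_apply]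
    exact mul_le_mul_of_nonneg_right (hTτ l) (sq_nonneg _)
  have h3 : min h τ⁻¹ * ‖sHat M G t s‖ ^ 2 ≤ h * ‖sHat M G t s‖ ^ 2 := by
    gcongr; exact min_le_left _ _
  have h4 : min h τ⁻¹ * ‖NodeState.θhat s - M.θ‖ ^ 2 ≤ τ⁻¹ * ‖NodeState.θhat s - M.θ‖ ^ 2 := by
    gcongr; exact min_le_right _ _
  have h5 : 0 ≤ h * ‖sHat M G t s‖ ^ 2 := by positivity
  have h6 : 0 ≤ τ⁻¹ * ‖NodeState.θhat s - M.θ‖ ^ 2 := by positivity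
  rw [nodeEnergy]
  constructor <;> linarith

theorem nodeEnergy_nonneg (hM : M.Regular t₀) (hG : G.Admissible M t₀) (t : ℝ)
    (s : NodeState m p k) : 0 ≤ nodeEnergy M G t s := by
  obtain ⟨μ, hμ, h⟩ := exists_nodeEnergy_coercive hM hG
  exact le_trans (by positivity) (h t s).1

theorem exists_norm_auxVel_le (hM : M.Regular t₀) (hα : 0 < G.α) (v : ℝ) : ∃ B, ∀ t s, t₀ ≤ t →
    ‖NodeState.vhat s‖ ≤ v → ‖trackErr M s‖ ≤ v → ‖auxVel M G t s‖ ≤ B := by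
  obtain ⟨b, hb⟩ := hM.sharp_bdd
  obtain ⟨N, hN⟩ := hM.nullφ_bdd
  have hb0 : 0 ≤ b := (norm_nonneg _).trans (hb 0)
  refine ⟨b * (v + G.α * v) + N, fun t s ht hv hr => ?_⟩
  refine (norm_add_le _ _).trans (add_le_add ?_ (hN t _ ht))
  refine ((M.sharp _).le_opNorm _).trans (mul_le_mul (hb _) ?_ (norm_nonneg _) hb0)
  refine (norm_sub_le _ _).trans (add_le_add hv ?_)
  rw [norm_smul, Real.norm_eq_abs, abs_of_pos hα]
  exact mul_le_mul_of_nonneg_left hr hα.le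

/-- Bounds for the motion of a node, in terms of the initial energy, the initial tracking error and
bounds for the estimates. -/
theorem exists_motion_bound (hM : M.Regular t₀) (hG : G.Admissible M t₀) (ρ v ℓ : ℝ) :
    ∃ B, ∀ a b c, t₀ ≤ a → a ≤ b → 0 ≤ c → c ^ 2 * (b - a) ≤ ℓ → ∀ s : ℝ → NodeState m p k,
      AbsolutelyContinuousOnInterval s a b → nodeEnergy M G a (s a) ≤ ρ →
      ‖trackErr M (s a)‖ ^ 2 ≤ ρ → (∀ t ∈ Icc a b, ‖NodeState.vhat (s t)‖ ≤ v) →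
      (∀ᵐ t ∂volume.restrict (Icc a b), ∃ w, HasDerivAt s w t ∧ NodeRates M G t (s t) w ∧
        ‖auxMismatch M G (s t) w‖ ≤ c ∧ ‖NodeState.xhat w‖ ≤ v) →
      ‖sHat M G b (s b)‖ ≤ B ∧ ‖NodeState.θhat (s b) - M.θ‖ ≤ B ∧ ‖trackErr M (s b)‖ ≤ B ∧
        ‖NodeState.dq (s b)‖ ≤ B ∧ ‖auxVel M G b (s b)‖ ≤ B := by
  obtain ⟨hb, hHb⟩ := hM.H_bdd
  obtain ⟨j, hj⟩ := hM.J_bdd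
  obtain ⟨lam, hlam, hKs⟩ := exists_coercive_of_posDef hG.Ks_pos
  obtain ⟨μ, hμ, hco⟩ := exists_nodeEnergy_coercive hM hG
  have hb0 : 0 ≤ hb := (norm_nonneg _).trans (hHb 0)
  have hj0 : 0 ≤ j := (norm_nonneg _).trans (hj 0)
  -- Young's inequality gives hb c‖ŝ‖ ≤ lam‖ŝ‖² + hb²c²/(4 lam); the last term, integrated over [a,
  -- b], is the energy gained, since c²(b - a) ≤ ℓ. S bounds ŝ and ϑ̂ - ϑ, y bounds the squared
  -- tracking error (with v + v for v̂ - x̂'), and A bounds the auxiliary velocity.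
  set Vb := ρ + hb ^ 2 / (4 * lam) * ℓ with hVb
  set S := Vb / μ + 1 with hS
  set y := ρ + G.α⁻¹ * (j * S + (v + v)) ^ 2 / G.α with hy
  obtain ⟨A, hA⟩ := exists_norm_auxVel_le (G := G) hM hG.α_pos (max v (y + 1))
  refine ⟨max S (max (y + 1) (S + A)), fun a b c ha hab hc hcℓ s hs hV hr hv hw => ?_⟩
  have hAC : AbsolutelyContinuousOnInterval (fun t => nodeEnergy M G t (s t)) a b :=
    absolutelyContinuousOnInterval_nodeEnergy hM hs
  have hVt : ∀ t ∈ Icc a b, nodeEnergy M G t (s t) ≤ Vb := by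
    intro t ht
    have h1 := (hAC.mono_Icc le_rfl ht.1 ht.2).sub_le_of_deriv_le
      (c := hb ^ 2 / (4 * lam) * c ^ 2) ht.1 (by
      filter_upwards [ae_restrict_Icc_mono hw le_rfl ht.2, ae_restrict_mem measurableSet_Icc]
        with τ ⟨w, hwd, hwr, hwm, _⟩ hτ d hd
      refine (deriv_nodeEnergy_le hM hG (ha.trans hτ.1) hwd hwr hd).trans ?_
      set u := sHat M G τ (s τ)
      have h2 := hKs u
      have h3 : |⟪M.H (NodeState.q (s τ)) (auxMismatch M G (s τ) w), u⟫| ≤ (hb * c) * ‖u‖ := by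
        refine (abs_real_inner_le_norm _ _).trans ?_
        gcongr
        exact ((M.H _).le_opNorm _).trans (mul_le_mul (hHb _) hwm (norm_nonneg _) hb0)
      have h4 := (abs_le.1 h3).1
      have h5 : hb * c * ‖u‖ ≤ lam * ‖u‖ ^ 2 + hb ^ 2 / (4 * lam) * c ^ 2 := by
        have h6 : 0 ≤ lam⁻¹ * (lam * ‖u‖ - hb * c / 2) ^ 2 := by positivity
        have h7 : lam⁻¹ * (lam * ‖u‖ - hb * c / 2) ^ 2 =
            lam * ‖u‖ ^ 2 - hb * c * ‖u‖ + hb ^ 2 / (4 * lam) * c ^ 2 := by field_simp; ring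
        linarith
      linarith)
    have h8 : hb ^ 2 / (4 * lam) * c ^ 2 * (t - a) ≤ hb ^ 2 / (4 * lam) * ℓ := by
      rw [mul_assoc]
      gcongr
      refine le_trans ?_ hcℓ
      gcongr
      exact ht.2
    linarith
  have hsq : ∀ x, μ * x ^ 2 ≤ Vb → x ≤ S := fun x hx => by
    refine le_add_one_of_sq_le ?_
    rw [le_div_iff₀ hμ]; linarith
  have hSt : ∀ t ∈ Icc a b, ‖sHat M G t (s t)‖ ≤ S := fun t ht =>
    hsq _ ((hco t (s t)).1.trans (hVt t ht))
  have hbb : b ∈ Icc a b := ⟨hab, le_rfl⟩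
  have hθ : ‖NodeState.θhat (s b) - M.θ‖ ≤ S := hsq _ ((hco b (s b)).2.trans (hVt b hbb))
  have hrAC : AbsolutelyContinuousOnInterval (fun t => ‖trackErr M (s t)‖ ^ 2) a b :=
    absolutelyContinuousOnInterval_norm_sq_trackErr hM hs
  have hv0 : 0 ≤ v := (norm_nonneg _).trans (hv b hbb)
  have hrb : ‖trackErr M (s b)‖ ≤ y + 1 := by
    refine le_add_one_of_sq_le ?_
    have := hrAC.le_of_deriv_le (y := fun t => ‖trackErr M (s t)‖ ^ 2) (c := G.α)
      (k := G.α⁻¹ * (j * S + (v + v)) ^ 2) hab hG.α_pos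
      (mul_nonneg (inv_nonneg.2 hG.α_pos.le) (sq_nonneg _)) (sq_nonneg _) (by
        filter_upwards [hw, ae_restrict_mem measurableSet_Icc] with t ⟨w, hwd, hwr, _, hwx⟩ ht d hd
        refine (deriv_norm_sq_trackErr_le hM hG.α_pos hwd hwr.1 hd).trans ?_
        refine add_le_add le_rfl (mul_le_mul_of_nonneg_left (pow_le_pow_left₀ (norm_nonneg _) ?_ 2)
          (inv_nonneg.2 hG.α_pos.le))
        refine (norm_add_le _ _).trans (add_le_add ?_ ?_)
        · exact ((M.J _).le_opNorm _).trans (mul_le_mul (hj _) (hSt t ht) (norm_nonneg _) hj0)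
        · exact (norm_sub_le _ _).trans (add_le_add (hv t ht) hwx))
    linarith
  have hav : ‖auxVel M G b (s b)‖ ≤ A :=
    hA b _ (ha.trans hab) ((hv b hbb).trans (le_max_left _ _)) (hrb.trans (le_max_right _ _))
  have hS0 : 0 ≤ S := (norm_nonneg _).trans hθ
  refine ⟨(hSt b hbb).trans (le_max_left _ _), hθ.trans (le_max_left _ _),
    hrb.trans ((le_max_left _ _).trans (le_max_right _ _)), ?_, ?_⟩
  · refine le_trans ?_ ((le_max_right (y + 1) (S + A)).trans (le_max_right _ _))
    have : NodeState.dq (s b) = sHat M G b (s b) + auxVel M G b (s b) := by rw [sHat]; abel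
    rw [this]
    exact (norm_add_le _ _).trans (add_le_add (hSt b hbb) hav)
  · refine hav.trans (le_trans ?_ ((le_max_right (y + 1) (S + A)).trans (le_max_right _ _)))
    linarith

/-- A priori bound for the state of a node on bounded time intervals. -/
theorem exists_apriori_bound (hM : M.Regular t₀) (hG : G.Admissible M t₀) (c T : ℝ)
    (s₀ : NodeState m p k) :
    ∃ R, ∀ τ ∈ Icc t₀ T, ∀ s : ℝ → NodeState m p k, s t₀ = s₀ →
      AbsolutelyContinuousOnInterval s t₀ τ →
      (∀ᵐ t ∂volume.restrict (Icc t₀ τ), ∃ w, HasDerivAt s w t ∧ NodeRates M G t (s t) w ∧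
        ‖NodeState.xhat w‖ ≤ c ∧ ‖NodeState.vhat w‖ ≤ c ∧ ‖NodeState.ahat w‖ ≤ c) → ‖s τ‖ < R := by
  obtain ⟨b, hb⟩ := hM.sharp_bdd
  have hb0 : 0 ≤ b := (norm_nonneg _).trans (hb 0)
  set C := |c| with hC
  set L := |T - t₀| with hL
  -- E bounds the estimates, D the mismatch and D²L the energy budget of the mismatch. The final
  -- radius adds the bounds for all blocks of the state, plus 1 for strictness.
  set E := ‖s₀‖ + C * L with hE
  set D := b * ((C + E) + G.α * (C + E)) with hD
  set ρ := max (nodeEnergy M G t₀ s₀) (‖trackErr M s₀‖ ^ 2) with hρ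
  obtain ⟨B, hB⟩ := exists_motion_bound hM hG ρ (E + C) (D ^ 2 * L)
  refine ⟨1 + (E + (‖M.θ‖ + |B| + (‖s₀‖ + |B| * L))), fun τ hτ s hs0 hs hw => ?_⟩
  have hα := hG.α_pos
  have hest : ∀ {F : Type} [NormedAddCommGroup F] [NormedSpace ℝ F]
      (P : NodeState m p k →L[ℝ] F), (∀ x, ‖P x‖ ≤ ‖x‖) → ∀ C' : ℝ, 0 ≤ C' → ∀ t ∈ Icc t₀ τ,
      (∀ᵐ t ∂volume.restrict (Icc t₀ τ), ∃ w, HasDerivAt s w t ∧ ‖P w‖ ≤ C') →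
      ‖P (s t)‖ ≤ ‖s₀‖ + C' * L := by
    intro F _ _ P hP C' hC' t ht hP'
    have h1 : AbsolutelyContinuousOnInterval (fun t => P (s t)) t₀ t :=
      P.contDiff.comp_absolutelyContinuousOnInterval (hs.mono_Icc le_rfl ht.1 ht.2)
    have h2 := h1.norm_sub_le (c := C') ht.1 (by
      filter_upwards [ae_restrict_Icc_mono hP' le_rfl ht.2] with u ⟨w, hwd, hwc⟩
      exact ⟨P w, P.hasFDerivAt.comp_hasDerivAt u hwd, hwc⟩)
    rw [hs0] at h2
    have h3 : ‖P (s t)‖ ≤ ‖P s₀‖ + ‖P (s t) - P s₀‖ := by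
      simpa using norm_add_le (P s₀) (P (s t) - P s₀)
    have h4 : C' * (t - t₀) ≤ C' * L := by
      gcongr
      exact le_trans (by linarith [ht.2, hτ.2]) (le_abs_self (T - t₀))
    linarith [hP s₀]
  let Pq : NodeState m p k →L[ℝ] Euc p := ContinuousLinearMap.fst ℝ _ _
  let P1 : NodeState m p k →L[ℝ] (Euc p × Euc k × Euc m × Euc m × Euc m) :=
    ContinuousLinearMap.snd ℝ _ _
  let P2 : NodeState m p k →L[ℝ] (Euc k × Euc m × Euc m × Euc m) :=
    (ContinuousLinearMap.snd ℝ _ _).comp P1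
  let P3 : NodeState m p k →L[ℝ] (Euc m × Euc m × Euc m) :=
    (ContinuousLinearMap.snd ℝ _ _).comp P2
  have hP3 : ∀ x : NodeState m p k, ‖P3 x‖ ≤ ‖x‖ := fun x =>
    (norm_snd_le (x := x.2.2)).trans ((norm_snd_le (x := x.2)).trans (norm_snd_le (x := x)))
  have hzeta : ∀ t ∈ Icc t₀ τ, ‖P3 (s t)‖ ≤ E := fun t ht => by
    refine hest P3 hP3 C (abs_nonneg c) t ht ?_
    filter_upwards [hw] with u ⟨w, hwd, _, h1, h2, h3⟩
    have hc := le_abs_self c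
    exact ⟨w, hwd, max_le (h1.trans hc) (max_le (h2.trans hc) (h3.trans hc))⟩
  have hvhat : ∀ t ∈ Icc t₀ τ, ‖NodeState.vhat (s t)‖ ≤ E := fun t ht =>
    ((norm_fst_le (x := (P3 (s t)).2)).trans (norm_snd_le (x := P3 (s t)))).trans (hzeta t ht)
  have hahat : ∀ t ∈ Icc t₀ τ, ‖NodeState.ahat (s t)‖ ≤ E := fun t ht =>
    ((norm_snd_le (x := (P3 (s t)).2)).trans (norm_snd_le (x := P3 (s t)))).trans (hzeta t ht)
  have hC0 : 0 ≤ C := abs_nonneg c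
  have hL0 : 0 ≤ L := abs_nonneg _
  have hE0 : 0 ≤ E := by positivity
  have hmot : ∀ t ∈ Icc t₀ τ, ‖NodeState.dq (s t)‖ ≤ |B| ∧
      ‖NodeState.θhat (s t) - M.θ‖ ≤ |B| := by
    intro t ht
    have := hB t₀ t D le_rfl ht.1 (by positivity) (by
        gcongr
        exact le_trans (by linarith [ht.2, hτ.2]) (le_abs_self (T - t₀))) s
      (hs.mono_Icc le_rfl ht.1 ht.2) (by rw [hs0]; exact le_max_left _ _)
      (by rw [hs0]; exact le_max_right _ _)
      (fun u hu => (hvhat u ⟨hu.1, hu.2.trans ht.2⟩).trans (by linarith)) (by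
        filter_upwards [ae_restrict_Icc_mono hw le_rfl ht.2, ae_restrict_mem measurableSet_Icc]
          with u ⟨w, hwd, hwr, h1, h2, h3⟩ hu
        have hu' : u ∈ Icc t₀ τ := ⟨hu.1, hu.2.trans ht.2⟩
        have hc := le_abs_self c
        refine ⟨w, hwd, hwr, ?_, by linarith⟩
        refine ((M.sharp _).le_opNorm _).trans (mul_le_mul (hb _) ?_ (norm_nonneg _) hb0)
        refine (norm_add_le _ _).trans (add_le_add ?_ ?_)
        · exact (norm_sub_le _ _).trans (add_le_add (h2.trans hc) (hahat u hu'))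
        · rw [norm_smul, Real.norm_eq_abs, abs_of_pos hα]
          gcongr
          exact (norm_sub_le _ _).trans (add_le_add (h1.trans hc) (hvhat u hu')))
    exact ⟨this.2.2.2.1.trans (le_abs_self B), this.2.1.trans (le_abs_self B)⟩
  have hττ : τ ∈ Icc t₀ τ := ⟨hτ.1, le_rfl⟩
  have hq : ‖NodeState.q (s τ)‖ ≤ ‖s₀‖ + |B| * L := by
    refine hest Pq (fun x => norm_fst_le (x := x)) |B| (abs_nonneg B) τ hττ ?_
    filter_upwards [hw, ae_restrict_mem measurableSet_Icc] with u ⟨w, hwd, hwr, _⟩ hu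
    refine ⟨w, hwd, ?_⟩
    have : Pq w = NodeState.dq (s u) := hwr.1
    rw [this]
    exact (hmot u hu).1
  have hθ : ‖NodeState.θhat (s τ)‖ ≤ ‖M.θ‖ + |B| := by
    have : ‖NodeState.θhat (s τ)‖ ≤ ‖M.θ‖ + ‖NodeState.θhat (s τ) - M.θ‖ := by
      simpa using norm_add_le M.θ (NodeState.θhat (s τ) - M.θ)
    linarith [(hmot τ hττ).2]
  have hdq := (hmot τ hττ).1
  have hz := hzeta τ hττ
  have hBL : 0 ≤ |B| * L := mul_nonneg (abs_nonneg B) hL0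
  have h0 := norm_nonneg s₀
  have h0' := norm_nonneg M.θ
  have hB0 := abs_nonneg B
  have hfin : ‖s τ‖ = max ‖NodeState.q (s τ)‖ (max ‖NodeState.dq (s τ)‖
      (max ‖NodeState.θhat (s τ)‖ ‖P3 (s τ)‖)) := rfl
  rw [hfin, max_lt_iff, max_lt_iff, max_lt_iff]
  refine ⟨?_, ?_, ?_, ?_⟩ <;> linarith

theorem exists_norm_auxAcc_le (hM : M.Regular t₀) (hα : 0 < G.α) (R : ℝ) : ∃ B, ∀ t s, t₀ ≤ t →
    ‖NodeState.dq s‖ ≤ R → ‖NodeState.vhat s‖ ≤ R → ‖NodeState.ahat s‖ ≤ R →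
    ‖trackErr M s‖ ≤ R → ‖auxAcc M G t s‖ ≤ B := by
  obtain ⟨b, hb⟩ := hM.sharp_bdd
  obtain ⟨b', hb'⟩ := hM.sharp_deriv_bdd
  obtain ⟨j, hj⟩ := hM.J_bdd
  obtain ⟨N, hN⟩ := hM.nullφ_deriv_bdd
  have hb0 : 0 ≤ b := (norm_nonneg _).trans (hb 0)
  have hb'0 : 0 ≤ b' := (norm_nonneg (fderiv ℝ M.sharp 0)).trans (hb' 0)
  have hj0 : 0 ≤ j := (norm_nonneg _).trans (hj 0)
  have hN0 : 0 ≤ N := (norm_nonneg _).trans (hN t₀ 0 le_rfl)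
  refine ⟨b' * R * (R + G.α * R) + b * (R + G.α * (j * R + R)) + N * max 1 R,
    fun t s ht h1 h2 h3 h4 => ?_⟩
  have hR : 0 ≤ R := (norm_nonneg _).trans h1
  refine (norm_add₃_le).trans (add_le_add (add_le_add ?_ ?_) ?_)
  · refine (ContinuousLinearMap.le_opNorm _ _).trans (mul_le_mul ?_ ?_ (norm_nonneg _)
      (by positivity))
    · exact (ContinuousLinearMap.le_opNorm _ _).trans (mul_le_mul (hb' _) h1 (norm_nonneg _) hb'0)
    · refine (norm_sub_le _ _).trans (add_le_add h2 ?_)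
      rw [norm_smul, Real.norm_eq_abs, abs_of_pos hα]
      exact mul_le_mul_of_nonneg_left h4 hα.le
  · refine (ContinuousLinearMap.le_opNorm _ _).trans (mul_le_mul (hb _) ?_ (norm_nonneg _) hb0)
    refine (norm_sub_le _ _).trans (add_le_add h3 ?_)
    rw [norm_smul, Real.norm_eq_abs, abs_of_pos hα]
    refine mul_le_mul_of_nonneg_left ((norm_sub_le _ _).trans (add_le_add ?_ h2)) hα.le
    exact (ContinuousLinearMap.le_opNorm _ _).trans (mul_le_mul (hj _) h1 (norm_nonneg _) hj0)
  · refine (ContinuousLinearMap.le_opNorm _ _).trans (mul_le_mul (hN _ _ ht) ?_ (norm_nonneg _) hN0)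
    rw [Prod.norm_mk, norm_one]
    exact max_le_max le_rfl h1

/-- Together with the bound on the auxiliary acceleration this bounds ŝ', and thus makes ŝ
Lipschitz. The constant has to be uniform in q, since q itself may be unbounded. -/
theorem exists_norm_switchedAcc_le (hM : M.Regular t₀) (R : ℝ) : ∃ B, ∀ t s σ, t₀ ≤ t →
    ‖NodeState.dq s‖ ≤ R → ‖auxVel M G t s‖ ≤ R → ‖auxAcc M G t s‖ ≤ R →
    ‖NodeState.θhat s‖ ≤ R → ‖sHat M G t s‖ ≤ R → IsSignOf σ (sHat M G t s) →
    ‖switchedAcc M G t s (M.d t) σ‖ ≤ B := by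
  obtain ⟨c, hc0, hc⟩ := hM.norm_H_inverse_le
  obtain ⟨y, hy⟩ := hM.Y_bdd R
  obtain ⟨j, hj⟩ := hM.J_bdd
  obtain ⟨C, hC0, hC⟩ := hM.C_bdd
  obtain ⟨g, hg⟩ := hM.g_bdd
  obtain ⟨D, hD⟩ := hM.d_bdd
  obtain ⟨kx, hkx0, hkx⟩ := exists_norm_matAct_le G.Kx
  obtain ⟨ks, hks0, hks⟩ := exists_norm_matAct_le G.Ks
  obtain ⟨kr, hkr0, hkr⟩ := exists_norm_matAct_le G.Kr
  have hj0 : 0 ≤ j := (norm_nonneg _).trans (hj 0)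
  refine ⟨c * (y * R + j * (kx * (j * R)) + ks * R + kr * p + C * R * R + g + D),
    fun t s σ ht h1 h2 h3 h4 h5 h6 => ?_⟩
  have hR : 0 ≤ R := (norm_nonneg _).trans h1
  have hy' : ‖regressor M G t s‖ ≤ y := hy _ _ _ _ h1 h2 h3
  have hy0 : 0 ≤ y := (norm_nonneg _).trans hy'
  refine (hc _ _).trans (mul_le_mul_of_nonneg_left ?_ hc0)
  refine (norm_sub_le _ _).trans (add_le_add ?_ (hD t ht))
  refine (norm_sub_le _ _).trans (add_le_add ?_ (hg _))
  refine (norm_sub_le _ _).trans (add_le_add ?_ ?_)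
  · refine (norm_sub_le _ _).trans (add_le_add ?_ ?_)
    · refine (norm_sub_le _ _).trans (add_le_add ?_ ?_)
      · refine (norm_sub_le _ _).trans (add_le_add ?_ ?_)
        · exact (ContinuousLinearMap.le_opNorm _ _).trans (mul_le_mul hy' h4 (norm_nonneg _) hy0)
        · refine (ContinuousLinearMap.le_opNorm _ _).trans ?_
          rw [norm_adjoint_eq]
          refine mul_le_mul (hj _) ((hkx _).trans ?_) (norm_nonneg _) hj0
          refine mul_le_mul_of_nonneg_left ?_ hkx0
          exact (ContinuousLinearMap.le_opNorm _ _).trans (mul_le_mul (hj _) h5 (norm_nonneg _) hj0)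
      · exact (hks _).trans (mul_le_mul_of_nonneg_left h5 hks0)
    · exact (hkr _).trans (mul_le_mul_of_nonneg_left h6.norm_le hkr0)
  · refine (ContinuousLinearMap.le_opNorm _ _).trans (mul_le_mul ?_ h1 (norm_nonneg _)
      (by positivity))
    exact (hC _ _).trans (mul_le_mul_of_nonneg_left h1 hC0.le)

/-- If the estimates of a node are, from some time on, bounded and successive derivatives of each
other, then the manipulator tracks them and its subtask error tends to zero. -/
theorem node_converges (hM : M.Regular t₀) (hG : G.Admissible M t₀) {t₁ v : ℝ} (ht₁ : t₀ ≤ t₁)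
    {s : ℝ → NodeState m p k} (hs : ∀ T, t₁ ≤ T → AbsolutelyContinuousOnInterval s t₁ T)
    (hv : ∀ t, t₁ ≤ t → ‖NodeState.vhat (s t)‖ ≤ v) (ha : ∀ t, t₁ ≤ t → ‖NodeState.ahat (s t)‖ ≤ v)
    (hw : ∀ᵐ t ∂volume.restrict (Ici t₁), ∃ w, HasDerivAt s w t ∧ NodeRates M G t (s t) w ∧
      NodeState.xhat w = NodeState.vhat (s t) ∧ NodeState.vhat w = NodeState.ahat (s t)) :
    Tendsto (fun t => trackErr M (s t)) atTop (𝓝 0) ∧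
    Tendsto (fun t => taskVel M (s t) - NodeState.vhat (s t)) atTop (𝓝 0) ∧
    Tendsto (fun t => subtaskError M t (s t)) atTop (𝓝 0) := by
  -- The mismatch vanishes, so the energy budget is 0 and the bound B does not depend on the length
  -- of the time interval.
  obtain ⟨B, hB⟩ := exists_motion_bound hM hG
    (max (nodeEnergy M G t₁ (s t₁)) (‖trackErr M (s t₁)‖ ^ 2)) v 0
  have hmis : ∀ {t w}, NodeState.xhat w = NodeState.vhat (s t) →
      NodeState.vhat w = NodeState.ahat (s t) → auxMismatch M G (s t) w = 0 := fun h1 h2 => by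
    rw [auxMismatch, h1, h2]; simp
  have hbd : ∀ t, t₁ ≤ t → ‖sHat M G t (s t)‖ ≤ B ∧ ‖NodeState.θhat (s t) - M.θ‖ ≤ B ∧
      ‖trackErr M (s t)‖ ≤ B ∧ ‖NodeState.dq (s t)‖ ≤ B ∧ ‖auxVel M G t (s t)‖ ≤ B := by
    intro t ht
    refine hB t₁ t 0 ht₁ ht le_rfl (by simp) s (hs t ht) (le_max_left _ _) (le_max_right _ _)
      (fun u hu => hv u hu.1) ?_
    filter_upwards [ae_restrict_Icc_of_Ici hw le_rfl, ae_restrict_mem measurableSet_Icc]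
      with u ⟨w, hwd, hwr, h1, h2⟩ hu
    refine ⟨w, hwd, hwr, ?_, ?_⟩
    · rw [hmis h1 h2, norm_zero]
    · rw [h1]; exact hv u hu.1
  obtain ⟨A, hA⟩ := exists_norm_auxAcc_le (G := G) hM hG.α_pos (max B v)
  obtain ⟨Q, hQ⟩ := exists_norm_switchedAcc_le (G := G) hM (max (max B A) (B + ‖M.θ‖))
  have hAC : ∀ T, t₁ ≤ T → AbsolutelyContinuousOnInterval (fun t => sHat M G t (s t)) t₁ T :=
    fun T hT => absolutelyContinuousOnInterval_sHat hM (hs T hT)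
  have hsd : ∀ᵐ t ∂volume.restrict (Ici t₁), ∃ w,
      HasDerivAt (fun t => sHat M G t (s t)) w t ∧ ‖w‖ ≤ Q + A := by
    filter_upwards [hw, ae_restrict_mem measurableSet_Ici] with t ⟨w, hwd, hwr, h1, h2⟩ ht
    have ht : t₁ ≤ t := ht
    refine ⟨_, hasDerivAt_sHat hM hwd hwr.1, ?_⟩
    rw [hmis h1 h2, sub_zero]
    obtain ⟨b1, b2, b3, b4, b5⟩ := hbd t ht
    have hacc : ‖auxAcc M G t (s t)‖ ≤ A := hA t _ (ht₁.trans ht) (b4.trans (le_max_left _ _))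
      ((hv t ht).trans (le_max_right _ _)) ((ha t ht).trans (le_max_right _ _))
      (b3.trans (le_max_left _ _))
    refine (norm_sub_le _ _).trans (add_le_add ?_ hacc)
    obtain ⟨-, ⟨σ, hσ, hdq⟩, -⟩ := hwr
    rw [hdq]
    have hBm : B ≤ max (max B A) (B + ‖M.θ‖) := (le_max_left _ _).trans (le_max_left _ _)
    refine hQ t _ σ (ht₁.trans ht) (b4.trans hBm) (b5.trans hBm)
      (hacc.trans ((le_max_right _ _).trans (le_max_left _ _))) ?_ (b1.trans hBm) hσ
    refine le_trans ?_ (le_max_right _ _)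
    have : ‖NodeState.θhat (s t)‖ ≤ ‖NodeState.θhat (s t) - M.θ‖ + ‖M.θ‖ := by
      simpa using norm_add_le (NodeState.θhat (s t) - M.θ) M.θ
    linarith
  have hLip : LipschitzOnWith (Q + A).toNNReal (fun t => sHat M G t (s t)) (Ici t₁) := by
    have hle : ∀ a b, t₁ ≤ a → a ≤ b →
        ‖sHat M G b (s b) - sHat M G a (s a)‖ ≤ (Q + A).toNNReal * (b - a) := by
      intro a b ha hab
      refine (((hAC b (ha.trans hab)).mono_Icc ha hab le_rfl).norm_sub_le hab
        (ae_restrict_Icc_of_Ici hsd ha)).trans ?_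
      exact mul_le_mul_of_nonneg_right (Real.le_coe_toNNReal _) (sub_nonneg.2 hab)
    refine LipschitzOnWith.of_dist_le_mul fun a ha b hb => ?_
    rcases le_total a b with h | h
    · rw [dist_comm, dist_comm a b, dist_eq_norm, Real.dist_eq, abs_of_nonneg (sub_nonneg.2 h)]
      exact hle a b ha h
    · rw [dist_eq_norm, Real.dist_eq, abs_of_nonneg (sub_nonneg.2 h)]
      exact hle b a hb h
  obtain ⟨lam, hlam, hKs⟩ := exists_coercive_of_posDef hG.Ks_pos
  have hs0 : Tendsto (fun t => sHat M G t (s t)) atTop (𝓝 0) := by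
    refine tendsto_zero_of_lyapunov (V := fun t => nodeEnergy M G t (s t)) hlam hLip
      (fun t => nodeEnergy_nonneg hM hG t _)
      (fun T hT => absolutelyContinuousOnInterval_nodeEnergy hM (hs T hT)) ?_
    filter_upwards [hw, ae_restrict_mem measurableSet_Ici] with t ⟨w, hwd, hwr, h1, h2⟩ ht d hd
    have h3 := deriv_nodeEnergy_le hM hG (ht₁.trans ht) hwd hwr hd
    rw [hmis h1 h2, map_zero, inner_zero_left] at h3
    have := hKs (sHat M G t (s t))
    linarith
  -- Used with J for the tracking error and with the null-space projection for the subtask error.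
  have happ : ∀ {F : Type} [NormedAddCommGroup F] [NormedSpace ℝ F] (A : Euc p → Euc p →L[ℝ] F)
      (c : ℝ), (∀ q, ‖A q‖ ≤ c) →
      Tendsto (fun t => A (NodeState.q (s t)) (sHat M G t (s t))) atTop (𝓝 0) := by
    intro F _ _ A c hc
    refine squeeze_zero_norm (a := fun t => c * ‖sHat M G t (s t)‖) (fun t => ?_) ?_
    · exact ((A _).le_opNorm _).trans (mul_le_mul_of_nonneg_right (hc _) (norm_nonneg _))
    · simpa using hs0.norm.const_mul c
  obtain ⟨j, hj⟩ := hM.J_bdd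
  obtain ⟨b, hb⟩ := hM.sharp_bdd
  have hJs := happ M.J j hj
  have hr : Tendsto (fun t => trackErr M (s t)) atTop (𝓝 0) := by
    have h1 : Tendsto (fun t => ‖trackErr M (s t)‖ ^ 2) atTop (𝓝 0) := by
      refine tendsto_zero_of_deriv_le (y := fun t => ‖trackErr M (s t)‖ ^ 2) hG.α_pos
        (fun t => sq_nonneg _) (t₀ := t₁)
        (k := fun t => G.α⁻¹ * ‖M.J (NodeState.q (s t)) (sHat M G t (s t))‖ ^ 2)
        (fun T hT => absolutelyContinuousOnInterval_norm_sq_trackErr hM (hs T hT)) ?_ ?_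
      · simpa using (hJs.norm.pow 2).const_mul G.α⁻¹
      · filter_upwards [hw] with t ⟨w, hwd, hwr, h1, h2⟩ d hd
        have := deriv_norm_sq_trackErr_le hM hG.α_pos hwd hwr.1 hd
        rwa [h1, sub_self, add_zero] at this
    have h2 := h1.sqrt
    simp only [Real.sqrt_sq (norm_nonneg _), Real.sqrt_zero] at h2
    exact tendsto_zero_iff_norm_tendsto_zero.2 h2
  refine ⟨hr, ?_, ?_⟩
  · have h1 : ∀ t, taskVel M (s t) - NodeState.vhat (s t) =
        M.J (NodeState.q (s t)) (sHat M G t (s t)) - G.α • trackErr M (s t) := fun t => by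
      rw [taskVel_eq (G := G) hM t]; abel
    simp only [h1]
    simpa using hJs.sub (hr.const_smul G.α)
  · simp only [subtaskError_eq (G := G) hM]
    refine happ M.nullProj (1 + b * j) fun q => ?_
    refine (norm_sub_le _ _).trans (add_le_add ContinuousLinearMap.norm_id_le ?_)
    exact (ContinuousLinearMap.opNorm_comp_le _ _).trans (mul_le_mul (hb q) (hj q) (norm_nonneg _)
      ((norm_nonneg _).trans (hb q)))

end Node

/-! ### The closed-loop network as a switched vector field -/

section Node

variable {m p k : ℕ} {M : Manipulator m p k} {G : Gains m p k} {t₀ : ℝ}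

theorem continuous_auxAcc (hM : M.Regular t₀) :
    Continuous fun y : ℝ × NodeState m p k => auxAcc M G y.1 y.2 := by
  have hs := hM.contDiff_sharp.continuous
  have hs' := hM.contDiff_sharp.continuous_fderiv one_ne_zero
  have hn' := hM.contDiff_nullφ.continuous_fderiv one_ne_zero
  have hJ := hM.contDiff_J.continuous
  have hψ := hM.ψ_smooth.continuous
  unfold auxAcc taskVel taskPos NodeState.q NodeState.dq NodeState.xhat NodeState.vhat NodeState.ahat
  fun_prop

theorem continuous_regressor (hM : M.Regular t₀) :
    Continuous fun y : ℝ × NodeState m p k => regressor M G y.1 y.2 := by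
  have h1 := continuous_auxAcc (G := G) hM
  have h2 := (contDiff_auxVel (G := G) hM).continuous
  unfold regressor
  refine hM.Y_cont.comp (f := fun y : ℝ × NodeState m p k =>
    (NodeState.q y.2, NodeState.dq y.2, auxVel M G y.1 y.2, auxAcc M G y.1 y.2)) ?_
  unfold NodeState.q NodeState.dq
  fun_prop

theorem continuous_adaptation (hM : M.Regular t₀) :
    Continuous fun y : ℝ × NodeState m p k => adaptation M G y.1 y.2 := by
  have h1 := continuous_regressor (G := G) hM
  have h2 := (contDiff_sHat (G := G) hM).continuous
  unfold adaptation
  refine ((continuous_matAct G.T).comp ?_).neg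
  exact ((adjointL k p).continuous.comp h1).clm_apply h2

theorem continuous_switchedAcc (hM : M.Regular t₀) :
    Continuous fun y : (ℝ × NodeState m p k) × Euc p × Euc p =>
      switchedAcc M G y.1.1 y.1.2 y.2.1 y.2.2 := by
  have h1 := (continuous_regressor (G := G) hM).comp
    (continuous_fst (X := ℝ × NodeState m p k) (Y := Euc p × Euc p))
  have h2 := (contDiff_sHat (G := G) hM).continuous.comp
    (continuous_fst (X := ℝ × NodeState m p k) (Y := Euc p × Euc p))
  have hJ := hM.contDiff_J.continuous
  have hg := hM.g_cont
  have hq : Continuous fun y : (ℝ × NodeState m p k) × Euc p × Euc p => NodeState.q y.1.2 := by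
    unfold NodeState.q; fun_prop
  have hdq : Continuous fun y : (ℝ × NodeState m p k) × Euc p × Euc p => NodeState.dq y.1.2 := by
    unfold NodeState.dq; fun_prop
  have hθ : Continuous fun y : (ℝ × NodeState m p k) × Euc p × Euc p => NodeState.θhat y.1.2 := by
    unfold NodeState.θhat; fun_prop
  have hC := hM.C_cont.comp (hq.prodMk hdq)
  unfold switchedAcc
  refine (hM.continuous_H_inverse.comp hq).clm_apply ?_
  refine Continuous.sub (Continuous.sub (Continuous.sub (Continuous.sub (Continuous.sub
    (Continuous.sub (h1.clm_apply hθ) ?_) ?_) ?_) (hC.clm_apply hdq)) (hg.comp hq)) (by fun_prop)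
  · exact ((adjointL p m).continuous.comp (hJ.comp hq)).clm_apply
      ((continuous_matAct G.Kx).comp ((hJ.comp hq).clm_apply h2))
  · exact (continuous_matAct G.Ks).comp h2
  · exact (continuous_matAct G.Kr).comp (by fun_prop)

/-- The acceleration is affine in the signs, not linear; a + b = 1 takes care of the sign-free part.
-/
theorem switchedAcc_affine (t : ℝ) (s : NodeState m p k) (e σ τ : Euc p) {a b : ℝ}
    (hab : a + b = 1) : switchedAcc M G t s e (a • σ + b • τ) =
      a • switchedAcc M G t s e σ + b • switchedAcc M G t s e τ := by
  unfold switchedAcc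
  rw [← map_smul, ← map_smul, ← map_add]
  congr 1
  obtain rfl : b = 1 - a := by linarith
  simp only [map_add, map_smul]
  module

theorem exists_switchedAcc_lipschitz (hM : M.Regular t₀) : ∃ c, 0 ≤ c ∧ ∀ t s e e' σ,
    ‖switchedAcc M G t s e σ - switchedAcc M G t s e' σ‖ ≤ c * ‖e - e'‖ := by
  obtain ⟨c, hc0, hc⟩ := hM.norm_H_inverse_le
  refine ⟨c, hc0, fun t s e e' σ => ?_⟩
  unfold switchedAcc
  rw [← map_sub, sub_sub_sub_cancel_left, norm_sub_rev e e']
  exact hc _ _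

/-- Displacement of the state of a node that compensates a change of the leader's state and the
dependence of `ŝ` on the time. -/
def nodeShift (M : Manipulator m p k) (G : Gains m p k) (t t' : ℝ) (c : Euc m × Euc m × Euc m)
    (s : NodeState m p k) : NodeState m p k :=
  (s.1, s.2.1 - auxVel M G t' s + auxVel M G t (s.1, s.2.1, s.2.2.1, s.2.2.2 + c), s.2.2.1,
    s.2.2.2 + c)

/-- `auxVel` does not involve the joint velocity, so adding its increment to the velocity restores ŝ
exactly. -/
theorem sHat_nodeShift (t t' : ℝ) (c : Euc m × Euc m × Euc m) (s : NodeState m p k) :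
    sHat M G t (nodeShift M G t t' c s) = sHat M G t' s := by
  have : auxVel M G t (nodeShift M G t t' c s) =
      auxVel M G t (s.1, s.2.1, s.2.2.1, s.2.2.2 + c) := rfl
  rw [sHat, this, sHat]
  exact add_sub_cancel_right _ _

theorem nodeShift_self (t : ℝ) (s : NodeState m p k) : nodeShift M G t t 0 s = s := by
  simp [nodeShift]

end Node

namespace Network

variable {n m : ℕ} (S : Network n m)

/-- Index set of all switching surfaces of the network. -/
abbrev SwitchIndex : Type := Σ i : Fin n, Fin (S.p i) ⊕ Fin m ⊕ Fin m ⊕ Fin m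

/-- The arguments of all signum functions of the closed loop. -/
def switchArg (L : Leader m) (y : ℝ × S.State) : S.SwitchIndex → ℝ
  | ⟨i, .inl l⟩ => sHat (S.plant i) (S.gain i) y.1 (y.2 i) l
  | ⟨i, .inr (.inl l)⟩ => S.disagreement (fun j => NodeState.xhat (y.2 j)) (L.x y.1) i l
  | ⟨i, .inr (.inr (.inl l))⟩ => S.disagreement (fun j => NodeState.vhat (y.2 j)) (L.v y.1) i l
  | ⟨i, .inr (.inr (.inr l))⟩ => S.disagreement (fun j => NodeState.ahat (y.2 j)) (L.a y.1) i l

/-- The closed loop with given disturbances and with given signs. -/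
def switchedLoop (y : ℝ × S.State) (e : ∀ i, Euc (S.p i)) (σ : S.SwitchIndex → ℝ) : S.State :=
  fun i =>
  (NodeState.dq (y.2 i),
   switchedAcc (S.plant i) (S.gain i) y.1 (y.2 i) (e i) (WithLp.toLp 2 fun l => σ ⟨i, .inl l⟩),
   adaptation (S.plant i) (S.gain i) y.1 (y.2 i),
   -(S.β₁ • WithLp.toLp 2 fun l => σ ⟨i, .inr (.inl l)⟩),
   -(S.β₂ • WithLp.toLp 2 fun l => σ ⟨i, .inr (.inr (.inl l))⟩),
   -(S.β₃ • WithLp.toLp 2 fun l => σ ⟨i, .inr (.inr (.inr l))⟩))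

theorem closedLoop_eq (L : Leader m) (t : ℝ) (z : S.State) :
    S.closedLoop L t z = S.switchedLoop (t, z) (fun i => (S.plant i).d t)
      (signVec (S.switchArg L (t, z))) := by
  funext i
  simp only [closedLoop, switchedLoop]
  rfl

variable {S}

theorem disagreement_add (y : Fin n → Euc m) (y₀ c : Euc m) (i : Fin n) :
    S.disagreement (fun j => y j + c) (y₀ + c) i = S.disagreement y y₀ i := by
  simp [disagreement]

theorem continuous_disagreement (i : Fin n) :
    Continuous fun y : (Fin n → Euc m) × Euc m => S.disagreement y.1 y.2 i := by
  unfold disagreement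
  fun_prop

theorem continuous_switchedLoop {t₀ : ℝ} (hS : S.Standing t₀) :
    Continuous fun p : (ℝ × S.State) × (∀ i, Euc (S.p i)) × (S.SwitchIndex → ℝ) =>
      S.switchedLoop p.1 p.2.1 p.2.2 := by
  refine continuous_pi fun i => ?_
  have hz : Continuous fun p : (ℝ × S.State) × (∀ i, Euc (S.p i)) × (S.SwitchIndex → ℝ) =>
      (p.1.1, p.1.2 i) := by fun_prop
  have he : Continuous fun p : (ℝ × S.State) × (∀ i, Euc (S.p i)) × (S.SwitchIndex → ℝ) =>
      p.2.1 i := by fun_prop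
  have hσ : Continuous fun p : (ℝ × S.State) × (∀ i, Euc (S.p i)) × (S.SwitchIndex → ℝ) =>
      (WithLp.toLp 2 fun l => p.2.2 ⟨i, .inl l⟩ : Euc (S.p i)) := by fun_prop
  have h1 : Continuous fun p : (ℝ × S.State) × (∀ i, Euc (S.p i)) × (S.SwitchIndex → ℝ) =>
      NodeState.dq (p.1.2 i) := continuous_fst.comp (continuous_snd.comp (continuous_snd.comp hz))
  have h2 : Continuous fun p : (ℝ × S.State) × (∀ i, Euc (S.p i)) × (S.SwitchIndex → ℝ) =>
      switchedAcc (S.plant i) (S.gain i) p.1.1 (p.1.2 i) (p.2.1 i)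
        (WithLp.toLp 2 fun l => p.2.2 ⟨i, .inl l⟩) :=
    (continuous_switchedAcc (G := S.gain i) (hS.regular i)).comp (hz.prodMk (he.prodMk hσ))
  have h3 : Continuous fun p : (ℝ × S.State) × (∀ i, Euc (S.p i)) × (S.SwitchIndex → ℝ) =>
      adaptation (S.plant i) (S.gain i) p.1.1 (p.1.2 i) := by
    have h := (continuous_adaptation (G := S.gain i) (hS.regular i)).comp hz
    exact h
  have h4 : ∀ (β : ℝ) (c : Fin m → S.SwitchIndex), Continuous
      fun p : (ℝ × S.State) × (∀ i, Euc (S.p i)) × (S.SwitchIndex → ℝ) =>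
        -(β • (WithLp.toLp 2 fun l => p.2.2 (c l) : Euc m)) := by
    intro β c
    fun_prop
  exact h1.prodMk (h2.prodMk (h3.prodMk ((h4 _ _).prodMk ((h4 _ _).prodMk (h4 _ _)))))

theorem continuous_switchArg {t₀ : ℝ} (hS : S.Standing t₀) {L : Leader m} (hx : Continuous L.x)
    (hv : Continuous L.v) (ha : Continuous L.a) : Continuous (S.switchArg L) := by
  refine continuous_pi ?_
  have hd : ∀ (i : Fin n) (l : Fin m) (f : S.State → Fin n → Euc m) (g : ℝ → Euc m),
      Continuous f → Continuous g →
      Continuous fun y : ℝ × S.State => S.disagreement (f y.2) (g y.1) i l := by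
    intro i l f g hf hg
    have h1 := (continuous_disagreement (S := S) i).comp
      ((hf.comp continuous_snd).prodMk (hg.comp continuous_fst))
    exact (EuclideanSpace.proj (𝕜 := ℝ) l).continuous.comp h1
  rintro ⟨i, l | l | l | l⟩
  · have h1 := (contDiff_sHat (G := S.gain i) (hS.regular i)).continuous.comp
      (by fun_prop : Continuous fun y : ℝ × S.State => (y.1, y.2 i))
    exact (EuclideanSpace.proj (𝕜 := ℝ) l).continuous.comp h1
  · exact hd i l (fun z j => NodeState.xhat (z j)) _ (by unfold NodeState.xhat; fun_prop) hx
  · exact hd i l (fun z j => NodeState.vhat (z j)) _ (by unfold NodeState.vhat; fun_prop) hv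
  · exact hd i l (fun z j => NodeState.ahat (z j)) _ (by unfold NodeState.ahat; fun_prop) ha

/-- The closed-loop network as a switched vector field. -/
def switchedField {t₀ : ℝ} (hS : S.Standing t₀) {L : Leader m} (hx : Continuous L.x)
    (hv : Continuous L.v) (ha : Continuous L.a) :
    SwitchedField S.State (∀ i, Euc (S.p i)) S.SwitchIndex where
  Φ := S.switchedLoop
  arg := S.switchArg L
  Φ_cont := continuous_switchedLoop hS
  arg_cont := continuous_switchArg hS hx hv ha
  affine y e σ τ a b hab := by
    funext i
    have hlin : ∀ (d : ℕ) (c : Fin d → S.SwitchIndex),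
        (WithLp.toLp 2 fun l => (a • σ + b • τ) (c l) : Euc d) =
          a • (WithLp.toLp 2 fun l => σ (c l)) + b • (WithLp.toLp 2 fun l => τ (c l)) := by
      intro d c
      ext l
      simp
    have hest : ∀ (β : ℝ) (u v : Euc m), -(β • (a • u + b • v)) = a • -(β • u) + b • -(β • v) := by
      intro β u v; module
    have hself : ∀ {F : Type} [AddCommGroup F] [Module ℝ F] (u : F), u = a • u + b • u := by
      intro F _ _ u
      rw [← add_smul, hab, one_smul]
    simp only [Pi.add_apply, Pi.smul_apply]
    refine Prod.ext (hself _) (Prod.ext ?_ (Prod.ext (hself _) (Prod.ext ?_ (Prod.ext ?_ ?_))))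
    · simp only [switchedLoop]
      rw [hlin]
      exact switchedAcc_affine _ _ _ _ _ hab
    all_goals
      simp only [switchedLoop]
      rw [hlin]
      exact hest _ _ _
  lip := by
    choose c hc0 hc using fun i => exists_switchedAcc_lipschitz (G := S.gain i) (hS.regular i)
    refine ⟨∑ i, c i, Finset.sum_nonneg fun i _ => hc0 i, fun y e e' σ => ?_⟩
    have hr : 0 ≤ (∑ i, c i) * ‖e - e'‖ :=
      mul_nonneg (Finset.sum_nonneg fun i _ => hc0 i) (norm_nonneg _)
    refine (pi_norm_le_iff_of_nonneg hr).2 fun i => ?_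
    refine (Prod.norm_def _).trans_le (max_le ?_ ((Prod.norm_def _).trans_le (max_le ?_ ?_)))
    · simpa [switchedLoop] using hr
    · refine (hc i _ _ _ _ _).trans ?_
      exact mul_le_mul (Finset.single_le_sum (f := c) (fun i _ => hc0 i) (Finset.mem_univ i))
        (norm_le_pi_norm (e - e') i) (norm_nonneg _) (Finset.sum_nonneg fun i _ => hc0 i)
    · simpa [switchedLoop] using hr
  shift t y i := nodeShift (S.plant i) (S.gain i) t y.1
    (L.x t - L.x y.1, L.v t - L.v y.1, L.a t - L.a y.1) (y.2 i)
  shift_cont t := by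
    refine continuous_pi fun i => ?_
    have h1 := (contDiff_auxVel (G := S.gain i) (hS.regular i)).continuous
    unfold nodeShift
    fun_prop
  shift_self t z := by
    funext i
    simp only [sub_self]
    exact nodeShift_self _ _
  arg_shift t y := by
    funext c
    rcases c with ⟨i, l | l | l | l⟩
    · simp only [switchArg]
      rw [sHat_nodeShift]
    · have := congrArg (fun u : Euc m => u l) (disagreement_add (S := S)
        (fun j => NodeState.xhat (y.2 j)) (L.x y.1) (L.x t - L.x y.1) i)
      simp only [add_sub_cancel] at this
      exact this
    · have := congrArg (fun u : Euc m => u l) (disagreement_add (S := S)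
        (fun j => NodeState.vhat (y.2 j)) (L.v y.1) (L.v t - L.v y.1) i)
      simp only [add_sub_cancel] at this
      exact this
    · have := congrArg (fun u : Euc m => u l) (disagreement_add (S := S)
        (fun j => NodeState.ahat (y.2 j)) (L.a y.1) (L.a t - L.a y.1) i)
      simp only [add_sub_cancel] at this
      exact this

end Network

/-! ### Filippov solutions of the network -/

theorem filippovMap_subset_krasovskiiMap {X : Type*} [NormedAddCommGroup X] [NormedSpace ℝ X]
    [MeasureSpace X] (g : X → X) (x : X) : filippovMap g x ⊆ krasovskiiMap g x := by
  intro w hw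
  simp only [filippovMap, krasovskiiMap, mem_iInter] at hw ⊢
  intro δ hδ
  simpa using hw δ hδ ∅ measure_empty

/-- A value g y with y near x already lies in the closed hull of the values on a small ball around y
minus N, and this ball lies inside the ball around x. -/
theorem krasovskiiMap_subset_filippovMap {X : Type*} [NormedAddCommGroup X] [NormedSpace ℝ X]
    [MeasureSpace X] {g : X → X} (hg : ∀ y, g y ∈ filippovMap g y) (x : X) :
    krasovskiiMap g x ⊆ filippovMap g x := by
  intro w hw
  simp only [filippovMap, krasovskiiMap, mem_iInter] at hw ⊢
  intro δ hδ N hN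
  refine closure_minimal (convexHull_min ?_ (convex_convexHull ℝ _).closure) isClosed_closure
    (hw δ hδ)
  rintro _ ⟨y, hy, rfl⟩
  have h1 := hg y
  simp only [filippovMap, mem_iInter] at h1
  obtain ⟨r, hr, hsub⟩ := Metric.isOpen_iff.1 Metric.isOpen_ball y hy
  exact closure_mono (convexHull_mono (image_mono (sdiff_subset_sdiff_left hsub))) (h1 r hr N hN)

/-- If every point can be approximated by pairs of points with opposite signs of the vanishing
switching arguments, then the values of a switched vector field lie in its Filippov map. -/
theorem SwitchedField.mem_filippovMap {X E ι : Type*} [NormedAddCommGroup X] [NormedSpace ℝ X]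
    [NormedAddCommGroup E] [Fintype ι] [MeasureSpace X] (S : SwitchedField X E ι) (d : ℝ → E)
    (t : ℝ) (x : X)
    (hflip : ∀ δ > 0, ∀ N : Set X, volume N = 0 → ∃ y ∈ Metric.ball x δ \ N,
      ∃ y' ∈ Metric.ball x δ \ N, ∀ i, Real.sign (S.arg (t, y) i) + Real.sign (S.arg (t, y') i) =
        2 * Real.sign (S.arg (t, x) i)) :
    S.field d t x ∈ filippovMap (S.field d t) x := by
  simp only [filippovMap, mem_iInter]
  intro δ hδ N hN
  rw [Metric.mem_closure_iff]
  intro η hη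
  have h2 := eventually_forall_dist_lt (A := X) (B := ι → ℝ)
    (Ψ := fun p => S.Φ (t, p.1) (d t) p.2)
    (S.Φ_cont.comp (by fun_prop : Continuous fun p : X × (ι → ℝ) => ((t, p.1), d t, p.2)))
    (isCompact_signBox ι) x hη
  obtain ⟨r, hr, hball⟩ := Metric.eventually_nhds_iff_ball.1 h2
  obtain ⟨y, hy, y', hy', hs⟩ := hflip (min δ r) (lt_min hδ hr) N hN
  have hδ' : Metric.ball x (min δ r) \ N ⊆ Metric.ball x δ \ N :=
    sdiff_subset_sdiff_left (Metric.ball_subset_ball (min_le_left _ _))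
  have hr' : Metric.ball x (min δ r) ⊆ Metric.ball x r := Metric.ball_subset_ball (min_le_right _ _)
  refine ⟨(2⁻¹ : ℝ) • S.field d t y + (2⁻¹ : ℝ) • S.field d t y',
    convex_convexHull ℝ (S.field d t '' (Metric.ball x δ \ N))
      (subset_convexHull ℝ _ (mem_image_of_mem _ (hδ' hy)))
      (subset_convexHull ℝ _ (mem_image_of_mem _ (hδ' hy')))
      (by norm_num) (by norm_num) (by norm_num), ?_⟩
  have hsum : signVec (S.arg (t, x)) =
      (2⁻¹ : ℝ) • signVec (S.arg (t, y)) + (2⁻¹ : ℝ) • signVec (S.arg (t, y')) := by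
    funext i
    have := hs i
    simp only [signVec, Pi.add_apply, Pi.smul_apply, smul_eq_mul]
    linarith
  have e : S.field d t x = (2⁻¹ : ℝ) • S.Φ (t, x) (d t) (signVec (S.arg (t, y))) +
      (2⁻¹ : ℝ) • S.Φ (t, x) (d t) (signVec (S.arg (t, y'))) := by
    rw [field, hsum, S.affine _ _ _ _ _ _ (by norm_num)]
  have h3 := hball y (hr' hy.1) (signVec (S.arg (t, y))) fun i => abs_sign_le_one _
  have h4 := hball y' (hr' hy'.1) (signVec (S.arg (t, y'))) fun i => abs_sign_le_one _
  rw [e, dist_eq_norm]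
  rw [dist_comm, dist_eq_norm] at h3 h4
  have e2 : (2⁻¹ : ℝ) • S.Φ (t, x) (d t) (signVec (S.arg (t, y))) +
      (2⁻¹ : ℝ) • S.Φ (t, x) (d t) (signVec (S.arg (t, y'))) -
      ((2⁻¹ : ℝ) • S.field d t y + (2⁻¹ : ℝ) • S.field d t y') =
      (2⁻¹ : ℝ) • (S.Φ (t, x) (d t) (signVec (S.arg (t, y))) - S.field d t y) +
      (2⁻¹ : ℝ) • (S.Φ (t, x) (d t) (signVec (S.arg (t, y'))) - S.field d t y') := by module
  rw [e2]
  refine (norm_add_le _ _).trans_lt ?_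
  rw [norm_smul, norm_smul, Real.norm_eq_abs, abs_of_pos (by norm_num : (0 : ℝ) < 2⁻¹)]
  simp only [field]
  linarith

/-- Translations and e ↦ -e preserve null sets, while a neighbourhood of e₀ has positive measure. -/
theorem exists_symmetric_not_mem {X : Type*} [NormedAddCommGroup X] [NormedSpace ℝ X]
    [FiniteDimensional ℝ X] [MeasurableSpace X] [BorelSpace X] (μ : Measure X) [μ.IsAddHaarMeasure]
    {P : X → Prop} {e₀ : X} (hP : ∀ᶠ e in 𝓝 e₀, P e) (x : X) {N : Set X} (hN : μ N = 0) :
    ∃ e, P e ∧ x + e ∉ N ∧ x - e ∉ N := by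
  have h1 : ∀ᵐ e ∂μ, x + e ∉ N := by
    rw [ae_iff]
    have : {e | ¬x + e ∉ N} = (fun e => x + e) ⁻¹' N := by
      ext e; simp
    rw [this, measure_preimage_add, hN]
  have h2 : ∀ᵐ e ∂μ, x - e ∉ N := by
    rw [ae_iff]
    have : {e | ¬x - e ∉ N} = (fun e => (-1 : ℝ) • e) ⁻¹' ((fun e => x + e) ⁻¹' N) := by
      ext e; simp [sub_eq_add_neg]
    rw [this, Measure.addHaar_preimage_smul μ (by norm_num), measure_preimage_add, hN, mul_zero]
  have hpos : 0 < μ {e | P e} := Measure.measure_pos_of_mem_nhds μ hP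
  by_contra! hcon
  refine hpos.ne' (measure_mono_null ?_ (ae_iff.1 (h1.and h2)))
  intro e he h
  exact h.2 (hcon e he h.1)

instance isAddHaarMeasure_nodeState (m p k : ℕ) :
    (volume : Measure (NodeState m p k)).IsAddHaarMeasure :=
  haveI : (volume : Measure (Euc m × Euc m)).IsAddHaarMeasure :=
    Measure.prod.instIsAddHaarMeasure _ _
  haveI : (volume : Measure (Euc m × Euc m × Euc m)).IsAddHaarMeasure :=
    Measure.prod.instIsAddHaarMeasure _ _
  haveI : (volume : Measure (Euc k × Euc m × Euc m × Euc m)).IsAddHaarMeasure :=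
    Measure.prod.instIsAddHaarMeasure _ _
  haveI : (volume : Measure (Euc p × Euc k × Euc m × Euc m × Euc m)).IsAddHaarMeasure :=
    Measure.prod.instIsAddHaarMeasure _ _
  Measure.prod.instIsAddHaarMeasure _ _

instance borelSpace_nodeState (m p k : ℕ) : BorelSpace (NodeState m p k) :=
  haveI : BorelSpace (Euc m × Euc m) := Prod.borelSpace
  haveI : BorelSpace (Euc m × Euc m × Euc m) := Prod.borelSpace
  haveI : BorelSpace (Euc k × Euc m × Euc m × Euc m) := Prod.borelSpace
  haveI : BorelSpace (Euc p × Euc k × Euc m × Euc m × Euc m) := Prod.borelSpace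
  Prod.borelSpace

instance secondCountableTopology_nodeState (m p k : ℕ) :
    SecondCountableTopology (NodeState m p k) :=
  haveI : SecondCountableTopology (Euc m × Euc m × Euc m) := inferInstance
  haveI : SecondCountableTopology (Euc k × Euc m × Euc m × Euc m) := inferInstance
  inferInstance

instance sigmaFinite_nodeState (m p k : ℕ) : SigmaFinite (volume : Measure (NodeState m p k)) :=
  Measure.IsAddHaarMeasure.sigmaFinite _

instance Network.borelSpace_state {n m : ℕ} (S : Network n m) : BorelSpace S.State :=
  Pi.borelSpace

instance Network.isAddHaarMeasure_state {n m : ℕ} (S : Network n m) :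
    (volume : Measure S.State).IsAddHaarMeasure :=
  Measure.pi.isAddHaarMeasure _

/-! ### Symmetric perturbations of a network state. -/

namespace Network

variable {n m : ℕ} {S : Network n m} {t₀ : ℝ}

theorem disagreement_symm (y e : Fin n → Euc m) (y₀ : Euc m) (i : Fin n) (l : Fin m)
    (h0 : S.disagreement y y₀ i l = 0) :
    S.disagreement (fun j => y j - e j) y₀ i l = -S.disagreement (fun j => y j + e j) y₀ i l := by
  have h1 : S.disagreement (fun j => y j - e j) y₀ i + S.disagreement (fun j => y j + e j) y₀ i =
      (2 : ℝ) • S.disagreement y y₀ i := by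
    simp only [disagreement, smul_add, Finset.smul_sum]
    rw [add_add_add_comm, ← Finset.sum_add_distrib]
    congr 1
    · refine Finset.sum_congr rfl fun j _ => ?_
      module
    · module
  have h2 := congrArg (fun u : Euc m => u l) h1
  simp only [PiLp.add_apply, PiLp.smul_apply, h0, smul_zero] at h2
  linarith

/-- Small perturbations keep nonzero signs. A vanishing disagreement is odd in e, so its two signs
cancel. The components of ŝ are not odd in e, because they depend nonlinearly on q; the
perturbations are therefore taken near an e₀ that moves every component of ŝ by the same positive
amount. That the mean of the two signs is the value at z requires sgn 0 = 0. -/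
theorem exists_symmetric_signs (hS : S.Standing t₀) {L : Leader m} (hx : Continuous L.x)
    (hv : Continuous L.v) (ha : Continuous L.a) (t : ℝ) (z : S.State) {δ : ℝ} (hδ : 0 < δ) :
    ∃ e₀ : S.State, ∀ᶠ e in 𝓝 e₀, ‖e‖ < δ ∧ ∀ c,
      Real.sign (S.switchArg L (t, z + e) c) + Real.sign (S.switchArg L (t, z - e) c) =
        2 * Real.sign (S.switchArg L (t, z) c) := by
  have hcont := continuous_switchArg hS hx hv ha
  have hp : ∀ c, Continuous fun e : S.State => S.switchArg L (t, z + e) c := fun c =>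
    (continuous_apply c).comp (hcont.comp (by fun_prop))
  have hm : ∀ c, Continuous fun e : S.State => S.switchArg L (t, z - e) c := fun c =>
    (continuous_apply c).comp (hcont.comp (by fun_prop))
  -- Only the joint velocities change, so ŝ moves by exactly ε in each component and the auxiliary
  -- velocity does not move.
  let E : ℝ → S.State := fun ε i => (0, WithLp.toLp 2 fun _ => ε, 0, 0, 0, 0)
  have hEc : Continuous E := by
    refine continuous_pi fun i => ?_
    fun_prop
  have hE0 : E 0 = 0 := by
    funext i
    refine Prod.ext rfl (Prod.ext ?_ rfl)
    ext l; rfl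
  have hps : ∀ ε i l, S.switchArg L (t, z + E ε) ⟨i, .inl l⟩ =
      S.switchArg L (t, z) ⟨i, .inl l⟩ + ε := by
    intro ε i l
    have haux : auxVel (S.plant i) (S.gain i) t ((z + E ε) i) =
        auxVel (S.plant i) (S.gain i) t (z i) := by
      have h : (z + E ε) i = (NodeState.q (z i) + 0, NodeState.dq (z i) + WithLp.toLp 2 fun _ => ε,
        NodeState.θhat (z i) + 0, NodeState.xhat (z i) + 0, NodeState.vhat (z i) + 0,
        NodeState.ahat (z i) + 0) := rfl
      rw [h]
      simp only [add_zero]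
      rfl
    have hdq : NodeState.dq ((z + E ε) i) = NodeState.dq (z i) + WithLp.toLp 2 fun _ => ε := rfl
    simp only [switchArg, sHat]
    rw [haux, hdq]
    simp only [PiLp.sub_apply, PiLp.add_apply]
    ring
  have hms : ∀ ε i l, S.switchArg L (t, z - E ε) ⟨i, .inl l⟩ =
      S.switchArg L (t, z) ⟨i, .inl l⟩ - ε := by
    intro ε i l
    have : z - E ε = z + E (-ε) := by
      rw [sub_eq_add_neg]
      congr 1
      funext i
      refine Prod.ext (neg_zero) (Prod.ext ?_ ?_)
      · ext l; rfl
      · simp [E]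
    rw [this, hps]; ring
  have hgood : ∀ c, ∀ᶠ ε in 𝓝[>] (0 : ℝ),
      (0 < S.switchArg L (t, z) c →
        0 < S.switchArg L (t, z + E ε) c ∧ 0 < S.switchArg L (t, z - E ε) c) ∧
      (S.switchArg L (t, z) c < 0 →
        S.switchArg L (t, z + E ε) c < 0 ∧ S.switchArg L (t, z - E ε) c < 0) ∧
      ∀ i l, c = ⟨i, .inl l⟩ → S.switchArg L (t, z) c = 0 →
        0 < S.switchArg L (t, z + E ε) c ∧ S.switchArg L (t, z - E ε) c < 0 := by
    intro c
    have h1 : Tendsto (fun ε => S.switchArg L (t, z + E ε) c) (𝓝[>] 0)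
        (𝓝 (S.switchArg L (t, z) c)) := by
      have := ((hp c).comp hEc).tendsto 0
      simp only [Function.comp_apply, hE0, add_zero] at this
      exact this.mono_left nhdsWithin_le_nhds
    have h2 : Tendsto (fun ε => S.switchArg L (t, z - E ε) c) (𝓝[>] 0)
        (𝓝 (S.switchArg L (t, z) c)) := by
      have := ((hm c).comp hEc).tendsto 0
      simp only [Function.comp_apply, hE0, sub_zero] at this
      exact this.mono_left nhdsWithin_le_nhds
    refine Eventually.and ?_ (Eventually.and ?_ ?_)
    · by_cases h : 0 < S.switchArg L (t, z) c
      · filter_upwards [h1.eventually (lt_mem_nhds h), h2.eventually (lt_mem_nhds h)]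
          with ε h3 h4 _ using ⟨h3, h4⟩
      · simp [h]
    · by_cases h : S.switchArg L (t, z) c < 0
      · filter_upwards [h1.eventually (gt_mem_nhds h), h2.eventually (gt_mem_nhds h)]
          with ε h3 h4 _ using ⟨h3, h4⟩
      · simp [h]
    · filter_upwards [self_mem_nhdsWithin] with ε hε i l hc h0
      subst hc
      rw [hps, hms, h0]
      have : (0 : ℝ) < ε := hε
      constructor <;> linarith
  have hsmall : ∀ᶠ ε in 𝓝[>] (0 : ℝ), ‖E ε‖ < δ := by
    have h1 := (hEc.norm).tendsto 0
    simp only [hE0, norm_zero] at h1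
    exact (h1.mono_left nhdsWithin_le_nhds).eventually (gt_mem_nhds hδ)
  obtain ⟨ε, hε1, hε2⟩ := (hsmall.and (eventually_all.2 hgood)).exists
  refine ⟨E ε, ?_⟩
  have hopen : ∀ c, ∀ᶠ e in 𝓝 (E ε),
      Real.sign (S.switchArg L (t, z + e) c) + Real.sign (S.switchArg L (t, z - e) c) =
        2 * Real.sign (S.switchArg L (t, z) c) := by
    intro c
    obtain ⟨g1, g2, g3⟩ := hε2 c
    rcases lt_trichotomy (S.switchArg L (t, z) c) 0 with h | h | h
    · filter_upwards [(hp c).continuousAt.eventually (gt_mem_nhds (g2 h).1),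
        (hm c).continuousAt.eventually (gt_mem_nhds (g2 h).2)] with e h1 h2
      rw [Real.sign_of_neg h, Real.sign_of_neg h1, Real.sign_of_neg h2]; norm_num
    · have hdis : ∀ e : S.State, S.switchArg L (t, z - e) c = -S.switchArg L (t, z + e) c →
          Real.sign (S.switchArg L (t, z + e) c) + Real.sign (S.switchArg L (t, z - e) c) =
            2 * Real.sign (S.switchArg L (t, z) c) := by
        intro e he
        rw [he, h, Real.sign_zero, Real.sign_neg]; ring
      rcases c with ⟨i, l | l | l | l⟩
      · obtain ⟨g4, g5⟩ := g3 i l rfl h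
        filter_upwards [(hp ⟨i, .inl l⟩).continuousAt.eventually (lt_mem_nhds g4),
          (hm ⟨i, .inl l⟩).continuousAt.eventually (gt_mem_nhds g5)] with e h1 h2
        rw [h, Real.sign_zero, Real.sign_of_pos h1, Real.sign_of_neg h2]; norm_num
      · exact Eventually.of_forall fun e => hdis e
          (disagreement_symm (fun j => NodeState.xhat (z j)) (fun j => NodeState.xhat (e j)) _ i l h)
      · exact Eventually.of_forall fun e => hdis e
          (disagreement_symm (fun j => NodeState.vhat (z j)) (fun j => NodeState.vhat (e j)) _ i l h)
      · exact Eventually.of_forall fun e => hdis e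
          (disagreement_symm (fun j => NodeState.ahat (z j)) (fun j => NodeState.ahat (e j)) _ i l h)
    · filter_upwards [(hp c).continuousAt.eventually (lt_mem_nhds (g1 h).1),
        (hm c).continuousAt.eventually (lt_mem_nhds (g1 h).2)] with e h1 h2
      rw [Real.sign_of_pos h, Real.sign_of_pos h1, Real.sign_of_pos h2]; norm_num
  exact (continuous_norm.continuousAt.eventually (gt_mem_nhds hε1)).and (eventually_all.2 hopen)

theorem field_mem_filippovMap (hS : S.Standing t₀) {L : Leader m} (hx : Continuous L.x)
    (hv : Continuous L.v) (ha : Continuous L.a) (d : ℝ → ∀ i, Euc (S.p i)) (t : ℝ) (z : S.State) :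
    (switchedField hS hx hv ha).field d t z ∈
      filippovMap ((switchedField hS hx hv ha).field d t) z := by
  refine SwitchedField.mem_filippovMap _ d t z fun δ hδ N hN => ?_
  obtain ⟨e₀, he₀⟩ := exists_symmetric_signs hS hx hv ha t z hδ
  obtain ⟨e, ⟨he, hs⟩, h1, h2⟩ := exists_symmetric_not_mem volume he₀ z hN
  refine ⟨z + e, ⟨by simpa using he, h1⟩, z - e, ⟨by simpa using he, h2⟩, hs⟩

end Network

/-- The leader's signals, frozen before the initial time. -/
def Leader.clip {m : ℕ} (L : Leader m) (t₀ : ℝ) : Leader m where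
  x t := L.x (max t t₀)
  v t := L.v (max t t₀)
  a t := L.a (max t t₀)
  da t := L.da (max t t₀)

theorem continuous_comp_max {F : Type*} [NormedAddCommGroup F] [NormedSpace ℝ F] {f f' : ℝ → F}
    {t₀ : ℝ} (h : ∀ t, t₀ ≤ t → HasDerivWithinAt f (f' t) (Ici t₀) t) :
    Continuous fun t => f (max t t₀) := by
  have h1 : ContinuousOn f (Ici t₀) := fun t ht => (h t ht).continuousWithinAt
  exact h1.comp_continuous (by fun_prop) fun t => mem_Ici.2 (le_max_right _ _)

/-! ### A priori bounds and existence of Filippov solutions of the closed loop. -/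

namespace Network

variable {n m : ℕ} {S : Network n m} {t₀ : ℝ} {L : Leader m}

theorem closedLoop_clip (hS : S.Standing t₀) (hx : Continuous (L.clip t₀).x)
    (hv : Continuous (L.clip t₀).v) (ha : Continuous (L.clip t₀).a) {t : ℝ} (ht : t₀ ≤ t) :
    S.closedLoop L t =
      (switchedField hS hx hv ha).field (fun t i => (S.plant i).d (max t t₀)) t := by
  funext z
  have h1 : S.closedLoop L t z = S.closedLoop (L.clip t₀) t z := by
    have e1 : (L.clip t₀).x t = L.x t := by simp [Leader.clip, max_eq_left ht]
    have e2 : (L.clip t₀).v t = L.v t := by simp [Leader.clip, max_eq_left ht]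
    have e3 : (L.clip t₀).a t = L.a t := by simp [Leader.clip, max_eq_left ht]
    funext i
    simp only [closedLoop, e1, e2, e3]
  rw [h1, closedLoop_eq]
  simp only [SwitchedField.field, max_eq_left ht]
  rfl

theorem switchArg_clip {t : ℝ} (ht : t₀ ≤ t) (z : S.State) :
    S.switchArg (L.clip t₀) (t, z) = S.switchArg L (t, z) := by
  funext c
  rcases c with ⟨i, l | l | l | l⟩ <;> simp [switchArg, Leader.clip, max_eq_left ht]

/-- The derivative of a Filippov solution is given by the closed loop with generalized signs. -/
theorem ae_hasDerivAt_switchedLoop (hS : S.Standing t₀) (hL : L.IsTrajectory t₀) {z : ℝ → S.State}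
    (hz : IsFilippovSolution (S.closedLoop L) t₀ z) :
    ∀ᵐ t ∂volume.restrict (Ici t₀), ∃ σ ∈ signSet (S.switchArg L (t, z t)),
      HasDerivAt z (S.switchedLoop (t, z t) (fun i => (S.plant i).d t) σ) t := by
  have hx : Continuous (L.clip t₀).x := continuous_comp_max hL.x_deriv
  have hv : Continuous (L.clip t₀).v := continuous_comp_max hL.v_deriv
  have ha : Continuous (L.clip t₀).a := continuous_comp_max hL.a_deriv
  filter_upwards [hz.2, ae_restrict_mem measurableSet_Ici] with t ⟨w, hw, hwd⟩ ht
  have ht : t₀ ≤ t := ht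
  rw [closedLoop_clip hS hx hv ha ht] at hw
  obtain ⟨σ, hσ, rfl⟩ := SwitchedField.mem_of_mem_krasovskiiMap _ _
    (filippovMap_subset_krasovskiiMap _ _ hw)
  have h1 : σ ∈ signSet (S.switchArg (L.clip t₀) (t, z t)) := hσ
  rw [switchArg_clip ht] at h1
  refine ⟨σ, h1, ?_⟩
  simp only [max_eq_left ht] at hwd
  exact hwd

theorem nodeRates_of_signSet {t : ℝ} {z : S.State} {σ : S.SwitchIndex → ℝ}
    (hσ : σ ∈ signSet (S.switchArg L (t, z))) (i : Fin n) :
    NodeRates (S.plant i) (S.gain i) t (z i)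
      (S.switchedLoop (t, z) (fun i => (S.plant i).d t) σ i) :=
  ⟨rfl, ⟨_, fun l => hσ ⟨i, .inl l⟩, rfl⟩, rfl⟩

theorem norm_estimator_rate_le {σ : S.SwitchIndex → ℝ} (hσ : ∀ c, |σ c| ≤ 1) (β : ℝ)
    (c : Fin m → S.SwitchIndex) :
    ‖-(β • (WithLp.toLp 2 fun l => σ (c l) : Euc m))‖ ≤ |β| * m := by
  rw [norm_neg, norm_smul, Real.norm_eq_abs]
  gcongr
  refine (norm_le_sum_abs _).trans ?_
  calc ∑ l, |σ (c l)| ≤ ∑ _l : Fin m, (1 : ℝ) := Finset.sum_le_sum fun l _ => hσ _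
    _ = m := by simp

theorem _root_.absolutelyContinuousOnInterval_apply {ι : Type*} [Fintype ι] {X : ι → Type*}
    [∀ i, PseudoMetricSpace (X i)] {f : ℝ → ∀ i, X i} {a b : ℝ}
    (hf : AbsolutelyContinuousOnInterval f a b) (i : ι) :
    AbsolutelyContinuousOnInterval (fun t => f t i) a b := by
  have h := ((LipschitzWith.eval (α := X) i).lipschitzOnWith
    (s := univ)).comp_absolutelyContinuousOnInterval hf (mapsTo_univ _ _)
  exact h

/-- The estimator rates are at most |β| m whatever the other nodes do, so the network decouples and
each node obeys its own a priori bound. -/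
theorem exists_network_bound (hS : S.Standing t₀)
    (hgain : ∀ i, (S.gain i).Admissible (S.plant i) t₀) (T : ℝ) (z₀ : S.State) :
    ∃ R, ∀ τ ∈ Icc t₀ T, ∀ z : ℝ → S.State, z t₀ = z₀ →
      AbsolutelyContinuousOnInterval z t₀ τ →
      (∀ᵐ t ∂volume.restrict (Icc t₀ τ), ∃ σ ∈ signSet (S.switchArg L (t, z t)),
        HasDerivAt z (S.switchedLoop (t, z t) (fun i => (S.plant i).d t) σ) t) → ‖z τ‖ < R := by
  set c := (|S.β₁| + |S.β₂| + |S.β₃|) * m with hc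
  choose R hR using fun i => exists_apriori_bound (hS.regular i) (hgain i) c T (z₀ i)
  have hR0 : 0 < ∑ i, |R i| + 1 :=
    add_pos_of_nonneg_of_pos (Finset.sum_nonneg fun i _ => abs_nonneg _) one_pos
  refine ⟨∑ i, |R i| + 1, fun τ hτ z hz0 hz hw => (pi_norm_lt_iff hR0).2 fun i => ?_⟩
  have h1 : ‖z τ i‖ < R i := by
    refine hR i τ hτ (fun t => z t i) (by rw [hz0]) (absolutelyContinuousOnInterval_apply hz i) ?_
    filter_upwards [hw] with t ⟨σ, h2, h3⟩
    have hβ : ∀ β : ℝ, |β| ≤ |S.β₁| + |S.β₂| + |S.β₃| → ∀ c' : Fin m → S.SwitchIndex,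
        ‖-(β • (WithLp.toLp 2 fun l => σ (c' l) : Euc m))‖ ≤ c := fun β hβ c' =>
      (norm_estimator_rate_le (fun c => (h2 c).1) β c').trans (by rw [hc]; gcongr)
    have b1 := abs_nonneg S.β₁
    have b2 := abs_nonneg S.β₂
    have b3 := abs_nonneg S.β₃
    exact ⟨_, hasDerivAt_pi.1 h3 i, nodeRates_of_signSet h2 i, hβ _ (by linarith) _,
      hβ _ (by linarith) _, hβ _ (by linarith) _⟩
  have h2 : |R i| ≤ ∑ i, |R i| :=
    Finset.single_le_sum (f := fun i => |R i|) (fun i _ => abs_nonneg _) (Finset.mem_univ i)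
  linarith [le_abs_self (R i)]

/-- Existence of Filippov solutions of the closed loop, with the components selected by a linear
map `π` frozen if the closed loop is stationary in these components. -/
theorem exists_filippovSolution (hS : S.Standing t₀) (hL : L.IsTrajectory t₀)
    (hgain : ∀ i, (S.gain i).Admissible (S.plant i) t₀) (z₀ : S.State) {Z : Type*}
    [NormedAddCommGroup Z] [NormedSpace ℝ Z] [CompleteSpace Z] (π : S.State →L[ℝ] Z)
    (hπ : ∀ t, t₀ ≤ t → ∀ z, π z = π z₀ → π (S.closedLoop L t z) = 0) :
    ∃ z : ℝ → S.State, z t₀ = z₀ ∧ IsFilippovSolution (S.closedLoop L) t₀ z ∧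
      ∀ t, t₀ ≤ t → π (z t) = π z₀ := by
  have hx : Continuous (L.clip t₀).x := continuous_comp_max hL.x_deriv
  have hv : Continuous (L.clip t₀).v := continuous_comp_max hL.v_deriv
  have ha : Continuous (L.clip t₀).a := continuous_comp_max hL.a_deriv
  set F := switchedField hS hx hv ha
  set d : ℝ → ∀ i, Euc (S.p i) := fun t i => (S.plant i).d (max t t₀)
  have hd : Measurable d := measurable_pi_lambda _ fun i =>
    (hS.regular i).d_meas.comp (measurable_id.max measurable_const)
  choose D hD using fun i => (hS.regular i).d_bdd
  have hdD : ∀ t, ‖d t‖ ≤ ∑ i, |D i| := fun t => by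
    refine (pi_norm_le_iff_of_nonneg (Finset.sum_nonneg fun i _ => abs_nonneg _)).2 fun i => ?_
    refine ((hD i _ (le_max_right _ _)).trans (le_abs_self _)).trans ?_
    exact Finset.single_le_sum (f := fun i => |D i|) (fun i _ => abs_nonneg _) (Finset.mem_univ i)
  obtain ⟨z, hz0, hAC, hzπ, hz⟩ := F.exists_global_solution hd hdD (t₀ := t₀) (z₀ := z₀) (by
      intro T hT
      obtain ⟨R, hR⟩ := exists_network_bound hS hgain T z₀ (L := L)
      refine ⟨R, fun τ hτ z hz0 hz hw => hR τ hτ z hz0 hz ?_⟩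
      filter_upwards [hw, ae_restrict_mem measurableSet_Icc] with t ⟨σ, hσ, hd⟩ ht
      have h2 : σ ∈ signSet (S.switchArg (L.clip t₀) (t, z t)) := hσ
      rw [switchArg_clip ht.1] at h2
      refine ⟨σ, h2, ?_⟩
      simp only [d, max_eq_left ht.1] at hd
      exact hd) π (by
      intro t ht z hz
      rw [← closedLoop_clip hS hx hv ha ht]
      exact hπ t ht z hz)
  refine ⟨z, hz0, ⟨hAC, ?_⟩, hzπ⟩
  filter_upwards [hz, ae_restrict_mem measurableSet_Ici] with t ⟨w, hw, hwd⟩ ht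
  refine ⟨w, ?_, hwd⟩
  rw [closedLoop_clip hS hx hv ha ht]
  exact krasovskiiMap_subset_filippovMap (field_mem_filippovMap hS hx hv ha d t) _ hw

end Network

/-! ### Finite-time consensus of the estimators -/

/-- The sup norm of the positive parts plays the role of the largest error truncated at 0; it is
Lipschitz and makes sense also for n = 0. -/
theorem exists_eq_norm_posPart {n : ℕ} {x : Fin n → ℝ} (h : 0 < ‖fun i => max (x i) 0‖) :
    ∃ i, x i = ‖fun i => max (x i) 0‖ := by
  by_contra! hne
  refine lt_irrefl _ ((pi_norm_lt_iff h).2 fun i => ?_)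
  have h1 := norm_le_pi_norm (fun i => max (x i) 0) i
  rw [Real.norm_eq_abs, abs_of_nonneg (le_max_right _ _)] at h1
  rw [Real.norm_eq_abs, abs_of_nonneg (le_max_right _ _)]
  exact max_lt (lt_of_le_of_ne ((le_max_left _ _).trans h1) (hne i)) h

theorem le_norm_posPart {n : ℕ} (x : Fin n → ℝ) (i : Fin n) : x i ≤ ‖fun i => max (x i) 0‖ := by
  have h1 := norm_le_pi_norm (fun i => max (x i) 0) i
  rw [Real.norm_eq_abs, abs_of_nonneg (le_max_right _ _)] at h1
  exact (le_max_left _ _).trans h1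

theorem lipschitzWith_norm_posPart (n : ℕ) :
    LipschitzWith 1 fun x : Fin n → ℝ => ‖fun i => max (x i) 0‖ := by
  refine LipschitzWith.of_dist_le_mul fun x y => ?_
  rw [NNReal.coe_one, one_mul, Real.dist_eq]
  refine (abs_norm_sub_norm_le _ _).trans ?_
  rw [dist_eq_norm]
  refine (pi_norm_le_iff_of_nonneg (norm_nonneg _)).2 fun i => ?_
  have := norm_le_pi_norm (x - y) i
  simp only [Pi.sub_apply, Real.norm_eq_abs] at this ⊢
  exact (abs_max_sub_max_le_abs _ _ _).trans this

namespace Network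

variable {n m : ℕ} {S : Network n m} {t₀ : ℝ} {L : Leader m}

/-- A component of the disagreement, as a function of the estimation errors. -/
def scalarDisagreement (S : Network n m) (x : Fin n → ℝ) (i : Fin n) : ℝ :=
  (∑ j with 0 < S.ε i j, S.ε i j * (x i - x j)) + S.b i * x i

theorem disagreement_apply (y : Fin n → Euc m) (y₀ : Euc m) (i : Fin n) (l : Fin m) :
    S.disagreement y y₀ i l = S.scalarDisagreement (fun j => y j l - y₀ l) i := by
  simp [disagreement, scalarDisagreement]

theorem scalarDisagreement_neg (x : Fin n → ℝ) (i : Fin n) :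
    S.scalarDisagreement (fun j => -x j) i = -S.scalarDisagreement x i := by
  simp only [scalarDisagreement, neg_add, ← Finset.sum_neg_distrib]
  congr 1
  · exact Finset.sum_congr rfl fun j _ => by ring
  · ring

/-- At a node with maximal error μ > 0 all terms of the disagreement are nonnegative. If none of
these nodes had positive disagreement, none would hear the leader and all their in-neighbours would
be maximal too; following a path backwards would then reach the leader. -/
theorem exists_max_scalarDisagreement_pos (hb : ∀ i, 0 ≤ S.b i) (hA : S.LeaderReachesAll)
    {x : Fin n → ℝ} {μ : ℝ} (hμ : 0 < μ) (hle : ∀ i, x i ≤ μ) (hex : ∃ i, x i = μ) :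
    ∃ i, x i = μ ∧ 0 < S.scalarDisagreement x i := by
  by_contra! hcon
  obtain ⟨i, hi⟩ := hex
  have hterm : ∀ i, x i = μ → ∀ j ∈ Finset.univ.filter (fun j => 0 < S.ε i j),
      0 ≤ S.ε i j * (x i - x j) := fun i hi j hj =>
    mul_nonneg (Finset.mem_filter.1 hj).2.le (by rw [hi]; exact sub_nonneg.2 (hle j))
  -- The property "has maximal error", declared false at the leader, passes from the head of an edge
  -- to its tail.
  have hback : ∀ a c, S.Edge a c → c.elim False (fun i => x i = μ) →
      a.elim False (fun i => x i = μ) := by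
    rintro (_ | j) (_ | i) hac hc
    · exact hc
    · have h1 := hcon i hc
      have h2 := Finset.sum_nonneg (hterm i hc)
      have h3 : 0 < S.b i * x i := mul_pos hac (by rw [show x i = μ from hc]; exact hμ)
      unfold scalarDisagreement at h1
      linarith
    · exact hc.elim
    · have hi : x i = μ := hc
      have hij : 0 < S.ε i j := hac
      have h1 := hcon i hi
      have h3 : 0 ≤ S.b i * x i := mul_nonneg (hb i) (by rw [hi]; exact hμ.le)
      have h4 := Finset.single_le_sum (hterm i hi)
        (Finset.mem_filter.2 ⟨Finset.mem_univ j, hij⟩)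
      unfold scalarDisagreement at h1
      have h5 : S.ε i j * (x i - x j) ≤ 0 := by linarith
      have h6 : x i - x j ≤ 0 := by
        by_contra! h
        exact absurd (mul_pos hij h) h5.not_gt
      exact le_antisymm (hle j) (by linarith)
  have key : (none : Option (Fin n)).elim False (fun i => x i = μ) := by
    refine Relation.TransGen.head_induction_on
      (motive := fun a _ => a.elim False (fun i => x i = μ)) (hA i) ?_ ?_
    · intro a ha
      exact hback _ _ ha hi
    · intro a c hac _ hc
      exact hback _ _ hac hc
  exact key

/-- Where the truncated maximum is differentiable and positive, it has the same derivative as any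
component attaining it: their difference is nonnegative and vanishes at that time. A maximizer with
positive disagreement thus gives the rate -κ. -/
theorem eventually_nonpos_of_deriv_le (hb : ∀ i, 0 ≤ S.b i) (hA : S.LeaderReachesAll) {κ : ℝ}
    (hκ : 0 < κ) {e : ℝ → Fin n → ℝ} (he : ∀ T, t₀ ≤ T → AbsolutelyContinuousOnInterval e t₀ T)
    (hd : ∀ᵐ t ∂volume.restrict (Ici t₀), ∃ w, HasDerivAt e w t ∧
      ∀ i, 0 < S.scalarDisagreement (e t) i → w i ≤ -κ) :
    ∃ T, t₀ ≤ T ∧ ∀ t, T ≤ t → ∀ i, e t i ≤ 0 := by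
  have hAC : ∀ T, t₀ ≤ T →
      AbsolutelyContinuousOnInterval (fun t => ‖fun i => max (e t i) 0‖) t₀ T := fun T hT => by
    have h := ((lipschitzWith_norm_posPart n).lipschitzOnWith
      (s := univ)).comp_absolutelyContinuousOnInterval (he T hT) (mapsTo_univ _ _)
    exact h
  obtain ⟨T, hT, h⟩ := eventually_eq_zero_of_deriv_le hκ hAC (fun t => norm_nonneg _) (by
    filter_upwards [hd] with t ⟨w, hw, hwκ⟩ hpos d hMd
    obtain ⟨i, hi, hD⟩ := exists_max_scalarDisagreement_pos hb hA hpos (le_norm_posPart (e t))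
      (exists_eq_norm_posPart hpos)
    have hmin : IsLocalMin (fun s => ‖fun i => max (e s i) 0‖ - e s i) t := by
      refine Eventually.of_forall fun s => ?_
      have h1 := le_norm_posPart (e s) i
      linarith
    have h0 := hmin.hasDerivAt_eq_zero (hMd.sub (hasDerivAt_pi.1 hw i))
    have := hwκ i hD
    linarith)
  exact ⟨T, hT, fun t ht i => (le_norm_posPart (e t) i).trans (h t ht).le⟩

theorem eventually_eq_zero_of_signed_deriv (hb : ∀ i, 0 ≤ S.b i) (hA : S.LeaderReachesAll) {κ : ℝ}
    (hκ : 0 < κ) {e : ℝ → Fin n → ℝ} (he : ∀ T, t₀ ≤ T → AbsolutelyContinuousOnInterval e t₀ T)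
    (hd : ∀ᵐ t ∂volume.restrict (Ici t₀), ∃ w, HasDerivAt e w t ∧
      ∀ i, (0 < S.scalarDisagreement (e t) i → w i ≤ -κ) ∧
        (S.scalarDisagreement (e t) i < 0 → κ ≤ w i)) :
    ∃ T, t₀ ≤ T ∧ ∀ t, T ≤ t → ∀ i, e t i = 0 := by
  obtain ⟨T, hT, h⟩ := eventually_nonpos_of_deriv_le hb hA hκ he (by
    filter_upwards [hd] with t ⟨w, hw, hwκ⟩ using ⟨w, hw, fun i => (hwκ i).1⟩)
  obtain ⟨T', hT', h'⟩ := eventually_nonpos_of_deriv_le (t₀ := t₀) (e := fun t => -e t) hb hA hκ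
    (fun T hT => (he T hT).neg) (by
      filter_upwards [hd] with t ⟨w, hw, hwκ⟩
      refine ⟨-w, hw.neg, fun i hi => neg_le_neg ((hwκ i).2 ?_)⟩
      have h1 := scalarDisagreement_neg (S := S) (e t) i
      have h2 : 0 < S.scalarDisagreement (fun j => -e t j) i := hi
      linarith)
  refine ⟨max T T', le_max_of_le_left hT, fun t ht i => le_antisymm
    (h t ((le_max_left _ _).trans ht) i) ?_⟩
  have := h' t ((le_max_right _ _).trans ht) i
  simpa using this

/-- Treated component by component: the sign term has size β and the leader derivative at most c <
β, so errors shrink at rate κ = β - c wherever the disagreement has the right sign. -/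
theorem estimates_eventually_eq (hb : ∀ i, 0 ≤ S.b i) (hA : S.LeaderReachesAll) {β : ℝ}
    {y : ℝ → Fin n → Euc m} {y₀ y₀' : ℝ → Euc m}
    (hy : ∀ T, t₀ ≤ T → AbsolutelyContinuousOnInterval y t₀ T)
    (hy₀ : ∀ t, t₀ ≤ t → HasDerivWithinAt y₀ (y₀' t) (Ici t₀) t) (hβ : SupNormLT y₀' t₀ β)
    (hd : ∀ᵐ t ∂volume.restrict (Ici t₀), ∃ σ : Fin n → Euc m,
      HasDerivAt y (fun i => -(β • σ i)) t ∧
        ∀ i, IsSignOf (σ i) (S.disagreement (y t) (y₀ t) i)) :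
    ∃ T, t₀ ≤ T ∧ ∀ t, T ≤ t → ∀ i, y t i = y₀ t := by
  obtain ⟨c, hcβ, hc⟩ := hβ
  have hcomp : ∀ l t, t₀ ≤ t → HasDerivWithinAt (fun t => y₀ t l) (y₀' t l) (Ici t₀) t :=
    fun l t ht => (EuclideanSpace.proj (𝕜 := ℝ) l).hasFDerivAt.comp_hasDerivWithinAt t (hy₀ t ht)
  have hl : ∀ l : Fin m, ∃ T, t₀ ≤ T ∧ ∀ t, T ≤ t → ∀ i, y t i l - y₀ t l = 0 := by
    intro l
    have hLip : LipschitzOnWith |c|.toNNReal (fun t => y₀ t l) (Ici t₀) := by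
      refine (convex_Ici t₀).lipschitzOnWith_of_nnnorm_hasDerivWithin_le (hcomp l) fun t ht => ?_
      rw [← NNReal.coe_le_coe, coe_nnnorm, Real.coe_toNNReal _ (abs_nonneg c)]
      exact (hc t ht l).trans (le_abs_self c)
    let P : (Fin n → Euc m) →L[ℝ] (Fin n → ℝ) := ContinuousLinearMap.pi fun i =>
      (EuclideanSpace.proj (𝕜 := ℝ) l).comp (ContinuousLinearMap.proj i)
    let Q : ℝ →L[ℝ] (Fin n → ℝ) := ContinuousLinearMap.pi fun _ => ContinuousLinearMap.id ℝ ℝ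
    refine eventually_eq_zero_of_signed_deriv (e := fun t i => y t i l - y₀ t l) hb hA
      (sub_pos.2 hcβ) (fun T hT => ?_) ?_
    · have h1 := (P.lipschitz.lipschitzOnWith
        (s := univ)).comp_absolutelyContinuousOnInterval (hy T hT) (mapsTo_univ _ _)
      have h2 := hLip.comp_absolutelyContinuousOnInterval
        (AbsolutelyContinuousOnInterval.id t₀ T)
        (fun t ht => by rw [uIcc_of_le hT] at ht; exact ht.1)
      have h3 := (Q.lipschitz.lipschitzOnWith
        (s := univ)).comp_absolutelyContinuousOnInterval h2 (mapsTo_univ _ _)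
      exact h1.sub h3
    · filter_upwards [hd, ae_restrict_mem measurableSet_Ici,
        ae_restrict_of_ae (Measure.ae_ne volume t₀)] with t ⟨σ, hσ, hs⟩ ht hne
      have ht' : t₀ < t := lt_of_le_of_ne ht hne.symm
      have h0 := (hcomp l t ht).hasDerivAt (Ici_mem_nhds ht')
      have hcl := abs_le.1 (hc t ht l)
      refine ⟨fun i => -(β * σ i l) - y₀' t l, hasDerivAt_pi.2 fun i => ?_, fun i => ?_⟩
      · have h1 := (EuclideanSpace.proj (𝕜 := ℝ) l).hasFDerivAt.comp_hasDerivAt t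
          (hasDerivAt_pi.1 hσ i)
        exact h1.sub h0
      · have h1 := hs i l
        rw [disagreement_apply] at h1
        constructor
        · intro h
          beta_reduce
          rw [h1.2.1 h]; linarith
        · intro h
          beta_reduce
          rw [h1.2.2 h]; linarith
  choose T hT h using hl
  -- A common upper bound for t₀ and all `T l`.
  refine ⟨|t₀| + ∑ l, |T l|, ?_, fun t ht i => ?_⟩
  · have := Finset.sum_nonneg fun l (_ : l ∈ Finset.univ) => abs_nonneg (T l)
    linarith [le_abs_self t₀]
  · ext l
    have h1 := Finset.single_le_sum (f := fun l => |T l|) (fun l _ => abs_nonneg _)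
      (Finset.mem_univ l)
    have h2 : |T l| ≤ ∑ l, |T l| := h1
    exact sub_eq_zero.1 (h l t (by linarith [le_abs_self (T l), abs_nonneg t₀]) i)

/-! ### Sufficiency and necessity of the connectivity assumption -/

/-- The leader estimates of a node, as a linear function of its state. -/
def estimateL (m p k : ℕ) : NodeState m p k →L[ℝ] Euc m × Euc m × Euc m :=
  (ContinuousLinearMap.snd ℝ _ _).comp
    ((ContinuousLinearMap.snd ℝ _ _).comp (ContinuousLinearMap.snd ℝ _ _))

theorem _root_.SupNormLT.exists_norm_le {w : ℝ → Euc m} {β : ℝ} (h : SupNormLT w t₀ β) :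
    ∃ c, ∀ t, t₀ ≤ t → ‖w t‖ ≤ c := by
  obtain ⟨c, -, hc⟩ := h
  refine ⟨∑ _l : Fin m, c, fun t ht => (norm_le_sum_abs _).trans ?_⟩
  exact Finset.sum_le_sum fun l _ => hc t ht l

theorem tasks_of_leaderReachesAll (hS : S.Standing t₀) (hL : L.IsTrajectory t₀)
    (hgain : ∀ i, (S.gain i).Admissible (S.plant i) t₀)
    (hv : SupNormLT L.v t₀ S.β₁) (ha : SupNormLT L.a t₀ S.β₂) (hda : SupNormLT L.da t₀ S.β₃)
    (hA : S.LeaderReachesAll) {z : ℝ → S.State} (hz : IsFilippovSolution (S.closedLoop L) t₀ z) :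
    S.MainTask L z ∧ S.SubTask z := by
  have hder := ae_hasDerivAt_switchedLoop hS hL hz
  have hP : ∀ (π : Euc m × Euc m × Euc m →L[ℝ] Euc m) T, t₀ ≤ T →
      AbsolutelyContinuousOnInterval (fun t i => π (estimateL _ _ _ (z t i))) t₀ T := by
    intro π T hT
    let P : S.State →L[ℝ] (Fin n → Euc m) := ContinuousLinearMap.pi fun i =>
      (π.comp (estimateL _ _ _)).comp (ContinuousLinearMap.proj i)
    have h1 := (P.lipschitz.lipschitzOnWith
        (s := univ)).comp_absolutelyContinuousOnInterval (hz.1 T hT) (mapsTo_univ _ _)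
    exact h1
  have hPd : ∀ (π : Euc m × Euc m × Euc m →L[ℝ] Euc m) {t : ℝ} {w : S.State}, HasDerivAt z w t →
      HasDerivAt (fun t i => π (estimateL _ _ _ (z t i))) (fun i => π (estimateL _ _ _ (w i))) t := by
    intro π t w hw
    refine hasDerivAt_pi.2 fun i => ?_
    exact (π.comp (estimateL _ _ _)).hasFDerivAt.comp_hasDerivAt t (hasDerivAt_pi.1 hw i)
  let π₁ : Euc m × Euc m × Euc m →L[ℝ] Euc m := ContinuousLinearMap.fst ℝ _ _
  let π₂ : Euc m × Euc m × Euc m →L[ℝ] Euc m :=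
    (ContinuousLinearMap.fst ℝ _ _).comp (ContinuousLinearMap.snd ℝ _ _)
  let π₃ : Euc m × Euc m × Euc m →L[ℝ] Euc m :=
    (ContinuousLinearMap.snd ℝ _ _).comp (ContinuousLinearMap.snd ℝ _ _)
  obtain ⟨T₁, hT₁, h₁⟩ := estimates_eventually_eq hS.b_nonneg hA (hP π₁) hL.x_deriv hv (by
    filter_upwards [hder] with t ⟨σ, hσ, hd⟩
    exact ⟨fun i => WithLp.toLp 2 fun l => σ ⟨i, .inr (.inl l)⟩, hPd π₁ hd,
      fun i l => hσ ⟨i, .inr (.inl l)⟩⟩)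
  obtain ⟨T₂, hT₂, h₂⟩ := estimates_eventually_eq hS.b_nonneg hA (hP π₂) hL.v_deriv ha (by
    filter_upwards [hder] with t ⟨σ, hσ, hd⟩
    exact ⟨fun i => WithLp.toLp 2 fun l => σ ⟨i, .inr (.inr (.inl l))⟩, hPd π₂ hd,
      fun i l => hσ ⟨i, .inr (.inr (.inl l))⟩⟩)
  obtain ⟨T₃, hT₃, h₃⟩ := estimates_eventually_eq hS.b_nonneg hA (hP π₃) hL.a_deriv hda (by
    filter_upwards [hder] with t ⟨σ, hσ, hd⟩
    exact ⟨fun i => WithLp.toLp 2 fun l => σ ⟨i, .inr (.inr (.inr l))⟩, hPd π₃ hd,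
      fun i l => hσ ⟨i, .inr (.inr (.inr l))⟩⟩)
  obtain ⟨cv, hcv⟩ := hv.exists_norm_le
  obtain ⟨ca, hca⟩ := ha.exists_norm_le
  set T := max T₁ (max T₂ T₃) with hT
  have hT0 : t₀ ≤ T := hT₁.trans (le_max_left _ _)
  have e₁ : ∀ t, T ≤ t → ∀ i, NodeState.xhat (z t i) = L.x t := fun t ht i =>
    h₁ t ((le_max_left _ _).trans ht) i
  have e₂ : ∀ t, T ≤ t → ∀ i, NodeState.vhat (z t i) = L.v t := fun t ht i =>
    h₂ t (((le_max_left _ _).trans (le_max_right _ _)).trans ht) i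
  have e₃ : ∀ t, T ≤ t → ∀ i, NodeState.ahat (z t i) = L.a t := fun t ht i =>
    h₃ t (((le_max_right _ _).trans (le_max_right _ _)).trans ht) i
  have hconv := fun i => node_converges (hS.regular i) (hgain i) (v := max cv ca) hT0
    (s := fun t => z t i)
    (fun T' hT' => (absolutelyContinuousOnInterval_apply (hz.1 T' (hT0.trans hT')) i).mono_Icc
      hT0 hT' le_rfl)
    (fun t ht => by rw [e₂ t ht]; exact (hcv t (hT0.trans ht)).trans (le_max_left _ _))
    (fun t ht => by rw [e₃ t ht]; exact (hca t (hT0.trans ht)).trans (le_max_right _ _)) (by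
      have hder' := ae_restrict_of_ae_restrict_of_subset (Ici_subset_Ici.2 hT0) hder
      filter_upwards [hder', ae_restrict_mem measurableSet_Ici,
        ae_restrict_of_ae (Measure.ae_ne volume T)] with t ⟨σ, hσ, hd⟩ ht hne
      have ht' : T < t := lt_of_le_of_ne ht hne.symm
      -- In the sliding regime the generalized signs need not be known: x̂ and v̂ coincide with
      -- leader signals near t, so uniqueness of derivatives identifies x̂' with v₀ and v̂' with a₀.
      have hnear : ∀ᶠ s in 𝓝 t, T ≤ s := Ici_mem_nhds ht'
      have ht0 : t₀ < t := hT0.trans_lt ht'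
      refine ⟨_, hasDerivAt_pi.1 hd i, nodeRates_of_signSet hσ i, ?_, ?_⟩
      · rw [e₂ t ht]
        have h1 := hasDerivAt_pi.1 (hPd π₁ hd) i
        have h2 := (hL.x_deriv t ht0.le).hasDerivAt (Ici_mem_nhds ht0)
        refine h1.unique (h2.congr_of_eventuallyEq ?_)
        filter_upwards [hnear] with s hs using e₁ s hs i
      · rw [e₃ t ht]
        have h1 := hasDerivAt_pi.1 (hPd π₂ hd) i
        have h2 := (hL.v_deriv t ht0.le).hasDerivAt (Ici_mem_nhds ht0)
        refine h1.unique (h2.congr_of_eventuallyEq ?_)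
        filter_upwards [hnear] with s hs using e₂ s hs i)
  refine ⟨fun i => ⟨(hconv i).1.congr' ?_, (hconv i).2.1.congr' ?_⟩, fun i _ => (hconv i).2.2⟩
  · filter_upwards [eventually_ge_atTop T] with t ht
    rw [trackErr, e₁ t ht]
  · filter_upwards [eventually_ge_atTop T] with t ht
    rw [e₂ t ht]

theorem disagreement_eq_zero {y : Fin n → Euc m} {y₀ : Euc m} {i : Fin n} (hb : S.b i = 0)
    (h : ∀ j, 0 < S.ε i j → y j = y i) : S.disagreement y y₀ i = 0 := by
  rw [disagreement, hb, zero_smul, add_zero]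
  refine Finset.sum_eq_zero fun j hj => ?_
  rw [h j (Finset.mem_filter.1 hj).2, sub_self, smul_zero]

theorem sgn_zero (d : ℕ) : sgn (0 : Euc d) = 0 := by
  ext l
  simp [sgn]

/-- One Filippov solution suffices: the estimates of all unreachable nodes are frozen at (c, 0, 0),
which are successive derivatives of each other. The end-effector of `i₀` then tends to c, while the
tasks force it to follow the leader. -/
theorem tendsto_of_not_transGen (hS : S.Standing t₀) (hL : L.IsTrajectory t₀)
    (hgain : ∀ i, (S.gain i).Admissible (S.plant i) t₀) (h : S.AchievesTasks L t₀) {i₀ : Fin n}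
    (hi₀ : ¬Relation.TransGen S.Edge none (some i₀)) (c : Euc m) : Tendsto L.x atTop (𝓝 c) := by
  classical
  -- π retains exactly the estimates of the unreachable nodes.
  let π : S.State →L[ℝ] (Fin n → Euc m × Euc m × Euc m) := ContinuousLinearMap.pi fun i =>
    if Relation.TransGen S.Edge none (some i) then 0
    else (estimateL _ _ _).comp (ContinuousLinearMap.proj i)
  have hπi : ∀ {i}, ¬Relation.TransGen S.Edge none (some i) → ∀ z : S.State,
      π z i = estimateL _ _ _ (z i) := by
    intro i hi z
    simp [π, hi]
  let z₀ : S.State := fun i => (0, 0, 0, c, 0, 0)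
  have hest : ∀ {z : S.State}, π z = π z₀ → ∀ {i}, ¬Relation.TransGen S.Edge none (some i) →
      estimateL _ _ _ (z i) = (c, 0, 0) := by
    intro z hz i hi
    rw [← hπi hi, hz, hπi hi]
    rfl
  obtain ⟨z, hz0, hz, hfix⟩ := exists_filippovSolution hS hL hgain z₀ π (by
    intro t _ z hz
    funext i
    by_cases hi : Relation.TransGen S.Edge none (some i)
    · simp [π, hi]
    · have hb : S.b i = 0 := by
        refine le_antisymm (not_lt.1 fun hb => hi (Relation.TransGen.single hb)) (hS.b_nonneg i)
      have hj : ∀ j, 0 < S.ε i j → estimateL _ _ _ (z j) = estimateL _ _ _ (z i) := by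
        intro j hij
        -- A node that sends information to an unreachable node is itself unreachable, since an edge
        -- would prolong the path.
        rw [hest hz hi, hest hz fun hj => hi (hj.tail hij)]
      rw [hπi hi]
      have d₁ := disagreement_eq_zero (S := S) (y := fun j => NodeState.xhat (z j)) (y₀ := L.x t) hb
        fun j hij => congrArg Prod.fst (hj j hij)
      have d₂ := disagreement_eq_zero (S := S) (y := fun j => NodeState.vhat (z j)) (y₀ := L.v t) hb
        fun j hij => congrArg (fun u => u.2.1) (hj j hij)
      have d₃ := disagreement_eq_zero (S := S) (y := fun j => NodeState.ahat (z j)) (y₀ := L.a t) hb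
        fun j hij => congrArg (fun u => u.2.2) (hj j hij)
      have hcl : estimateL _ _ _ (S.closedLoop L t z i) =
        (-(S.β₁ • sgn (S.disagreement (fun j => NodeState.xhat (z j)) (L.x t) i)),
          -(S.β₂ • sgn (S.disagreement (fun j => NodeState.vhat (z j)) (L.v t) i)),
          -(S.β₃ • sgn (S.disagreement (fun j => NodeState.ahat (z j)) (L.a t) i))) := rfl
      rw [hcl, d₁, d₂, d₃, sgn_zero]
      simp)
  have he : ∀ t, t₀ ≤ t → estimateL _ _ _ (z t i₀) = (c, 0, 0) := fun t ht => hest (hfix t ht) hi₀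
  have hx : ∀ t, t₀ ≤ t → NodeState.xhat (z t i₀) = c := fun t ht => congrArg Prod.fst (he t ht)
  have hv : ∀ t, t₀ ≤ t → NodeState.vhat (z t i₀) = 0 := fun t ht =>
    congrArg (fun u => u.2.1) (he t ht)
  have ha : ∀ t, t₀ ≤ t → NodeState.ahat (z t i₀) = 0 := fun t ht =>
    congrArg (fun u => u.2.2) (he t ht)
  have hconv := node_converges (hS.regular i₀) (hgain i₀) (v := 0) le_rfl (s := fun t => z t i₀)
    (fun T hT => absolutelyContinuousOnInterval_apply (hz.1 T hT) i₀)
    (fun t ht => by rw [hv t ht, norm_zero]) (fun t ht => by rw [ha t ht, norm_zero]) (by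
      filter_upwards [ae_hasDerivAt_switchedLoop hS hL hz, ae_restrict_mem measurableSet_Ici,
        ae_restrict_of_ae (Measure.ae_ne volume t₀)] with t ⟨σ, hσ, hd⟩ ht hne
      have ht' : t₀ < t := lt_of_le_of_ne ht hne.symm
      have hnear : ∀ᶠ s in 𝓝 t, t₀ ≤ s := Ici_mem_nhds ht'
      have hdi := hasDerivAt_pi.1 hd i₀
      have h1 : HasDerivAt (fun s => estimateL _ _ _ (z s i₀)) _ t :=
        (estimateL _ _ _).hasFDerivAt.comp_hasDerivAt t hdi
      have h2 : HasDerivAt (fun s => estimateL _ _ _ (z s i₀)) 0 t := by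
        refine (hasDerivAt_const t (c, (0 : Euc m), (0 : Euc m))).congr_of_eventuallyEq ?_
        filter_upwards [hnear] with s hs using he s hs
      have h3 := h1.unique h2
      refine ⟨_, hdi, nodeRates_of_signSet hσ i₀, ?_, ?_⟩
      · rw [hv t ht]; exact congrArg Prod.fst h3
      · rw [ha t ht]; exact congrArg (fun u => u.2.1) h3)
  have hlim := hconv.1.sub ((h.2 z hz).1 i₀).1
  rw [sub_zero] at hlim
  have : Tendsto (fun t => L.x t - c) atTop (𝓝 0) := by
    refine hlim.congr' ?_
    filter_upwards [eventually_ge_atTop t₀] with t ht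
    rw [trackErr, hx t ht]
    abel
  exact tendsto_sub_nhds_zero_iff.1 this

end Network

end

theorem corollary1 {n m : ℕ} (hm : 2 ≤ m) (S : Network n m) (L : Leader m) (t₀ : ℝ) (ht₀ : 0 ≤ t₀)
    (hS : S.Standing t₀) (hL : L.IsTrajectory t₀)
    (hgain : ∀ i, (S.gain i).Admissible (S.plant i) t₀)
    (hβ₁ : 0 < S.β₁) (hβ₂ : 0 < S.β₂) (hβ₃ : 0 < S.β₃)
    (hv : SupNormLT L.v t₀ S.β₁) (ha : SupNormLT L.a t₀ S.β₂) (hda : SupNormLT L.da t₀ S.β₃) :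
    S.AchievesTasks L t₀ ↔ S.LeaderReachesAll := by
  constructor
  · intro h
    by_contra hA
    simp only [Network.LeaderReachesAll, not_forall] at hA
    obtain ⟨i₀, hi₀⟩ := hA
    have h1 := Network.tendsto_of_not_transGen hS hL hgain h hi₀
    -- The leader position would converge both to 0 and to a unit vector.
    have h2 := tendsto_nhds_unique (h1 0) (h1 (EuclideanSpace.single ⟨0, by omega⟩ 1))
    have h3 := congrArg norm h2
    simp at h3
  · intro hA
    refine ⟨fun z₀ => ?_, fun z hz =>
      Network.tasks_of_leaderReachesAll hS hL hgain hv ha hda hA hz⟩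
    -- With the zero map nothing is frozen.
    obtain ⟨z, hz0, hz, -⟩ := Network.exists_filippovSolution hS hL hgain z₀
      (0 : S.State →L[ℝ] ℝ) fun _ _ _ _ => rfl
    exact ⟨z, hz0, hz⟩
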